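/- Let $\mathbf k$ be an algebraically closed field of arbitrary characteristic $p\ge 0$. A *Campana orbifold* $(X,\Delta_\epsilon)$ over $\mathbf k$ is a smooth projective variety $\underline X$ with a strict normal crossings divisor $\Delta=\bigcup_i\Delta_i$ (the $\Delta_i$ irreducible), its associated divisorial log structure, and multiplicities $m_i\in\{1,2,\dots\}\cup\{\infty\}$, where $\Delta_\epsilon=\sum_i(1-\frac1{m_i})\Delta_i$. It is *klt* if all $m_i$ are finite. A finite collection $\varsigma=(\mathbf c_j)_{j=1}^n$ of contact orders $\mathbf c_j=(c_{j,i})_i\in\mathbb Z_{\ge0}^{\{i\}}$, all of them nonzero, is *of Campana type* if for every $i$: when $m_i<\infty$, every $j$ has $c_{j,i}=0$ or $c_{j,i}\ge m_i$; when $m_i=\infty$, at most one $j$ has $c_{j,i}>0$. It is *good* if no $\mathbf c_j$ is divisible by $p$, i.e. for each $j$ there is an $i$ with $p\nmid c_{j,i}$ (where $0$ divides only $0$). Say that $X$ is *separably $\varsigma$-rationally connected* if there are a variety $W$ and a family over $W$ of genus zero non-degenerate stable log maps to $X$ with contact orders $\varsigma$ whose underlying family of curves is $\mathcal U=W\times\mathbb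 P^1\to W$ — that is, $n$ pairwise disjoint sections $p_j$ of $W\times\mathbb P^1\to W$ and a log morphism $ev:\mathcal U\to X$ over $\mathbf k$, for the log structure on $\mathcal U$ defined by the markings, with $ev^*\Delta_i=\sum_j c_{j,i}\,p_j(W)$ for all $i$, such that on each fibre $ev$ is non-constant or $n\ge3$ — for which the morphism of varieties $$ev^{(2)}:\mathcal U\times_W\mathcal U\to X\times X$$ is dominant and separable (its extension of function fields is separably generated). The orbifold $(X,\Delta_\epsilon)$ is *separably Campana rationally connected by good contact orders* if $X$ is separably $\varsigma$-rationally connected for some good $\varsigma$ of Campana type consisting of nonzero contact orders. **Corollary.** Let $\Sigma$ be a fan in $\mathbb R^d$ with respect to the lattice $\mathbb Z^d$, $d\ge1$, let $X_\Sigma$ be its toric variety over $\mathbf k$, and let $\Delta_\Sigma=\bigcup_{\rho\in\Sigma^{(1)}}\Delta_\rho$ be its toric boundary. Let $(X,\Delta_\epsilon)$ be a klt Campana orbifold over $\mathbf k$ whose log scheme is that of $(X_\Sigma,\Delta_\Sigma)$, i.e. there is an isomorphism $\underline X\cong X_\Sigma$ over $\mathbf k$ that identifies $\Delta$ with $\Delta_\Sigma$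 (so $X_\Sigma$ is smooth and projective). Then $(X,\Delta_\epsilon)$ is separably Campana rationally connected by good contact orders. -/

import Mathlib

open CategoryTheory CategoryTheory.Limits AlgebraicGeometry

universe u

namespace Campana

noncomputable section

/-! ## Fans in the lattice `N = ℤ ^ d` and their toric varieties -/

/-- The pairing of a character `m ∈ M = ℤ ^ d` with a vector `v ∈ N_ℝ = ℝ ^ d`. -/
def pairing {d : ℕ} (m : Fin d → ℤ) (v : Fin d → ℝ) : ℝ := ∑ i, (m i : ℝ) * v i

lemma pairing_add {d : ℕ} (a b : Fin d → ℤ) (v : Fin d → ℝ) :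
    pairing (a + b) v = pairing a v + pairing b v := by
  simp [pairing, add_mul, Finset.sum_add_distrib]

/-- The monoid `σ^∨ ∩ M` of the characters that are nonnegative on the cone `σ`. -/
def dualMonoid {d : ℕ} (σ : PointedCone ℝ (Fin d → ℝ)) : AddSubmonoid (Fin d → ℤ) where
  carrier := {m | ∀ v ∈ σ, 0 ≤ pairing m v}
  zero_mem' := by intro v _; simp [pairing]
  add_mem' := by
    intro a b ha hb v hv
    rw [pairing_add]; exact add_nonneg (ha v hv) (hb v hv)

/-- A cone is rational polyhedral if it is generated by finitely many lattice vectors. -/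
def IsRationalPolyhedral {d : ℕ} (σ : PointedCone ℝ (Fin d → ℝ)) : Prop :=
  ∃ S : Finset (Fin d → ℤ), σ = PointedCone.hull ℝ ((fun u i => (u i : ℝ)) '' (S : Set (Fin d → ℤ)))

/-- `τ` is a face of the rational cone `σ`: `τ = σ ∩ m^⊥` for some `m ∈ σ^∨ ∩ M`. -/
def IsFace {d : ℕ} (τ σ : PointedCone ℝ (Fin d → ℝ)) : Prop :=
  ∃ m ∈ dualMonoid σ, ∀ v, v ∈ τ ↔ v ∈ σ ∧ pairing m v = 0

/-- A fan in `N_ℝ = ℝ ^ d` with respect to the lattice `N = ℤ ^ d`. -/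
structure Fan (d : ℕ) where
  cones : Set (PointedCone ℝ (Fin d → ℝ))
  finite : cones.Finite
  nonempty : cones.Nonempty
  rational : ∀ σ ∈ cones, IsRationalPolyhedral σ
  stronglyConvex : ∀ σ ∈ cones, ∀ v ∈ σ, -v ∈ σ → v = 0
  face_mem : ∀ σ ∈ cones, ∀ τ, IsFace τ σ → τ ∈ cones
  inter_face : ∀ σ ∈ cones, ∀ τ ∈ cones, IsFace (σ ⊓ τ) σ ∧ IsFace (σ ⊓ τ) τ

lemma dualMonoid_anti {d : ℕ} {τ σ : PointedCone ℝ (Fin d → ℝ)} (h : τ ≤ σ) :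
    dualMonoid σ ≤ dualMonoid τ := fun _ hm v hv => hm v (h hv)

/-- The restriction map `k[σ^∨ ∩ M] → k[τ^∨ ∩ M]` for `τ ≤ σ`. -/
def chartMap (k : Type u) [Field k] {d : ℕ} {τ σ : PointedCone ℝ (Fin d → ℝ)} (h : τ ≤ σ) :
    AddMonoidAlgebra k (dualMonoid σ) →+* AddMonoidAlgebra k (dualMonoid τ) :=
  AddMonoidAlgebra.mapDomainRingHom k (AddSubmonoid.inclusion (dualMonoid_anti h))

/-- The affine toric variety `U_σ = Spec k[σ^∨ ∩ M]`. -/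
abbrev chart (k : Type u) [Field k] {d : ℕ} (σ : PointedCone ℝ (Fin d → ℝ)) : Scheme.{u} :=
  Spec (.of (AddMonoidAlgebra k (dualMonoid σ)))

lemma pairing_nsmul {d : ℕ} (n : ℕ) (a : Fin d → ℤ) (v : Fin d → ℝ) :
    pairing (n • a) v = n * pairing a v := by
  simp [pairing, Finset.mul_sum, mul_assoc]

lemma pairing_neg {d : ℕ} (a : Fin d → ℤ) (v : Fin d → ℝ) :
    pairing (-a) v = - pairing a v := by
  simp [pairing]

/-- `m ↦ ⟨m, v⟩` is linear in `v`. -/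
def pairingLin {d : ℕ} (m : Fin d → ℤ) : (Fin d → ℝ) →ₗ[ℝ] ℝ where
  toFun := pairing m
  map_add' x y := by simp [pairing, mul_add, Finset.sum_add_distrib]
  map_smul' c x := by simp [pairing, Finset.mul_sum, mul_left_comm]

/-- Every character in `τ^∨` becomes a character in `σ^∨` after adding a multiple of the
character that cuts out the face `τ`. -/
lemma exists_add_nsmul_mem {d : ℕ} {τ σ : PointedCone ℝ (Fin d → ℝ)}
    (hσ : IsRationalPolyhedral σ) {m : Fin d → ℤ} (hm : m ∈ dualMonoid σ)
    (hτ : ∀ v, v ∈ τ ↔ v ∈ σ ∧ pairing m v = 0) {w : Fin d → ℤ} (hw : w ∈ dualMonoid τ) :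
    ∃ n : ℕ, w + n • m ∈ dualMonoid σ := by
  obtain ⟨S, rfl⟩ := hσ
  set c : (Fin d → ℤ) → (Fin d → ℝ) := fun u i => (u i : ℝ) with hc
  have hS : ∀ u ∈ S, c u ∈ PointedCone.hull ℝ (c '' (S : Set (Fin d → ℤ))) := fun u hu =>
    Submodule.subset_span ⟨u, hu, rfl⟩
  have key : ∀ u ∈ S, ∃ n : ℕ, ∀ n' ≥ n, 0 ≤ pairing (w + n' • m) (c u) := by
    intro u hu
    have h0 := hm _ (hS u hu)
    rcases h0.eq_or_lt with h | h
    · refine ⟨0, fun n' _ => ?_⟩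
      rw [pairing_add, pairing_nsmul, ← h, mul_zero, add_zero]
      exact hw _ ((hτ _).2 ⟨hS u hu, h.symm⟩)
    · obtain ⟨n, hn⟩ := exists_nat_gt (-(pairing w (c u)) / pairing m (c u))
      refine ⟨n, fun n' hn' => ?_⟩
      rw [pairing_add, pairing_nsmul]
      rw [div_lt_iff₀ h] at hn
      have : (n : ℝ) * pairing m (c u) ≤ n' * pairing m (c u) := by
        gcongr
      linarith
  choose! f hf using key
  refine ⟨S.sup f, fun v hv => ?_⟩
  refine Submodule.span_induction (p := fun v _ => 0 ≤ pairing (w + (S.sup f) • m) v)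
    ?_ ?_ ?_ ?_ hv
  · rintro _ ⟨u, hu, rfl⟩
    exact hf u hu _ (Finset.le_sup (f := f) hu)
  · simp [pairing]
  · intro x y _ _ hx hy
    have := (pairingLin (w + (S.sup f) • m)).map_add x y
    change pairing _ _ = pairing _ _ + pairing _ _ at this
    rw [this]; exact add_nonneg hx hy
  · intro a x _ hx
    have := (pairingLin (w + (S.sup f) • m)).map_smul (a : ℝ) x
    change pairing _ _ = (a : ℝ) * pairing _ _ at this
    change 0 ≤ pairing _ ((a : ℝ) • x)
    rw [this]; exact mul_nonneg a.2 hx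

lemma chartMap_single (k : Type u) [Field k] {d : ℕ} {τ σ : PointedCone ℝ (Fin d → ℝ)}
    (h : τ ≤ σ) (a : dualMonoid σ) (r : k) :
    chartMap k h (AddMonoidAlgebra.single a r) =
      AddMonoidAlgebra.single (AddSubmonoid.inclusion (dualMonoid_anti h) a) r := by
  simp [chartMap, AddMonoidAlgebra.mapDomainRingHom]

lemma chartMap_refl (k : Type u) [Field k] {d : ℕ} (σ : PointedCone ℝ (Fin d → ℝ)) :
    chartMap k (le_refl σ) = RingHom.id _ := by
  refine AddMonoidAlgebra.ringHom_ext (fun r => ?_) (fun m => ?_) <;>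
    rw [chartMap_single] <;> rfl

lemma chartMap_comp (k : Type u) [Field k] {d : ℕ} {ρ τ σ : PointedCone ℝ (Fin d → ℝ)}
    (h : ρ ≤ τ) (h' : τ ≤ σ) :
    (chartMap k h).comp (chartMap k h') = chartMap k (h.trans h') := by
  refine AddMonoidAlgebra.ringHom_ext (fun r => ?_) (fun m => ?_) <;>
    rw [RingHom.comp_apply, chartMap_single, chartMap_single, chartMap_single] <;> rfl

lemma isLocalization_chartMap (k : Type u) [Field k] {d : ℕ} {τ σ : PointedCone ℝ (Fin d → ℝ)}
    (hσ : IsRationalPolyhedral σ) (h : τ ≤ σ) {m : Fin d → ℤ} (hm : m ∈ dualMonoid σ)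
    (hτ : ∀ v, v ∈ τ ↔ v ∈ σ ∧ pairing m v = 0) :
    @IsLocalization.Away _ _ (AddMonoidAlgebra.single (⟨m, hm⟩ : dualMonoid σ) (1 : k))
      (AddMonoidAlgebra k (dualMonoid τ)) _ (chartMap k h).toAlgebra := by
  let _ := (chartMap k h).toAlgebra
  have halg : ∀ x, algebraMap (AddMonoidAlgebra k (dualMonoid σ))
    (AddMonoidAlgebra k (dualMonoid τ)) x = chartMap k h x := fun _ => rfl
  have hsingle := chartMap_single k h
  have hneg : -m ∈ dualMonoid τ := fun v hv => by
    rw [pairing_neg, ((hτ v).1 hv).2, neg_zero]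
  have hpow : ∀ n : ℕ, (AddMonoidAlgebra.single (⟨m, hm⟩ : dualMonoid σ) (1 : k)) ^ n =
      AddMonoidAlgebra.single (n • (⟨m, hm⟩ : dualMonoid σ)) (1 : k) := by
    intro n; rw [AddMonoidAlgebra.single_pow, one_pow]
  refine IsLocalization.Away.mk _ ?_ ?_ ?_
  · rw [halg, hsingle]
    refine IsUnit.of_mul_eq_one (AddMonoidAlgebra.single (⟨-m, hneg⟩ : dualMonoid τ) 1) ?_
    rw [AddMonoidAlgebra.single_mul_single, AddMonoidAlgebra.one_def]
    congr 1
    · ext; simp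
    · simp
  · intro z
    induction z using AddMonoidAlgebra.induction_linear with
    | zero => exact ⟨0, 0, by simp⟩
    | add f g hf hg =>
      obtain ⟨n, a, ha⟩ := hf
      obtain ⟨n', b, hb⟩ := hg
      refine ⟨n + n', a * (AddMonoidAlgebra.single (⟨m, hm⟩ : dualMonoid σ) (1 : k)) ^ n' +
        b * (AddMonoidAlgebra.single (⟨m, hm⟩ : dualMonoid σ) (1 : k)) ^ n, ?_⟩
      simp only [map_add, map_mul, map_pow, ← ha, ← hb]
      ring
    | single w r =>
      obtain ⟨n, hn⟩ := exists_add_nsmul_mem hσ hm hτ w.2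
      refine ⟨n, AddMonoidAlgebra.single ⟨_, hn⟩ r, ?_⟩
      rw [← map_pow, hpow, halg, halg, hsingle, hsingle, AddMonoidAlgebra.single_mul_single,
        mul_one]
      congr 1
  · intro a b hab
    refine ⟨0, ?_⟩
    rw [pow_zero, one_mul, one_mul]
    exact AddMonoidAlgebra.mapDomain_injective
      (AddSubmonoid.inclusion_injective (dualMonoid_anti h)) hab

namespace Fan

variable {d : ℕ} (F : Fan d)

lemma isFace_of_le {τ σ : PointedCone ℝ (Fin d → ℝ)} (hτ : τ ∈ F.cones) (hσ : σ ∈ F.cones)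
    (h : τ ≤ σ) : IsFace τ σ := by
  have := (F.inter_face σ hσ τ hτ).1
  rwa [inf_eq_right.2 h] at this

/-- The charts `U_σ`, `σ ∈ Σ`, with the open immersions `U_τ → U_σ` for `τ ≤ σ`. -/
def diagram (k : Type u) [Field k] : F.cones ⥤ Scheme.{u} where
  obj σ := chart k σ.1
  map f := Spec.map (CommRingCat.ofHom (chartMap k (leOfHom f)))
  map_id σ := by
    change Spec.map (CommRingCat.ofHom (chartMap k (le_refl σ.1))) = 𝟙 (chart k σ.1)
    rw [chartMap_refl]; exact Spec.map_id _
  map_comp {ρ τ σ} f g := by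
    rw [← Spec.map_comp, ← CommRingCat.ofHom_comp, chartMap_comp]

instance (k : Type u) [Field k] {τ σ : F.cones} (f : τ ⟶ σ) :
    IsOpenImmersion ((F.diagram k).map f) := by
  obtain ⟨m, hm, hτ⟩ := F.isFace_of_le τ.2 σ.2 (leOfHom f)
  let _ := (chartMap k (leOfHom f)).toAlgebra
  have := isLocalization_chartMap k (F.rational _ σ.2) (leOfHom f) hm hτ
  exact IsOpenImmersion.of_isLocalization
    (AddMonoidAlgebra.single (⟨m, hm⟩ : dualMonoid σ.1) (1 : k))

lemma range_diagram_map (k : Type u) [Field k] {τ σ : F.cones} (f : τ ⟶ σ) {m : Fin d → ℤ}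
    (hm : m ∈ dualMonoid σ.1) (hτ : ∀ v, v ∈ τ.1 ↔ v ∈ σ.1 ∧ pairing m v = 0) :
    Set.range ((F.diagram k).map f) =
      (PrimeSpectrum.basicOpen (AddMonoidAlgebra.single (⟨m, hm⟩ : dualMonoid σ.1) (1 : k)) :
        Set (PrimeSpectrum (AddMonoidAlgebra k (dualMonoid σ.1)))) := by
  let _ := (chartMap k (leOfHom f)).toAlgebra
  have := isLocalization_chartMap k (F.rational _ σ.2) (leOfHom f) hm hτ
  exact PrimeSpectrum.localization_away_comap_range (AddMonoidAlgebra k (dualMonoid τ.1))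
    (AddMonoidAlgebra.single (⟨m, hm⟩ : dualMonoid σ.1) (1 : k))

instance (k : Type u) [Field k] : (F.diagram k ⋙ Scheme.forget).IsLocallyDirected where
  cond {τ τ' σ} f g x y hxy := by
    obtain ⟨m, hm, hτ⟩ := F.isFace_of_le τ.2 σ.2 (leOfHom f)
    obtain ⟨m', hm', hτ'⟩ := F.isFace_of_le τ'.2 σ.2 (leOfHom g)
    let ρ : F.cones := ⟨τ.1 ⊓ τ'.1, F.face_mem _ τ.2 _ (F.inter_face _ τ.2 _ τ'.2).1⟩
    let a : ρ ⟶ τ := homOfLE (show τ.1 ⊓ τ'.1 ≤ τ.1 from inf_le_left)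
    let b : ρ ⟶ τ' := homOfLE (show τ.1 ⊓ τ'.1 ≤ τ'.1 from inf_le_right)
    have hρ : ∀ v, v ∈ ρ.1 ↔ v ∈ σ.1 ∧ pairing (m + m') v = 0 := by
      intro v
      change v ∈ τ.1 ∧ v ∈ τ'.1 ↔ _
      rw [hτ, hτ', pairing_add]
      constructor
      · rintro ⟨⟨h1, h2⟩, _, h3⟩
        exact ⟨h1, by rw [h2, h3, add_zero]⟩
      · rintro ⟨h1, h2⟩
        have := hm v h1
        have := hm' v h1
        exact ⟨⟨h1, by linarith⟩, h1, by linarith⟩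
    change (F.diagram k).map f x = (F.diagram k).map g y at hxy
    have hx := (F.range_diagram_map k f hm hτ).le ⟨x, rfl⟩
    have hy := (F.range_diagram_map k g hm' hτ').le ⟨y, rfl⟩
    rw [← hxy] at hy
    have hz : (F.diagram k).map f x ∈ Set.range ((F.diagram k).map (a ≫ f)) := by
      rw [F.range_diagram_map k (a ≫ f) (add_mem hm hm') hρ]
      have : (AddMonoidAlgebra.single (⟨m + m', add_mem hm hm'⟩ : dualMonoid σ.1) (1 : k)) =
          AddMonoidAlgebra.single ⟨m, hm⟩ 1 * AddMonoidAlgebra.single ⟨m', hm'⟩ 1 := by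
        rw [AddMonoidAlgebra.single_mul_single, mul_one]; rfl
      rw [this, PrimeSpectrum.basicOpen_mul]
      exact ⟨hx, hy⟩
    obtain ⟨z, hz⟩ := hz
    refine ⟨ρ, a, b, z, ?_, ?_⟩
    · apply ((F.diagram k).map f).isOpenEmbedding.injective
      change (F.diagram k).map f ((F.diagram k).map a z) = _
      rw [← hz, Functor.map_comp, Scheme.Hom.comp_apply]
    · apply ((F.diagram k).map g).isOpenEmbedding.injective
      change (F.diagram k).map g ((F.diagram k).map b z) = _
      have : a ≫ f = b ≫ g := Subsingleton.elim _ _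
      rw [← hxy, ← hz, this, Functor.map_comp, Scheme.Hom.comp_apply]

/-- The toric variety `X_Σ` of the fan `Σ` over `k`, glued from the charts `U_σ`. -/
def toricVariety (k : Type u) [Field k] : Scheme.{u} := colimit (F.diagram k)

/-- The open immersion `U_σ → X_Σ`. -/
def chartι (k : Type u) [Field k] (σ : F.cones) : chart k σ.1 ⟶ F.toricVariety k :=
  colimit.ι (F.diagram k) σ

/-- The structure morphism `X_Σ → Spec k`. -/
def toricStr (k : Type u) [Field k] : F.toricVariety k ⟶ Spec (.of k) :=
  colimit.desc (F.diagram k)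
    { pt := Spec (.of k)
      ι :=
        { app := fun σ => Spec.map (CommRingCat.ofHom
            (algebraMap k (AddMonoidAlgebra k (dualMonoid σ.1))))
          naturality := by
            intro τ σ f
            change Spec.map _ ≫ Spec.map _ = _ ≫ 𝟙 _
            rw [← Spec.map_comp, ← CommRingCat.ofHom_comp, Category.comp_id]
            congr 2
            ext; simp [chartMap] } }

/-- The rays of the fan: its one-dimensional cones. -/
def rays : Set F.cones :=
  {ρ | Module.finrank ℝ (Submodule.span ℝ (ρ.1 : Set (Fin d → ℝ))) = 1}

/-- The torus orbit in `U_σ` that corresponds to the cone `σ`: the locus in `U_σ` where all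
characters `χ^m` with `m ∈ σ^∨ ∩ M` and `m ∉ σ^⊥` vanish. -/
def orbit (k : Type u) [Field k] (σ : F.cones) :
    Set (PrimeSpectrum (AddMonoidAlgebra k (dualMonoid σ.1))) :=
  PrimeSpectrum.zeroLocus
    {f | ∃ m : dualMonoid σ.1, (∃ v ∈ σ.1, pairing m.1 v ≠ 0) ∧ f = AddMonoidAlgebra.single m 1}

/-- The torus invariant divisor `Δ_ρ ⊆ X_Σ` of a ray `ρ`: the closure of its orbit. -/
def toricDivisor (k : Type u) [Field k] (ρ : F.cones) : Set (F.toricVariety k) :=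
  closure (F.chartι k ρ '' F.orbit k ρ)

/-- The toric boundary `Δ_Σ`, the union of the divisors `Δ_ρ` over all rays `ρ`. -/
def toricBoundary (k : Type u) [Field k] : Set (F.toricVariety k) :=
  ⋃ ρ ∈ F.rays, F.toricDivisor k ρ

end Fan

/-! ## Projective space -/

attribute [instance] MvPolynomial.gradedAlgebra

/-- Projective space `ℙ^n` over `k`. -/
def projectiveSpace (n : ℕ) (k : Type u) [Field k] : Scheme.{u} :=
  Proj (MvPolynomial.homogeneousSubmodule (Fin (n + 1)) k)

/-- The structure morphism `ℙ^n → Spec k`. -/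
def projectiveStr (n : ℕ) (k : Type u) [Field k] : projectiveSpace n k ⟶ Spec (.of k) :=
  Proj.toSpecZero (MvPolynomial.homogeneousSubmodule (Fin (n + 1)) k) ≫
    Spec.map (CommRingCat.ofHom
      (algebraMap k (MvPolynomial.homogeneousSubmodule (Fin (n + 1)) k 0)))

/-- A `k`-scheme is projective if it is a closed subscheme of some `ℙ^n`. -/
def IsProjective {k : Type u} [Field k] {X : Scheme.{u}} (str : X ⟶ Spec (.of k)) : Prop :=
  ∃ (n : ℕ) (i : X ⟶ projectiveSpace n k), IsClosedImmersion i ∧ i ≫ projectiveStr n k = str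

/-! ## Divisorial log structures -/

/-- The ideal in `𝒪_{X,x}` of the germs that vanish on the closed set `Z`, i.e. the stalk at `x`
of the radical ideal sheaf of `Z` (the unit ideal if `x ∉ Z`). -/
def stalkIdeal {X : Scheme.{u}} (Z : Set X) (x : X) : Ideal (X.presheaf.stalk x) :=
  PrimeSpectrum.vanishingIdeal ((X.fromSpecStalk x) ⁻¹' Z)

/-- The log structure of a pair `(X, D)`: over an open `U`, the functions on `U` that are
invertible on `U \ D`. -/
def logStructure {X : Scheme.{u}} (D : Set X) (U : X.Opens) : Set Γ(X, U) :=
  {s | ∀ x ∈ U, x ∉ D → x ∈ X.basicOpen s}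

/-- `f : Y → X` is a morphism of the log schemes of `(Y, E)` and `(X, D)`: the pullback of
functions maps the log structure of `X` to the one of `Y`. -/
def IsLogMorphism {Y X : Scheme.{u}} (f : Y ⟶ X) (E : Set Y) (D : Set X) : Prop :=
  ∀ (U : X.Opens), ∀ s ∈ logStructure D U, f.app U s ∈ logStructure E (f ⁻¹ᵁ U)

/-- `D = ⋃ Δ_i` is a strict normal crossings divisor with irreducible components `Δ_i`: the `Δ_i`
are distinct irreducible closed subsets and at every point `x` the ideals of the `Δ_i` through
`x` are generated by single elements `t_i` whose classes in the cotangent space `𝔪 / 𝔪²` are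
linearly independent. To be used on regular schemes, where this says that the `t_i` are part of
a regular system of parameters. -/
structure IsSNC {X : Scheme.{u}} {ι : Type} (Δ : ι → TopologicalSpace.Closeds X) : Prop where
  injective : Function.Injective Δ
  irreducible : ∀ i, IsIrreducible (Δ i : Set X)
  parameters : ∀ x : X, ∃ t : {i // x ∈ Δ i} → IsLocalRing.maximalIdeal (X.presheaf.stalk x),
    (∀ i, stalkIdeal (Δ i.1 : Set X) x = Ideal.span {(t i : X.presheaf.stalk x)}) ∧
    LinearIndependent (IsLocalRing.ResidueField (X.presheaf.stalk x))
      (fun i => (IsLocalRing.maximalIdeal (X.presheaf.stalk x)).toCotangent (t i))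

/-! ## Campana orbifolds -/

/-- A Campana orbifold over `k`: a smooth projective variety `X` with a strict normal crossings
divisor `Δ = ⋃ Δ_i` and multiplicities `m_i ∈ {1, 2, …} ∪ {∞}`, which encode the `ℚ`-divisor
`Δ_ε = ∑ (1 - 1 / m_i) Δ_i`. -/
structure Orbifold (k : Type u) [Field k] where
  X : Scheme.{u}
  str : X ⟶ Spec (.of k)
  isIntegral : IsIntegral X
  smooth : Smooth str
  projective : IsProjective str
  ι : Type
  finite : Finite ι
  Δ : ι → TopologicalSpace.Closeds X
  snc : IsSNC Δ
  mult : ι → ℕ∞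
  one_le_mult : ∀ i, 1 ≤ mult i

namespace Orbifold

variable {k : Type u} [Field k] (O : Orbifold k)

/-- The support `⋃ Δ_i` of the boundary. -/
def boundary : Set O.X := ⋃ i, (O.Δ i : Set O.X)

/-- The orbifold is klt if all multiplicities are finite. -/
def IsKlt : Prop := ∀ i, O.mult i ≠ ⊤

/-- A collection of contact orders `c_{j,i}` (at the `j`-th marking along `Δ_i`) is of Campana
type. -/
def IsCampanaType {n : ℕ} (c : Fin n → O.ι → ℕ) : Prop :=
  ∀ i, (O.mult i ≠ ⊤ → ∀ j, c j i = 0 ∨ O.mult i ≤ (c j i : ℕ∞)) ∧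
    (O.mult i = ⊤ → ∀ j j', 0 < c j i → 0 < c j' i → j = j')

/-- A family, over a variety `W`, of non-degenerate genus zero stable log maps to `X` with `n`
markings of contact orders `c`, whose underlying family of curves is `W × ℙ^1 → W`. Since the
log structure of `W` is trivial, the log structure of the family of curves is the divisorial one
of the markings. -/
structure LogFamily {n : ℕ} (c : Fin n → O.ι → ℕ) where
  W : Scheme.{u}
  strW : W ⟶ Spec (.of k)
  isIntegral : IsIntegral W
  isSeparated : IsSeparated strW
  locallyOfFiniteType : LocallyOfFiniteType strW
  quasiCompact : QuasiCompact strW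
  /-- the markings, disjoint sections of `W × ℙ^1 → W` -/
  mark : Fin n → (W ⟶ pullback strW (projectiveStr 1 k))
  mark_fst : ∀ j, mark j ≫ pullback.fst strW (projectiveStr 1 k) = 𝟙 W
  mark_disjoint : ∀ j j', j ≠ j' → Disjoint (Set.range (mark j)) (Set.range (mark j'))
  /-- the evaluation morphism, the log map on the total space of the family -/
  ev : pullback strW (projectiveStr 1 k) ⟶ O.X
  ev_str : ev ≫ O.str = pullback.fst strW (projectiveStr 1 k) ≫ strW
  isLogMorphism : IsLogMorphism ev (⋃ j, Set.range (mark j)) O.boundary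
  /-- the contact orders: `ev^* Δ_i = ∑ j, c_{j,i} p_j` as divisors on `W × ℙ^1` -/
  contact : ∀ i, ∀ x : (pullback strW (projectiveStr 1 k) : Scheme.{u}),
    (stalkIdeal (O.Δ i : Set O.X) (ev x)).map (ev.stalkMap x).hom =
      ∏ j, stalkIdeal (Set.range (mark j)) x ^ c j i
  /-- stability of the underlying maps: on each fibre the map is not constant, or there are at
  least three markings -/
  stable : ∀ w : W, 3 ≤ n ∨
    ¬ (ev '' (pullback.fst strW (projectiveStr 1 k) ⁻¹' {w})).Subsingleton

end Orbifold

/-! ## Separable dominant morphisms -/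

/-- A field extension is separable (separably generated): it is separable algebraic over a purely
transcendental extension. -/
def IsSeparablyGenerated (K L : Type u) [Field K] [Field L] (φ : K →+* L) : Prop :=
  letI := φ.toAlgebra
  ∃ s : Set L, IsTranscendenceBasis K ((↑) : s → L) ∧
    Algebra.IsSeparable (IntermediateField.adjoin K s) L

lemma genericPoint_specializes_genericPoint {Y Z : Scheme.{u}} [IsIntegral Y] [IsIntegral Z]
    (f : Y ⟶ Z) [IsDominant f] : f (genericPoint Y) ⤳ genericPoint Z := by
  have h : IsGenericPoint (f (genericPoint Y)) Set.univ := by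
    have := (genericPoint_spec Y).image f.continuous
    rwa [Set.image_univ, f.denseRange.closure_range] at this
  exact h.specializes (Set.mem_univ _)

/-- The extension of function fields `k(Z) → k(Y)` of a dominant morphism `Y → Z`. -/
def functionFieldMap {Y Z : Scheme.{u}} [IsIntegral Y] [IsIntegral Z] (f : Y ⟶ Z)
    [IsDominant f] : Z.functionField →+* Y.functionField :=
  (Z.presheaf.stalkSpecializes (genericPoint_specializes_genericPoint f) ≫
    f.stalkMap (genericPoint Y)).hom

/-- A morphism of varieties is dominant and separable: it is dominant and the extension of
function fields is separable. -/
def IsDominantSeparable {Y Z : Scheme.{u}} (f : Y ⟶ Z) : Prop :=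
  ∃ (_ : IsIntegral Y) (_ : IsIntegral Z) (_ : IsDominant f),
    IsSeparablyGenerated Z.functionField Y.functionField (functionFieldMap f)

namespace Orbifold

variable {k : Type u} [Field k] (O : Orbifold k)

/-- The two-point evaluation morphism `ev^(2) : U ×_W U → X × X`, for `U = W × ℙ^1`. -/
def LogFamily.ev₂ {O : Orbifold k} {n : ℕ} {c : Fin n → O.ι → ℕ} (F : O.LogFamily c) :
    pullback (pullback.fst F.strW (projectiveStr 1 k)) (pullback.fst F.strW (projectiveStr 1 k)) ⟶
      pullback O.str O.str :=
  pullback.lift (pullback.fst _ _ ≫ F.ev) (pullback.snd _ _ ≫ F.ev) (by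
    rw [Category.assoc, Category.assoc, F.ev_str, pullback.condition_assoc])

/-- `X` is separably rationally connected with respect to the collection `c` of contact orders. -/
def IsSeparablyRationallyConnected {n : ℕ} (c : Fin n → O.ι → ℕ) : Prop :=
  ∃ F : O.LogFamily c, IsDominantSeparable F.ev₂

/-- The orbifold is separably Campana rationally connected by good contact orders: there is a
collection of positive contact orders of Campana type, none of them divisible by the
characteristic, with respect to which `X` is separably rationally connected. -/
def IsSeparablyCampanaRationallyConnectedByGoodContactOrders : Prop :=
  ∃ (n : ℕ) (c : Fin n → O.ι → ℕ),
    (∀ j, c j ≠ 0) ∧ O.IsCampanaType c ∧ (∀ j, ¬ ∀ i, ringChar k ∣ c j i) ∧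
      O.IsSeparablyRationallyConnected c

end Orbifold

end

end Campana

namespace Campana

open scoped TensorProduct

noncomputable section

/-! Let `u_0 = -∑ e_i, u_1 = e_1, …, u_d = e_d`, and consider the rational map
`t ↦ (τ_i (t - p_i) ^ N)_i` from the projective line to the torus, where the scalars `τ_i ≠ 0` and
the distinct points `p_i` are the parameters of the family. At `p_j`, and at `∞` for `j = 0`, this
is a unit times the one-parameter subgroup `u_j` evaluated at the `N`-th power of a local parameter.
As the variety is proper, the valuative criterion puts each `u_j` into a cone of the fan. So the map
extends to the whole projective line, and its contact order with `Δ_i` at the `j`-th marking is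
`N c_{j,i}`, where `c_{j,i}` depends only on `u_j`. The divisor of a character `m` is a combination
of the `Δ_i`, so `m ⬝ᵥ u_j` is an integral combination of the `c_{j,i}`; as it equals `1` for some
`m`, the characteristic does not divide all the `c_{j,i}`. Choosing `N` prime to the characteristic
and at least as large as all multiplicities gives good contact orders of Campana type.

For the two-point evaluation put `a_i = τ_i (t - p_i) ^ N` and `b_i = τ_i (s - p_i) ^ N`. The field
`k(τ, p, t, s)` is generated over `k(a, b)` by `t`, `s` and the `N`-th roots
`r_i = (t - p_i) / (s - p_i)` of `a_i / b_i`, since `p_i = (t - r_i s) / (1 - r_i)`. Counting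
transcendence degrees, `a, b, t, s` are algebraically independent, and adjoining the `N`-th roots is
separable because `N` is prime to the characteristic. -/

lemma pairing_intCast {d : ℕ} (m u : Fin d → ℤ) :
    pairing m (fun i => (u i : ℝ)) = (m ⬝ᵥ u : ℤ) := by
  simp [pairing, dotProduct]

lemma pairing_smul {d : ℕ} (m : Fin d → ℤ) (a : ℝ) (v : Fin d → ℝ) :
    pairing m (a • v) = a * pairing m v := (pairingLin m).map_smul a v

lemma pairing_zero_right {d : ℕ} (m : Fin d → ℤ) : pairing m 0 = 0 := (pairingLin m).map_zero

lemma pairing_add_right {d : ℕ} (m : Fin d → ℤ) (v w : Fin d → ℝ) :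
    pairing m (v + w) = pairing m v + pairing m w := (pairingLin m).map_add v w

lemma pairing_zsmul_sub_zsmul {d : ℕ} (a b : ℤ) (m w : Fin d → ℤ) (v : Fin d → ℝ) :
    pairing (a • m - b • w) v = a * pairing m v - b * pairing w v := by
  simp [pairing, sub_mul, Finset.sum_sub_distrib, Finset.mul_sum, mul_assoc]

lemma pairing_single_one {d : ℕ} (i : Fin d) (v : Fin d → ℝ) :
    pairing (Pi.single i 1) v = v i := by
  simp [pairing, Pi.single_apply]

/-- The face `σ ∩ m^⊥` of a cone `σ` cut out by a character `m`. -/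
def faceCone {d : ℕ} (σ : PointedCone ℝ (Fin d → ℝ)) (m : Fin d → ℤ) :
    PointedCone ℝ (Fin d → ℝ) :=
  σ ⊓ (LinearMap.ker (pairingLin m)).restrictScalars _

lemma mem_faceCone {d : ℕ} {σ : PointedCone ℝ (Fin d → ℝ)} {m : Fin d → ℤ} {v : Fin d → ℝ} :
    v ∈ faceCone σ m ↔ v ∈ σ ∧ pairing m v = 0 := Iff.rfl

lemma faceCone_le {d : ℕ} (σ : PointedCone ℝ (Fin d → ℝ)) (m : Fin d → ℤ) :
    faceCone σ m ≤ σ := fun _ hv => hv.1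

lemma isFace_faceCone {d : ℕ} {σ : PointedCone ℝ (Fin d → ℝ)} {m : Fin d → ℤ}
    (hm : m ∈ dualMonoid σ) : IsFace (faceCone σ m) σ := ⟨m, hm, fun _ => mem_faceCone⟩

lemma mem_dualMonoid_hull {d : ℕ} {S : Set (Fin d → ℝ)} {m : Fin d → ℤ}
    (h : ∀ v ∈ S, 0 ≤ pairing m v) : m ∈ dualMonoid (PointedCone.hull ℝ S) := by
  intro v hv
  induction hv using Submodule.span_induction with
  | mem x hx => exact h x hx
  | zero => rw [pairing_zero_right]
  | add x y _ _ hx hy => rw [pairing_add_right]; exact add_nonneg hx hy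
  | smul a x _ hx =>
    change 0 ≤ pairing m ((a : ℝ) • x)
    rw [pairing_smul]; exact mul_nonneg a.2 hx

lemma eq_zero_of_mem_hull_of_pairing_eq_zero {d : ℕ} {S : Set (Fin d → ℝ)} {m : Fin d → ℤ}
    (h : ∀ v ∈ S, v ≠ 0 → 0 < pairing m v) {v : Fin d → ℝ} (hv : v ∈ PointedCone.hull ℝ S)
    (hmv : pairing m v = 0) : v = 0 := by
  suffices key : v = 0 ∨ 0 < pairing m v from key.resolve_right hmv.not_gt
  clear hmv
  induction hv using Submodule.span_induction with
  | mem x hx => exact or_iff_not_imp_left.2 (h x hx)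
  | zero => exact Or.inl rfl
  | add x y _ _ hx hy =>
    rw [pairing_add_right]
    rcases hx with rfl | hx <;> rcases hy with rfl | hy
    · exact Or.inl (add_zero 0)
    · exact Or.inr (by rwa [pairing_zero_right, zero_add])
    · exact Or.inr (by rwa [pairing_zero_right, add_zero])
    · exact Or.inr (add_pos hx hy)
  | smul a x _ hx =>
    change (a : ℝ) • x = 0 ∨ 0 < pairing m ((a : ℝ) • x)
    rw [pairing_smul]
    rcases hx with rfl | hx
    · exact Or.inl (smul_zero _)
    · rcases a.2.eq_or_lt with ha | ha
      · exact Or.inl (by rw [← ha, zero_smul])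
      · exact Or.inr (mul_pos ha hx)

lemma convex_ne_zero_of_salient {E : Type*} [AddCommGroup E] [Module ℝ E] {σ : PointedCone ℝ E}
    (hσ : ∀ v ∈ σ, -v ∈ σ → v = 0) : Convex ℝ {v | v ∈ σ ∧ v ≠ 0} := by
  rintro x ⟨hx, hx0⟩ y ⟨hy, hy0⟩ a b ha hb hab
  have hax : a • x ∈ σ := σ.smul_mem ha hx
  have hby : b • y ∈ σ := σ.smul_mem hb hy
  refine ⟨add_mem hax hby, fun h => ?_⟩
  have hax0 : a • x = 0 := hσ _ hax (neg_eq_of_add_eq_zero_right h ▸ hby)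
  have hby0 : b • y = 0 := by rwa [hax0, zero_add] at h
  rw [(smul_eq_zero.1 hax0).resolve_right hx0, (smul_eq_zero.1 hby0).resolve_right hy0] at hab
  norm_num at hab

lemma exists_strongDual_pos_of_salient {E : Type*} [AddCommGroup E] [Module ℝ E]
    [TopologicalSpace E] [IsTopologicalAddGroup E] [ContinuousSMul ℝ E] [LocallyConvexSpace ℝ E]
    [T2Space E] {σ : PointedCone ℝ E} (hσ : ∀ v ∈ σ, -v ∈ σ → v = 0) {S : Set E} (hS : S.Finite)
    (hSσ : ∀ v ∈ S, v ∈ σ ∧ v ≠ 0) : ∃ f : StrongDual ℝ E, ∀ v ∈ S, 0 < f v := by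
  have hzero : (0 : E) ∉ convexHull ℝ S := fun h =>
    (convexHull_min hSσ (convex_ne_zero_of_salient hσ) h).2 rfl
  obtain ⟨f, r, hr0, hr⟩ := geometric_hahn_banach_point_closed (convex_convexHull ℝ S)
    (hS.isCompact_convexHull ℝ).isClosed hzero
  rw [map_zero] at hr0
  exact ⟨f, fun v hv => hr0.trans (hr v (subset_convexHull ℝ S hv))⟩

lemma tendsto_floor_mul_div_atTop (a : ℝ) :
    Filter.Tendsto (fun x : ℝ => (⌊a * x⌋ : ℝ) / x) Filter.atTop (nhds a) := by
  have hlower : Filter.Tendsto (fun x : ℝ => a - 1 / x) Filter.atTop (nhds a) := by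
    simpa using tendsto_inv_atTop_zero.const_sub a
  refine tendsto_of_tendsto_of_tendsto_of_le_of_le' hlower tendsto_const_nhds ?_ ?_ <;>
    filter_upwards [Filter.eventually_gt_atTop 0] with x hx
  · rw [le_div_iff₀ hx, sub_mul, div_mul_cancel₀ _ hx.ne']
    exact (Int.sub_one_lt_floor _).le
  · rw [div_le_iff₀ hx]
    exact Int.floor_le _

lemma exists_dotProduct_pos {ι : Type*} [Fintype ι] (S : Finset (ι → ℤ)) (y : ι → ℝ)
    (hy : ∀ u ∈ S, 0 < ∑ i, y i * (u i : ℝ)) : ∃ m : ι → ℤ, ∀ u ∈ S, 0 < m ⬝ᵥ u := by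
  have hlim (u : ι → ℤ) : Filter.Tendsto (fun x : ℝ => ∑ i, (⌊y i * x⌋ : ℝ) / x * u i)
      Filter.atTop (nhds (∑ i, y i * (u i : ℝ))) :=
    tendsto_finsetSum _ fun i _ => (tendsto_floor_mul_div_atTop (y i)).mul_const _
  have hpos : ∀ᶠ x : ℝ in Filter.atTop, ∀ u ∈ S, 0 < ∑ i, (⌊y i * x⌋ : ℝ) / x * u i :=
    (Filter.eventually_all_finset S).2 fun u hu => (hlim u).eventually_const_lt (hy u hu)
  obtain ⟨x, hx, hx0⟩ := (hpos.and (Filter.eventually_gt_atTop 0)).exists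
  refine ⟨fun i => ⌊y i * x⌋, fun u hu => ?_⟩
  have h := mul_pos hx0 (hx u hu)
  have hclear : x * ∑ i, (⌊y i * x⌋ : ℝ) / x * u i = ((fun i => ⌊y i * x⌋) ⬝ᵥ u : ℤ) := by
    simp only [dotProduct, Finset.mul_sum, Int.cast_sum, Int.cast_mul]
    exact Finset.sum_congr rfl fun i _ => by field_simp
  exact_mod_cast hclear ▸ h

lemma exists_mem_dualMonoid_pairing_eq_zero_imp {d : ℕ} {σ : PointedCone ℝ (Fin d → ℝ)}
    (hσ : IsRationalPolyhedral σ) (hs : ∀ v ∈ σ, -v ∈ σ → v = 0) :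
    ∃ m ∈ dualMonoid σ, ∀ v ∈ σ, pairing m v = 0 → v = 0 := by
  classical
  obtain ⟨S, rfl⟩ := hσ
  obtain ⟨f, hf⟩ := exists_strongDual_pos_of_salient hs
    (((S.finite_toSet.image fun u i => (u i : ℝ))).inter_of_left {v | v ≠ 0})
    fun v hv => ⟨Submodule.subset_span hv.1, hv.2⟩
  have hfsum (v : Fin d → ℝ) : f v = ∑ i, f (Pi.single i 1) * v i := by
    conv_lhs => rw [pi_eq_sum_univ' v]
    simp [mul_comm]
  obtain ⟨m, hm⟩ := exists_dotProduct_pos (S.filter fun u => (fun i => (u i : ℝ)) ≠ 0)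
    (fun i => f (Pi.single i 1)) fun u hu => by
      rw [← hfsum fun i => (u i : ℝ)]
      exact hf _ ⟨⟨u, (Finset.mem_filter.1 hu).1, rfl⟩, (Finset.mem_filter.1 hu).2⟩
  have hpos : ∀ v ∈ (fun u i => (u i : ℝ)) '' (S : Set (Fin d → ℤ)), v ≠ 0 → 0 < pairing m v := by
    rintro _ ⟨u, hu, rfl⟩ h
    rw [pairing_intCast]
    exact_mod_cast hm u (Finset.mem_filter.2 ⟨hu, h⟩)
  refine ⟨m, mem_dualMonoid_hull fun v hv => ?_, fun v hv =>
    eq_zero_of_mem_hull_of_pairing_eq_zero hpos hv⟩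
  rcases eq_or_ne v 0 with rfl | h
  · rw [pairing_zero_right]
  · exact (hpos v hv h).le

/-- The slope `w / m` attains its minimum `b / a` on the nonzero generators of `σ`. -/
lemma exists_zsmul_sub_zsmul_mem_dualMonoid {d : ℕ} {σ : PointedCone ℝ (Fin d → ℝ)}
    (hσ : IsRationalPolyhedral σ) (h0 : σ ≠ ⊥) {m : Fin d → ℤ} (hm : m ∈ dualMonoid σ)
    (hpos : ∀ v ∈ σ, pairing m v = 0 → v = 0) (w : Fin d → ℤ) :
    ∃ a b : ℤ, 0 < a ∧ a • w - b • m ∈ dualMonoid σ ∧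
      ∃ v ∈ σ, v ≠ 0 ∧ pairing (a • w - b • m) v = 0 := by
  classical
  obtain ⟨S, rfl⟩ := hσ
  set c : (Fin d → ℤ) → Fin d → ℝ := fun u i => (u i : ℝ) with hc
  have hmem : ∀ u ∈ S, c u ∈ PointedCone.hull ℝ (c '' (S : Set (Fin d → ℤ))) := fun u hu =>
    Submodule.subset_span ⟨u, hu, rfl⟩
  have hmpos : ∀ u ∈ S, c u ≠ 0 → 0 < pairing m (c u) := fun u hu h =>
    (hm _ (hmem u hu)).lt_of_ne' fun h' => h (hpos _ (hmem u hu) h')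
  obtain ⟨u₀, hu₀, hu₀0⟩ : ∃ u ∈ S, c u ≠ 0 := by
    by_contra! h
    refine h0 (le_bot_iff.1 (Submodule.span_le.2 ?_))
    rintro _ ⟨u, hu, rfl⟩
    exact h u hu
  obtain ⟨u₁, hu₁, hmin⟩ := (S.filter fun u => c u ≠ 0).exists_min_image
    (fun u => pairing w (c u) / pairing m (c u)) ⟨u₀, Finset.mem_filter.2 ⟨hu₀, hu₀0⟩⟩
  rw [Finset.mem_filter] at hu₁
  have hpair (v : Fin d → ℝ) : pairing ((m ⬝ᵥ u₁) • w - (w ⬝ᵥ u₁) • m) v =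
      pairing m (c u₁) * pairing w v - pairing w (c u₁) * pairing m v := by
    rw [pairing_zsmul_sub_zsmul, hc, pairing_intCast, pairing_intCast]
  have hm₁ := hmpos u₁ hu₁.1 hu₁.2
  refine ⟨m ⬝ᵥ u₁, w ⬝ᵥ u₁, ?_, mem_dualMonoid_hull ?_, c u₁, hmem u₁ hu₁.1, hu₁.2, ?_⟩
  · rw [hc, pairing_intCast] at hm₁
    exact_mod_cast hm₁
  · rintro _ ⟨u, hu, rfl⟩
    rw [hpair]
    rcases eq_or_ne (c u) 0 with h | h
    · simp [h, pairing_zero_right]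
    · have hslope := hmin u (Finset.mem_filter.2 ⟨hu, h⟩)
      rw [div_le_div_iff₀ hm₁ (hmpos u hu h)] at hslope
      linarith
  · rw [hpair]
    ring

namespace Fan

variable {d : ℕ} (F : Fan d)

lemma isFace_bot {σ : PointedCone ℝ (Fin d → ℝ)} (hσ : σ ∈ F.cones) : IsFace ⊥ σ := by
  obtain ⟨m, hm, h⟩ :=
    exists_mem_dualMonoid_pairing_eq_zero_imp (F.rational σ hσ) (F.stronglyConvex σ hσ)
  refine ⟨m, hm, fun v => ⟨?_, fun hv => h v hv.1 hv.2⟩⟩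
  rintro rfl
  exact ⟨zero_mem _, pairing_zero_right m⟩

lemma bot_mem : ⊥ ∈ F.cones := by
  obtain ⟨σ, hσ⟩ := F.nonempty
  exact F.face_mem σ hσ ⊥ (F.isFace_bot hσ)

/-- The cone `{0}` of the fan, whose chart is the torus. -/
def zeroCone : F.cones := ⟨⊥, F.bot_mem⟩

/-- On a minimal nonzero cone every coordinate is a multiple of one positive character `m`,
since its faces are only `⊥` and itself. -/
lemma finrank_span_eq_one_of_minimal {ρ : PointedCone ℝ (Fin d → ℝ)}
    (hρ : Minimal (fun σ => σ ∈ F.cones ∧ σ ≠ ⊥) ρ) :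
    Module.finrank ℝ (Submodule.span ℝ (ρ : Set (Fin d → ℝ))) = 1 := by
  obtain ⟨⟨hρF, hρ0⟩, hmin⟩ := hρ
  obtain ⟨m, hm, hpos⟩ :=
    exists_mem_dualMonoid_pairing_eq_zero_imp (F.rational ρ hρF) (F.stronglyConvex ρ hρF)
  have hcoord (i : Fin d) : ∃ q : ℝ, ∀ v ∈ ρ, v i = pairing m v * q := by
    obtain ⟨a, b, ha, hab, v₀, hv₀, hv₀0, hv₀ab⟩ := exists_zsmul_sub_zsmul_mem_dualMonoid
      (F.rational ρ hρF) hρ0 hm hpos (Pi.single i 1)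
    have hface : ρ ≤ faceCone ρ (a • Pi.single i 1 - b • m) := by
      refine hmin ⟨F.face_mem ρ hρF _ (isFace_faceCone hab), fun h => hv₀0 ?_⟩ (faceCone_le _ _)
      exact (Submodule.mem_bot _).1 (h ▸ mem_faceCone.2 ⟨hv₀, hv₀ab⟩)
    refine ⟨b / a, fun v hv => ?_⟩
    have h := (mem_faceCone.1 (hface hv)).2
    rw [pairing_zsmul_sub_zsmul, pairing_single_one] at h
    have ha' : (a : ℝ) ≠ 0 := by exact_mod_cast ha.ne'
    field_simp
    linarith
  choose q hq using hcoord
  have hle : Submodule.span ℝ (ρ : Set (Fin d → ℝ)) ≤ Submodule.span ℝ {q} :=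
    Submodule.span_le.2 fun v hv =>
      Submodule.mem_span_singleton.2 ⟨pairing m v, funext fun i => (hq i v hv).symm⟩
  obtain ⟨v, hv, hv0⟩ := (Submodule.ne_bot_iff ρ).1 hρ0
  refine le_antisymm ((Submodule.finrank_mono hle).trans (finrank_span_le_card {q})) ?_
  exact Submodule.one_le_finrank_iff.2
    ((Submodule.ne_bot_iff _).2 ⟨v, Submodule.subset_span hv, hv0⟩)

lemma exists_ray_le {τ : PointedCone ℝ (Fin d → ℝ)} (hτ : τ ∈ F.cones) (h0 : τ ≠ ⊥) :
    ∃ ρ ∈ F.rays, ρ.1 ≤ τ := by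
  have hfin : {σ | σ ∈ F.cones ∧ σ ≠ ⊥}.Finite := F.finite.subset fun _ h => h.1
  obtain ⟨ρ, hρτ, hρ⟩ := hfin.exists_le_minimal ⟨hτ, h0⟩
  exact ⟨⟨ρ, hρ.prop.1⟩, F.finrank_span_eq_one_of_minimal hρ, hρτ⟩

end Fan

section Charts

variable (k : Type u) [Field k] {d : ℕ}

lemma coeff_chartMap_inclusion {τ σ : PointedCone ℝ (Fin d → ℝ)} (h : τ ≤ σ)
    (f : AddMonoidAlgebra k (dualMonoid σ)) (a : dualMonoid σ) :
    (chartMap k h f).coeff (AddSubmonoid.inclusion (dualMonoid_anti h) a) = f.coeff a :=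
  Finsupp.mapDomain_apply (AddSubmonoid.inclusion_injective (dualMonoid_anti h)) _ _

variable {k}

lemma single_add_mem_iff {M : Type*} [AddCommMonoid M] (p : PrimeSpectrum (AddMonoidAlgebra k M))
    (a b : M) :
    AddMonoidAlgebra.single (a + b) (1 : k) ∈ p.asIdeal ↔
      AddMonoidAlgebra.single a (1 : k) ∈ p.asIdeal ∨
      AddMonoidAlgebra.single b (1 : k) ∈ p.asIdeal := by
  rw [← p.isPrime.mul_mem_iff_mem_or_mem, AddMonoidAlgebra.single_mul_single, one_mul]

lemma single_nsmul_notMem {M : Type*} [AddCommMonoid M]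
    {p : PrimeSpectrum (AddMonoidAlgebra k M)} {a : M}
    (ha : AddMonoidAlgebra.single a (1 : k) ∉ p.asIdeal) (n : ℕ) :
    AddMonoidAlgebra.single (n • a) (1 : k) ∉ p.asIdeal := by
  rw [← one_pow n, ← AddMonoidAlgebra.single_pow]
  exact fun h => ha (p.isPrime.mem_of_pow_mem n h)

lemma faceCone_add_le {σ : PointedCone ℝ (Fin d → ℝ)} (a b : dualMonoid σ) :
    faceCone σ (a + b).1 ≤ faceCone σ a.1 ⊓ faceCone σ b.1 := by
  rintro v ⟨hv, h : pairing (a.1 + b.1) v = 0⟩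
  rw [pairing_add] at h
  obtain ⟨ha, hb⟩ := (add_eq_zero_iff_of_nonneg (a.2 v hv) (b.2 v hv)).1 h
  exact ⟨⟨hv, ha⟩, hv, hb⟩

lemma single_notMem_of_faceCone_eq_bot {σ : PointedCone ℝ (Fin d → ℝ)}
    (hσ : IsRationalPolyhedral σ) {p : PrimeSpectrum (AddMonoidAlgebra k (dualMonoid σ))}
    {m : dualMonoid σ} (hm : AddMonoidAlgebra.single m (1 : k) ∉ p.asIdeal)
    (hbot : faceCone σ m.1 = ⊥) (a : dualMonoid σ) :
    AddMonoidAlgebra.single a (1 : k) ∉ p.asIdeal := by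
  obtain ⟨n, hn⟩ := exists_add_nsmul_mem (τ := ⊥) (w := -a.1) hσ m.2
    (fun v => by rw [← hbot]; exact mem_faceCone) (by
      rintro v (rfl : v = 0)
      rw [pairing_zero_right])
  have hsplit : n • m = a + ⟨_, hn⟩ := by
    ext i
    simp
  have h := single_nsmul_notMem hm n
  rw [hsplit, single_add_mem_iff] at h
  exact (not_or.1 h).1

end Charts

namespace Fan

variable {d : ℕ} (F : Fan d) (k : Type u) [Field k]

instance (σ : F.cones) : IsOpenImmersion (F.chartι k σ) :=
  inferInstanceAs (IsOpenImmersion (colimit.ι (F.diagram k) σ))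

lemma exists_chartι_eq (x : F.toricVariety k) : ∃ σ, ∃ p, F.chartι k σ p = x :=
  Scheme.IsLocallyDirected.ι_jointly_surjective (F.diagram k) x

lemma SpecMap_chartMap_chartι {τ σ : F.cones} (h : τ.1 ≤ σ.1) :
    Spec.map (CommRingCat.ofHom (chartMap k h)) ≫ F.chartι k σ = F.chartι k τ :=
  colimit.w (F.diagram k) (homOfLE h)

lemma chartι_comap {τ σ : F.cones} (h : τ.1 ≤ σ.1)
    (q : PrimeSpectrum (AddMonoidAlgebra k (dualMonoid τ.1))) :
    F.chartι k σ (PrimeSpectrum.comap (chartMap k h) q) = F.chartι k τ q :=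
  congrArg (fun f : chart k τ.1 ⟶ F.toricVariety k => f q) (F.SpecMap_chartMap_chartι k h)

lemma chartι_toricStr (σ : F.cones) : F.chartι k σ ≫ F.toricStr k =
    Spec.map (CommRingCat.ofHom (algebraMap k (AddMonoidAlgebra k (dualMonoid σ.1)))) :=
  colimit.ι_desc _ _

/-- The torus as a subset of the toric variety. -/
def torus : Set (F.toricVariety k) := Set.range (F.chartι k F.zeroCone)

lemma isOpen_torus : IsOpen (F.torus k) := (F.chartι k F.zeroCone).isOpenEmbedding.isOpen_range

lemma chartι_mem_torus_iff {σ : F.cones} {m : Fin d → ℤ} (hm : m ∈ dualMonoid σ.1)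
    (hpos : ∀ v ∈ σ.1, pairing m v = 0 → v = 0)
    (p : PrimeSpectrum (AddMonoidAlgebra k (dualMonoid σ.1))) :
    F.chartι k σ p ∈ F.torus k ↔
      AddMonoidAlgebra.single (⟨m, hm⟩ : dualMonoid σ.1) (1 : k) ∉ p.asIdeal := by
  have hle : F.zeroCone.1 ≤ σ.1 := bot_le
  have hface (v : Fin d → ℝ) : v ∈ F.zeroCone.1 ↔ v ∈ σ.1 ∧ pairing m v = 0 := by
    refine ⟨?_, fun hv => hpos v hv.1 hv.2⟩
    rintro (rfl : v = 0)
    exact ⟨zero_mem _, pairing_zero_right m⟩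
  rw [← PrimeSpectrum.mem_basicOpen, ← SetLike.mem_coe,
    ← F.range_diagram_map k (homOfLE hle : F.zeroCone ⟶ σ) hm hface]
  constructor
  · rintro ⟨q, hq⟩
    refine ⟨q, (F.chartι k σ).isOpenEmbedding.injective ?_⟩
    exact (F.chartι_comap k hle q).trans hq
  · rintro ⟨q, rfl⟩
    exact ⟨q, (F.chartι_comap k hle q).symm⟩

variable {F} in
lemma ne_bot_of_mem_rays {ρ : F.cones} (hρ : ρ ∈ F.rays) : ρ.1 ≠ ⊥ := fun h => by
  have hspan : Module.finrank ℝ (Submodule.span ℝ (ρ.1 : Set (Fin d → ℝ))) = 1 := hρ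
  rw [h, Submodule.span_eq_bot.2 fun v hv => (Submodule.mem_bot _).1 hv, finrank_bot] at hspan
  exact zero_ne_one hspan

lemma disjoint_torus_toricDivisor {ρ : F.cones} (hρ : ρ ∈ F.rays) :
    Disjoint (F.torus k) (F.toricDivisor k ρ) := by
  refine Disjoint.closure_right (Set.disjoint_left.2 ?_) (F.isOpen_torus k)
  rintro _ hx ⟨p, hp, rfl⟩
  obtain ⟨m, hm, hpos⟩ :=
    exists_mem_dualMonoid_pairing_eq_zero_imp (F.rational _ ρ.2) (F.stronglyConvex _ ρ.2)
  obtain ⟨v, hv, hv0⟩ := (Submodule.ne_bot_iff ρ.1).1 (ne_bot_of_mem_rays hρ)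
  exact (F.chartι_mem_torus_iff k hm hpos p).1 hx
    (hp ⟨⟨m, hm⟩, ⟨v, hv, fun h => hv0 (hpos v hv h)⟩, rfl⟩)

lemma orbit_eq_zeroLocus_span (ρ : F.cones) :
    F.orbit k ρ = PrimeSpectrum.zeroLocus (Ideal.span (AddMonoidAlgebra.of' k _ ''
      {m : dualMonoid ρ.1 | ∃ v ∈ ρ.1, pairing m.1 v ≠ 0}) :
        Set (AddMonoidAlgebra k (dualMonoid ρ.1))) := by
  rw [PrimeSpectrum.zeroLocus_span, orbit]
  congr 1
  ext f
  simp only [Set.mem_ofPred_eq, Set.mem_image, eq_comm (a := f)]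
  rfl

/-- The closure of the image of the orbit is cut out by the preimage of its monomial ideal, which
is spanned by the characters that are positive somewhere on `ρ`. -/
lemma mem_closure_image_orbit {ρ σ : F.cones} (h : ρ.1 ≤ σ.1)
    {p : PrimeSpectrum (AddMonoidAlgebra k (dualMonoid σ.1))}
    (hp : ∀ m : dualMonoid σ.1, (∃ v ∈ ρ.1, pairing m.1 v ≠ 0) →
      AddMonoidAlgebra.single m (1 : k) ∈ p.asIdeal) :
    p ∈ closure (PrimeSpectrum.comap (chartMap k h) '' F.orbit k ρ) := by
  rw [orbit_eq_zeroLocus_span, PrimeSpectrum.closure_image_comap_zeroLocus]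
  intro f hf
  rw [SetLike.mem_coe, Ideal.mem_comap, AddMonoidAlgebra.mem_ideal_span_of'_image] at hf
  rw [SetLike.mem_coe, ← AddMonoidAlgebra.sum_coeff_single f]
  refine Ideal.sum_mem _ fun a ha => ?_
  obtain ⟨m, ⟨v, hv, hmv⟩, e, hae⟩ := hf (AddSubmonoid.inclusion (dualMonoid_anti h) a) (by
    rw [Finsupp.mem_support_iff, coeff_chartMap_inclusion]
    exact Finsupp.mem_support_iff.1 ha)
  have hae' : a.1 = e.1 + m.1 := congrArg Subtype.val hae
  have hav : 0 < pairing a.1 v := by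
    rw [hae', pairing_add]
    exact add_pos_of_nonneg_of_pos (e.2 v hv) ((m.2 v hv).lt_of_ne' hmv)
  have hmem := Ideal.mul_mem_left p.asIdeal (AddMonoidAlgebra.single 0 (f.coeff a))
    (hp a ⟨v, hv, hav.ne'⟩)
  rwa [AddMonoidAlgebra.single_mul_single, zero_add, mul_one] at hmem

lemma chartι_mem_toricDivisor {ρ σ : F.cones} (h : ρ.1 ≤ σ.1)
    {p : PrimeSpectrum (AddMonoidAlgebra k (dualMonoid σ.1))}
    (hp : ∀ m : dualMonoid σ.1, (∃ v ∈ ρ.1, pairing m.1 v ≠ 0) →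
      AddMonoidAlgebra.single m (1 : k) ∈ p.asIdeal) :
    F.chartι k σ p ∈ F.toricDivisor k ρ := by
  refine closure_mono ?_ (image_closure_subset_closure_image (F.chartι k σ).continuous
    ⟨p, F.mem_closure_image_orbit k h hp, rfl⟩)
  rintro _ ⟨_, ⟨q, hq, rfl⟩, rfl⟩
  exact ⟨q, hq, (F.chartι_comap k h q).symm⟩

/-- The smallest face cut out by a character that does not vanish at `p`; its relative orbit is
the one that contains `p`. -/
lemma exists_face_of_point {σ : F.cones}
    (p : PrimeSpectrum (AddMonoidAlgebra k (dualMonoid σ.1))) :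
    ∃ m : dualMonoid σ.1, AddMonoidAlgebra.single m (1 : k) ∉ p.asIdeal ∧
      ∀ a : dualMonoid σ.1, AddMonoidAlgebra.single a (1 : k) ∉ p.asIdeal →
        ∀ v ∈ faceCone σ.1 m.1, pairing a.1 v = 0 := by
  have hfin : ((fun m : dualMonoid σ.1 => faceCone σ.1 m.1) ''
      {m | AddMonoidAlgebra.single m (1 : k) ∉ p.asIdeal}).Finite := by
    refine F.finite.subset ?_
    rintro _ ⟨m, -, rfl⟩
    exact F.face_mem _ σ.2 _ (isFace_faceCone m.2)
  have hzero : AddMonoidAlgebra.single (0 : dualMonoid σ.1) (1 : k) ∉ p.asIdeal :=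
    (Ideal.ne_top_iff_one _).1 p.isPrime.ne_top
  obtain ⟨_, ⟨m, hm, rfl⟩, hmin⟩ := hfin.exists_minimal ⟨_, 0, hzero, rfl⟩
  refine ⟨m, hm, fun a ha v hv => ?_⟩
  have ham := faceCone_add_le a m
  have hle := hmin ⟨a + m, (single_add_mem_iff p a m).not.2 (not_or.2 ⟨ha, hm⟩), rfl⟩
    (ham.trans inf_le_right)
  exact (ham (hle hv)).1.2

lemma exists_mem_toricDivisor {x : F.toricVariety k} (hx : x ∉ F.torus k) :
    ∃ ρ ∈ F.rays, x ∈ F.toricDivisor k ρ := by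
  obtain ⟨σ, p, rfl⟩ := F.exists_chartι_eq k x
  obtain ⟨m, hm, hvan⟩ := F.exists_face_of_point k p
  have hne : faceCone σ.1 m.1 ≠ ⊥ := by
    obtain ⟨m₀, hm₀, hpos⟩ :=
      exists_mem_dualMonoid_pairing_eq_zero_imp (F.rational _ σ.2) (F.stronglyConvex _ σ.2)
    exact fun hbot => hx ((F.chartι_mem_torus_iff k hm₀ hpos p).2
      (single_notMem_of_faceCone_eq_bot (F.rational _ σ.2) hm hbot _))
  obtain ⟨ρ, hρ, hρm⟩ := F.exists_ray_le (F.face_mem _ σ.2 _ (isFace_faceCone m.2)) hne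
  refine ⟨ρ, hρ, F.chartι_mem_toricDivisor k (hρm.trans (faceCone_le _ _)) fun a => ?_⟩
  rintro ⟨v, hv, hav⟩
  by_contra ha
  exact hav (hvan a ha v (hρm hv))

lemma toricBoundary_eq_compl : F.toricBoundary k = (F.torus k)ᶜ := by
  ext x
  rw [toricBoundary, Set.mem_iUnion₂, Set.mem_compl_iff]
  constructor
  · rintro ⟨ρ, hρ, hx⟩ hx'
    exact Set.disjoint_left.1 (F.disjoint_torus_toricDivisor k hρ) hx' hx
  · intro hx
    obtain ⟨ρ, hρ, h⟩ := F.exists_mem_toricDivisor k hx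
    exact ⟨ρ, hρ, h⟩

end Fan

/-! ## Morphisms to proper toric varieties -/

lemma isIso_SpecMap_algebraMap_homogeneousSubmodule_zero (σ : Type) (k : Type u)
    [Field k] : IsIso (Spec.map (CommRingCat.ofHom
      (algebraMap k (MvPolynomial.homogeneousSubmodule σ k 0)))) := by
  have hbij : Function.Bijective (algebraMap k (MvPolynomial.homogeneousSubmodule σ k 0)) := by
    refine ⟨fun x y h => MvPolynomial.C_injective _ k (congrArg Subtype.val h), fun ⟨x, hx⟩ => ?_⟩
    rw [MvPolynomial.homogeneousSubmodule_zero, Submodule.mem_one] at hx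
    obtain ⟨y, hy⟩ := hx
    exact ⟨y, Subtype.ext hy⟩
  have : IsIso (CommRingCat.ofHom (algebraMap k (MvPolynomial.homogeneousSubmodule σ k 0))) :=
    (ConcreteCategory.isIso_iff_bijective _).2 hbij
  infer_instance

instance (n : ℕ) (k : Type u) [Field k] : IsProper (projectiveStr n k) := by
  have : IsScalarTower k (MvPolynomial.homogeneousSubmodule (Fin (n + 1)) k 0)
      (MvPolynomial (Fin (n + 1)) k) := ⟨fun a b c => smul_mul_assoc a b.1 c⟩
  have : Algebra.FiniteType (MvPolynomial.homogeneousSubmodule (Fin (n + 1)) k 0)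
      (MvPolynomial (Fin (n + 1)) k) := Algebra.FiniteType.of_restrictScalars_finiteType k _ _
  have := isIso_SpecMap_algebraMap_homogeneousSubmodule_zero (Fin (n + 1)) k
  have : IsProper (Proj.toSpecZero (MvPolynomial.homogeneousSubmodule (Fin (n + 1)) k)) :=
    inferInstance
  exact MorphismProperty.comp_mem _ _ _ this inferInstance

lemma IsProjective.isProper {k : Type u} [Field k] {X : Scheme.{u}} {str : X ⟶ Spec (.of k)}
    (h : IsProjective str) : IsProper str := by
  obtain ⟨n, i, hi, rfl⟩ := h
  infer_instance

section CharHom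

variable {k : Type*} [Field k] {d : ℕ} {R : Type*} [CommRing R] [Algebra k R]

/-- The homomorphism `k[σ^∨ ∩ M] → R` of an `R`-valued point `χ : M → R` of the torus. -/
def charHom (σ : PointedCone ℝ (Fin d → ℝ)) (χ : Multiplicative (Fin d → ℤ) →* R) :
    AddMonoidAlgebra k (dualMonoid σ) →ₐ[k] R :=
  AddMonoidAlgebra.lift k R _ (χ.comp (AddMonoidHom.toMultiplicative (dualMonoid σ).subtype))

lemma charHom_single (σ : PointedCone ℝ (Fin d → ℝ)) (χ : Multiplicative (Fin d → ℤ) →* R)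
    (m : dualMonoid σ) :
    charHom (k := k) σ χ (AddMonoidAlgebra.single m 1) = χ (Multiplicative.ofAdd m.1) := by
  rw [charHom, AddMonoidAlgebra.lift_single, one_smul]
  rfl

lemma algHom_ext_single {A : Type*} [AddMonoid A] {f g : AddMonoidAlgebra k A →ₐ[k] R}
    (h : ∀ m, f (AddMonoidAlgebra.single m 1) = g (AddMonoidAlgebra.single m 1)) : f = g :=
  AddMonoidAlgebra.algHom_ext h (Subsingleton.elim _ _)

end CharHom

lemma charHom_comp_chartMap {k : Type u} [Field k] {d : ℕ} {R : Type*} [CommRing R] [Algebra k R]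
    {τ σ : PointedCone ℝ (Fin d → ℝ)} (h : τ ≤ σ) (χ : Multiplicative (Fin d → ℤ) →* R) :
    (charHom (k := k) τ χ).toRingHom.comp (chartMap k h) = (charHom σ χ).toRingHom := by
  refine AddMonoidAlgebra.ringHom_ext (fun r => ?_) fun m => ?_ <;>
    rw [RingHom.comp_apply, chartMap_single]
  · change charHom τ χ _ = charHom σ χ _
    rw [charHom, charHom, AddMonoidAlgebra.lift_single, AddMonoidAlgebra.lift_single]
    rfl
  · exact (charHom_single τ χ _).trans (charHom_single σ χ m).symm

section Charts

variable {d : ℕ} (F : Fan d) {k : Type u} [Field k] {X : Scheme.{u}} (e : X ≅ F.toricVariety k)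

/-- The chart `U_σ` of a scheme identified with the toric variety. -/
def chartTo (σ : F.cones) : chart k σ.1 ⟶ X := F.chartι k σ ≫ e.inv

instance (σ : F.cones) : IsOpenImmersion (chartTo F e σ) := by
  unfold chartTo; infer_instance

lemma hom_chartTo (σ : F.cones) (p : chart k σ.1) :
    e.hom (chartTo F e σ p) = F.chartι k σ p := by
  rw [← Scheme.Hom.comp_apply, chartTo, Category.assoc, e.inv_hom_id, Category.comp_id]

lemma chartTo_eq_iff (σ : F.cones) (p : chart k σ.1) (x : X) :
    chartTo F e σ p = x ↔ F.chartι k σ p = e.hom x := by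
  rw [← e.hom.homeomorph.injective.eq_iff, ← hom_chartTo F e]
  rfl

lemma exists_chartTo_eq (x : X) : ∃ σ, ∃ p, chartTo F e σ p = x := by
  simpa only [chartTo_eq_iff] using F.exists_chartι_eq k (e.hom x)

lemma SpecMap_chartMap_chartTo {τ σ : F.cones} (h : τ.1 ≤ σ.1) :
    Spec.map (CommRingCat.ofHom (chartMap k h)) ≫ chartTo F e σ = chartTo F e τ := by
  rw [chartTo, ← Category.assoc, F.SpecMap_chartMap_chartι k h, chartTo]

lemma chartTo_comp {str : X ⟶ Spec (.of k)} (he : e.hom ≫ F.toricStr k = str) (σ : F.cones) :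
    chartTo F e σ ≫ str =
      Spec.map (CommRingCat.ofHom (algebraMap k (AddMonoidAlgebra k (dualMonoid σ.1)))) := by
  rw [← he, chartTo, Category.assoc, e.inv_hom_id_assoc, F.chartι_toricStr]

/-- The torus in a scheme identified with the toric variety. -/
def torusIn : Set X := Set.range (chartTo F e F.zeroCone)

lemma torusIn_eq_preimage : torusIn F e = e.hom ⁻¹' F.torus k := by
  ext x
  exact exists_congr fun p => chartTo_eq_iff F e _ p x

lemma torusIn_eq_compl {D : Set X} (hD : e.hom ⁻¹' F.toricBoundary k = D) :
    torusIn F e = Dᶜ := by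
  rw [torusIn_eq_preimage, ← hD, F.toricBoundary_eq_compl k, Set.preimage_compl, compl_compl]

lemma chartTo_mem_torusIn_iff {σ : F.cones} {m : Fin d → ℤ} (hm : m ∈ dualMonoid σ.1)
    (hpos : ∀ v ∈ σ.1, pairing m v = 0 → v = 0)
    (p : PrimeSpectrum (AddMonoidAlgebra k (dualMonoid σ.1))) :
    chartTo F e σ p ∈ torusIn F e ↔
      AddMonoidAlgebra.single (⟨m, hm⟩ : dualMonoid σ.1) (1 : k) ∉ p.asIdeal := by
  rw [← F.chartι_mem_torus_iff k hm hpos, torusIn_eq_preimage, Set.mem_preimage]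
  exact Eq.to_iff (congrArg (· ∈ F.torus k) (hom_chartTo F e σ p))

lemma SpecMap_charHom_chartTo {R : Type u} [CommRing R] [Algebra k R]
    (χ : Multiplicative (Fin d → ℤ) →* R) (σ : F.cones) :
    Spec.map (CommRingCat.ofHom (charHom (k := k) σ.1 χ).toRingHom) ≫ chartTo F e σ =
      Spec.map (CommRingCat.ofHom (charHom (k := k) F.zeroCone.1 χ).toRingHom) ≫
        chartTo F e F.zeroCone := by
  have hle : F.zeroCone.1 ≤ σ.1 := bot_le
  rw [← SpecMap_chartMap_chartTo F e hle, ← Spec.map_comp_assoc, ← CommRingCat.ofHom_comp,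
    charHom_comp_chartMap]

lemma exists_SpecMap_chartTo_eq {R : Type u} [CommRing R] [IsLocalRing R]
    (f : Spec (.of R) ⟶ X) : ∃ (σ : F.cones) (φ : AddMonoidAlgebra k (dualMonoid σ.1) →+* R),
      Spec.map (CommRingCat.ofHom φ) ≫ chartTo F e σ = f := by
  obtain ⟨σ, p, hp⟩ := exists_chartTo_eq F e (f (IsLocalRing.closedPoint R))
  have hrange : Set.range f ⊆ Set.range (chartTo F e σ) := by
    rintro _ ⟨x, rfl⟩
    exact ((IsLocalRing.specializes_closedPoint x).map f.continuous).mem_open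
      (chartTo F e σ).isOpenEmbedding.isOpen_range ⟨p, hp⟩
  obtain ⟨φ, hφ⟩ := Spec.map_surjective (IsOpenImmersion.lift (chartTo F e σ) f hrange)
  refine ⟨σ, φ.hom, ?_⟩
  change Spec.map φ ≫ _ = f
  rw [hφ, IsOpenImmersion.lift_fac]

/-- The generic point of the one-parameter subgroup `u`: `χ^m ↦ t^⟨m, u⟩`. -/
def laurentChar (k : Type*) [Field k] (u : Fin d → ℤ) :
    Multiplicative (Fin d → ℤ) →* LaurentSeries k where
  toFun m := HahnSeries.single (m.toAdd ⬝ᵥ u) 1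
  map_one' := by
    rw [toAdd_one, zero_dotProduct]
    rfl
  map_mul' a b := by rw [HahnSeries.single_mul_single, one_mul, toAdd_mul, add_dotProduct]

lemma nonneg_of_algebraMap_eq_single {k : Type*} [Field k] {f : PowerSeries k} {n : ℤ}
    (h : algebraMap (PowerSeries k) (LaurentSeries k) f = HahnSeries.single n 1) : 0 ≤ n := by
  by_contra! hneg
  have hcoeff := congrArg (fun g : LaurentSeries k => g.coeff n) h
  rw [HahnSeries.coeff_single_same, LaurentSeries.coe_algebraMap, PowerSeries.coeff_coe,
    if_pos hneg] at hcoeff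
  exact zero_ne_one hcoeff

/-- By the valuative criterion the limit of the one-parameter subgroup `u` exists; it lies in the
chart of a cone that contains `u`. -/
lemma exists_cone_dotProduct_nonneg {str : X ⟶ Spec (.of k)} (he : e.hom ≫ F.toricStr k = str)
    [UniversallyClosed str] (u : Fin d → ℤ) :
    ∃ σ : F.cones, ∀ m ∈ dualMonoid σ.1, 0 ≤ m ⬝ᵥ u := by
  have hex : ValuativeCriterion.Existence str :=
    (UniversallyClosed.eq_valuativeCriterion.le _ _ _ ‹_›).1
  let S : ValuativeCommSq str :=
    { R := PowerSeries k
      K := LaurentSeries k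
      i₁ := Spec.map (CommRingCat.ofHom
        (charHom (k := k) F.zeroCone.1 (laurentChar k u)).toRingHom) ≫ chartTo F e F.zeroCone
      i₂ := Spec.map (CommRingCat.ofHom (algebraMap k (PowerSeries k)))
      commSq := ⟨by
        rw [Category.assoc, chartTo_comp F e he, ← Spec.map_comp, ← Spec.map_comp,
          ← CommRingCat.ofHom_comp, ← CommRingCat.ofHom_comp]
        exact congrArg (fun f => Spec.map (CommRingCat.ofHom f))
          (charHom (k := k) F.zeroCone.1 (laurentChar k u)).comp_algebraMap⟩ }
  obtain ⟨⟨l, hl, -⟩⟩ := (hex S).exists_lift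
  obtain ⟨σ, φ, rfl⟩ := exists_SpecMap_chartTo_eq (R := PowerSeries k) F e l
  refine ⟨σ, fun m hm => nonneg_of_algebraMap_eq_single (f := φ (.single ⟨m, hm⟩ 1)) ?_⟩
  change Spec.map (CommRingCat.ofHom (algebraMap (PowerSeries k) (LaurentSeries k))) ≫ _ =
    Spec.map _ ≫ _ at hl
  rw [← SpecMap_charHom_chartTo F e (laurentChar k u) σ, ← Category.assoc, cancel_mono,
    ← Spec.map_comp] at hl
  have hφ := congrArg CommRingCat.Hom.hom (Spec.map_injective hl)
  exact (RingHom.congr_fun hφ _).trans (charHom_single σ.1 (laurentChar k u) ⟨m, hm⟩)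

end Charts

/-! ## Locally principal ideals and orders along a prime element -/

lemma exists_eq_span_singleton_mul_of_le {A : Type*} [CommRing A] {J : Ideal A} {a : A}
    (h : J ≤ Ideal.span {a}) : ∃ J' : Ideal A, J = Ideal.span {a} * J' := by
  refine ⟨Submodule.comap (LinearMap.mulLeft A a) J, le_antisymm ?_ ?_⟩
  · refine Ideal.le_span_singleton_mul_iff.2 fun x hx => ?_
    obtain ⟨y, rfl⟩ := Ideal.mem_span_singleton.1 (h hx)
    exact ⟨y, hx, rfl⟩
  · exact Ideal.span_singleton_mul_le_iff.2 fun y hy => hy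

/-- An ideal is locally principal: at every prime it is generated by one of its elements. -/
def IsLocallyPrincipal {A : Type*} [CommRing A] (I : Ideal A) : Prop :=
  ∀ p : Ideal A, p.IsPrime → ∃ t ∈ I, ∀ a ∈ I, ∃ b ∉ p, t ∣ b * a

namespace IsLocallyPrincipal

lemma map {A B : Type*} [CommRing A] [CommRing B] {I : Ideal A}
    (h : IsLocallyPrincipal I) (f : A →+* B) : IsLocallyPrincipal (I.map f) := by
  intro p hp
  obtain ⟨t, ht, hI⟩ := h (p.comap f) (hp.comap f)
  refine ⟨f t, Ideal.mem_map_of_mem f ht, fun a ha => ?_⟩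
  induction ha using Submodule.span_induction with
  | mem x hx =>
    obtain ⟨y, hy, rfl⟩ := hx
    obtain ⟨b, hb, hdvd⟩ := hI y hy
    exact ⟨f b, hb, by rw [← map_mul]; exact map_dvd f hdvd⟩
  | zero => exact ⟨1, (Ideal.ne_top_iff_one p).1 hp.ne_top, by rw [mul_zero]; exact dvd_zero _⟩
  | add x y _ _ hx hy =>
    obtain ⟨b, hb, c, hc⟩ := hx
    obtain ⟨b', hb', c', hc'⟩ := hy
    refine ⟨b * b', fun h => (hp.mem_or_mem h).elim hb hb', b' * c + b * c', ?_⟩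
    linear_combination b' * hc + b * hc'
  | smul r x _ hx =>
    obtain ⟨b, hb, c, hc⟩ := hx
    refine ⟨b, hb, r * c, ?_⟩
    rw [smul_eq_mul]
    linear_combination r * hc

variable {S : Type*} [CommRing S] [IsDomain S] {s : S} {J : Ideal S}

lemma of_span_singleton_mul {a : S} (ha : a ≠ 0)
    (h : IsLocallyPrincipal (Ideal.span {a} * J)) : IsLocallyPrincipal J := by
  intro p hp
  obtain ⟨t, ht, hloc⟩ := h p hp
  obtain ⟨t, htJ, rfl⟩ := Ideal.mem_span_singleton_mul.1 ht
  refine ⟨t, htJ, fun x hx => ?_⟩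
  obtain ⟨b, hb, hdvd⟩ := hloc (a * x) (Ideal.mem_span_singleton_mul.2 ⟨x, hx, rfl⟩)
  rw [mul_left_comm] at hdvd
  exact ⟨b, hb, (mul_dvd_mul_iff_left ha).1 hdvd⟩

lemma eq_top_of_prime_mem_radical (hJ : IsLocallyPrincipal J) (hs : Prime s)
    (hrad : s ∈ J.radical) (hle : ¬ J ≤ Ideal.span {s}) : J = ⊤ := by
  by_contra htop
  obtain ⟨n, hn⟩ := hrad
  obtain ⟨z, hz, hJz⟩ := Ideal.exists_le_maximal J htop
  have hsz : s ∈ z := hz.isPrime.mem_of_pow_mem n (hJz hn)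
  obtain ⟨t, ht, hloc⟩ := hJ z hz.isPrime
  have hst : ¬ s ∣ t := by
    intro hdvd
    refine hle fun a ha => ?_
    obtain ⟨b, hb, hba⟩ := hloc a ha
    have hsb : ¬ s ∣ b := fun h => hb (Ideal.mem_of_dvd z h hsz)
    exact Ideal.mem_span_singleton.2 ((hs.dvd_or_dvd (hdvd.trans hba)).resolve_left hsb)
  obtain ⟨b, hb, q, hq⟩ := hloc _ hn
  obtain ⟨r, rfl⟩ := hs.pow_dvd_of_dvd_mul_left n hst ⟨b, by rw [← hq, mul_comm]⟩
  have hbt : b = t * r := mul_left_cancel₀ (pow_ne_zero n hs.ne_zero) (by linear_combination hq)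
  exact hb (hbt ▸ z.mul_mem_right _ (hJz ht))

lemma exists_eq_span_pow (hJ : IsLocallyPrincipal J) (hs : Prime s) (hrad : s ∈ J.radical) :
    ∃ c : ℕ, J = Ideal.span {s ^ c} := by
  obtain ⟨c, hle, hnot⟩ : ∃ c, J ≤ Ideal.span {s ^ c} ∧ ¬ J ≤ Ideal.span {s ^ (c + 1)} := by
    by_contra! h
    have hall (c : ℕ) : J ≤ Ideal.span {s ^ c} := by
      induction c with
      | zero => rw [pow_zero, Ideal.span_singleton_one]; exact le_top
      | succ c ih => exact h c ih
    obtain ⟨n, hn⟩ := hrad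
    have hdvd : s ^ (n + 1) ∣ s ^ n := Ideal.mem_span_singleton.1 (hall (n + 1) hn)
    exact absurd ((pow_dvd_pow_iff hs.ne_zero hs.not_isUnit).1 hdvd) (by omega)
  have hsc : s ^ c ≠ 0 := pow_ne_zero c hs.ne_zero
  obtain ⟨J', hJ'⟩ := exists_eq_span_singleton_mul_of_le hle
  have hJJ' : J ≤ J' := hJ'.trans_le Ideal.mul_le_right
  have hleJ : ¬ J' ≤ Ideal.span {s} := by
    intro h
    apply hnot
    rw [hJ', pow_succ, ← Ideal.span_singleton_mul_span_singleton]
    exact Ideal.mul_mono_right h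
  have hlp : IsLocallyPrincipal J' := of_span_singleton_mul hsc (hJ' ▸ hJ)
  have htop := hlp.eq_top_of_prime_mem_radical hs (Ideal.radical_mono hJJ' hrad) hleJ
  exact ⟨c, by rw [hJ', htop, Ideal.mul_top]⟩

/-- The local generator at the centre of the order along `s`. -/
lemma exists_emultiplicity_eq {A : Type*} [CommRing A] {I : Ideal A} (hI : IsLocallyPrincipal I)
    (Ψ : A →+* S) (hs : Prime s) {c : ℕ} (hc : I.map Ψ = Ideal.span {s ^ c}) :
    ∃ t ∈ I, (∀ a ∈ I, ∃ b, ¬ s ∣ Ψ b ∧ t ∣ b * a) ∧ emultiplicity s (Ψ t) = c := by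
  have hsp : (Ideal.span {s}).IsPrime := (Ideal.span_singleton_prime hs.ne_zero).2 hs
  obtain ⟨t, ht, hloc⟩ := hI ((Ideal.span {s}).comap Ψ) (hsp.comap Ψ)
  simp only [Ideal.mem_comap, Ideal.mem_span_singleton] at hloc
  refine ⟨t, ht, hloc, emultiplicity_eq_coe.2 ⟨?_, fun hdvd => ?_⟩⟩
  · rw [← Ideal.mem_span_singleton, ← hc]
    exact Ideal.mem_map_of_mem Ψ ht
  have hall : I.map Ψ ≤ Ideal.span {s ^ (c + 1)} := by
    refine Ideal.map_le_iff_le_comap.2 fun a ha => ?_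
    obtain ⟨b, hb, hta⟩ := hloc a ha
    have hprod : s ^ (c + 1) ∣ Ψ b * Ψ a := by
      rw [← map_mul]
      exact hdvd.trans (map_dvd Ψ hta)
    exact Ideal.mem_span_singleton.2 (hs.pow_dvd_of_dvd_mul_left _ hb hprod)
  rw [hc, Ideal.span_singleton_le_span_singleton,
    pow_dvd_pow_iff hs.ne_zero hs.not_isUnit] at hall
  omega

end IsLocallyPrincipal

/-- By Krull's principal ideal theorem a minimal prime over `f` has height at most one, so it
equals the nonzero prime it contains. -/
lemma exists_isPrime_le_of_mem {A ι : Type*} [CommRing A] [IsDomain A] [IsNoetherianRing A]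
    {I : ι → Ideal A} (hprime : ∀ i, I i ≠ ⊤ → (I i).IsPrime) (hne : ∀ i, I i ≠ ⊥)
    {p : Ideal A} [p.IsPrime] {f : A} (hfp : f ∈ p)
    (hf : ∀ q : Ideal A, q.IsPrime → q ≤ p → f ∈ q → ∃ i, I i ≤ q) :
    ∃ i, f ∈ I i ∧ I i ≤ p := by
  obtain ⟨q, hq, hqp⟩ := Ideal.exists_minimalPrimes_le ((Ideal.span_singleton_le_iff_mem p).2 hfp)
  have hqprime : q.IsPrime := hq.1.1
  have hfq : f ∈ q := (Ideal.span_singleton_le_iff_mem q).1 hq.1.2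
  obtain ⟨i, hi⟩ := hf q hqprime hqp hfq
  have hip : (I i).IsPrime := hprime i fun h => hqprime.ne_top (top_le_iff.1 (h ▸ hi))
  suffices hiq : I i = q from ⟨i, hiq ▸ hfq, hiq ▸ hqp⟩
  by_contra hne'
  have hbot := Ideal.height_add_one_le_of_lt_of_isPrime (bot_lt_iff_ne_bot.2 (hne i))
  rw [Ideal.height_bot, zero_add] at hbot
  have htwo := (add_le_add_left hbot 1).trans
    ((Ideal.height_add_one_le_of_lt_of_isPrime (hi.lt_of_ne hne')).trans
      (Ideal.height_le_one_of_isPrincipal_of_mem_minimalPrimes _ q hq))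
  exact absurd htwo (by decide)

/-- If near the centre of the order along `s` the function `f` vanishes only on the divisors
`I i`, then its order is a sum of the orders `c i` of these divisors. -/
lemma natCast_order_eq_zero {A S k ι : Type*} [CommRing A] [IsDomain A] [IsNoetherianRing A]
    [CommRing S] [IsDomain S] [AddMonoidWithOne k] (Ψ : A →+* S) {s : S} (hs : Prime s)
    {I : ι → Ideal A} (hprime : ∀ i, I i ≠ ⊤ → (I i).IsPrime) (hne : ∀ i, I i ≠ ⊥)
    (hlp : ∀ i, IsLocallyPrincipal (I i)) {c : ι → ℕ}
    (hc : ∀ i, (I i).map Ψ = Ideal.span {s ^ c i}) (hck : ∀ i, (c i : k) = 0) {e : ℕ} {f : A}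
    (hf : ∀ q : Ideal A, q.IsPrime → q ≤ (Ideal.span {s}).comap Ψ → f ∈ q → ∃ i, I i ≤ q)
    (he : emultiplicity s (Ψ f) = e) : (e : k) = 0 := by
  induction e using Nat.strong_induction_on generalizing f with
  | _ e ih =>
  rcases eq_or_ne e 0 with rfl | he0
  · exact Nat.cast_zero
  have hsp : (Ideal.span {s}).IsPrime := (Ideal.span_singleton_prime hs.ne_zero).2 hs
  have hpmem (a : A) : a ∈ (Ideal.span {s}).comap Ψ ↔ s ∣ Ψ a := Ideal.mem_span_singleton
  have hsf : s ∣ Ψ f := emultiplicity_ne_zero.1 (by rw [he]; exact_mod_cast he0)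
  have := hsp.comap Ψ
  obtain ⟨i, hfi, hip⟩ := exists_isPrime_le_of_mem hprime hne ((hpmem f).2 hsf) hf
  obtain ⟨t, ht, hloc, htc⟩ := (hlp i).exists_emultiplicity_eq Ψ hs (hc i)
  obtain ⟨b, hb, g, hg⟩ := hloc f hfi
  have hci : c i ≠ 0 := by
    have := emultiplicity_ne_zero.2 ((hpmem t).1 (hip ht))
    rw [htc] at this
    exact_mod_cast this
  have hsum : (e : ℕ∞) = c i + emultiplicity s (Ψ g) := by
    rw [← he, ← htc, ← emultiplicity_mul hs, ← map_mul, ← hg, map_mul, emultiplicity_mul hs,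
      emultiplicity_eq_zero.2 hb, zero_add]
  obtain ⟨e', he'⟩ : ∃ e' : ℕ, emultiplicity s (Ψ g) = e' :=
    ENat.ne_top_iff_exists.1 (fun h => by simp [h] at hsum) |>.imp fun _ h => h.symm
  rw [he'] at hsum
  obtain rfl : e = c i + e' := by exact_mod_cast hsum
  rw [Nat.cast_add, hck, zero_add]
  refine ih e' (by omega) (fun q hq hqp hgq => hf q hq hqp ?_) he'
  exact (hq.mem_or_mem (hg ▸ q.mul_mem_left t hgq)).resolve_left fun h => hb ((hpmem b).1 (hqp h))

/-! ## Stalks of ideals of closed subsets -/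

/-- The localization map `R → 𝒪_{Spec R, x}`. -/
def specToStalk (R : Type u) [CommRing R] (x : Spec (.of R)) :
    R →+* (Spec (.of R)).presheaf.stalk x :=
  ((Scheme.ΓSpecIso (.of R)).inv ≫ (Spec (.of R)).presheaf.germ ⊤ x trivial).hom

lemma fromSpecStalk_eq_specMap_specToStalk (R : Type u) [CommRing R] (x : Spec (.of R)) :
    (Spec (.of R)).fromSpecStalk x = Spec.map (CommRingCat.ofHom (specToStalk R x)) :=
  Spec.fromSpecStalk_eq _ _

lemma isLocalization_specToStalk (R : Type u) [CommRing R] (x : PrimeSpectrum R) :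
    @IsLocalization R _ x.asIdeal.primeCompl ((Spec (.of R)).presheaf.stalk x) _
      (specToStalk R x).toAlgebra :=
  StructureSheaf.IsLocalization.to_stalk R x

lemma stalkMap_comp_specToStalk {R S : Type u} [CommRing R] [CommRing S] (f : R →+* S)
    (x : Spec (.of S)) :
    ((Spec.map (CommRingCat.ofHom f)).stalkMap x).hom.comp
      (specToStalk R (Spec.map (CommRingCat.ofHom f) x)) = (specToStalk S x).comp f := by
  have h := Scheme.SpecMap_stalkMap_fromSpecStalk (Spec.map (CommRingCat.ofHom f)) (x := x)
  rw [fromSpecStalk_eq_specMap_specToStalk, fromSpecStalk_eq_specMap_specToStalk,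
    ← Spec.map_comp, ← Spec.map_comp] at h
  exact congrArg CommRingCat.Hom.hom (Spec.map_injective h)

lemma stalkIdeal_eq_top {X : Scheme.{u}} {Z : Set X} (hZ : IsClosed Z) {x : X} (hx : x ∉ Z) :
    stalkIdeal Z x = ⊤ := by
  suffices h : X.fromSpecStalk x ⁻¹' Z = ∅ from
    (congrArg PrimeSpectrum.vanishingIdeal h).trans PrimeSpectrum.vanishingIdeal_empty
  refine Set.eq_empty_iff_forall_notMem.2 fun q hq => hx ?_
  have hspec := (IsLocalRing.specializes_closedPoint q).map (X.fromSpecStalk x).continuous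
  rw [Scheme.fromSpecStalk_closedPoint] at hspec
  exact hspec.mem_closed hZ hq

lemma stalkIdeal_ne_top {X : Scheme.{u}} {Z : Set X} {x : X} (hx : x ∈ Z) :
    stalkIdeal Z x ≠ ⊤ := by
  intro h
  have hone : (1 : X.presheaf.stalk x) ∈ stalkIdeal Z x := h ▸ Submodule.mem_top
  rw [stalkIdeal, PrimeSpectrum.mem_vanishingIdeal] at hone
  refine (Ideal.ne_top_iff_one _).1 (IsLocalRing.closedPoint (X.presheaf.stalk x)).isPrime.ne_top
    (hone (IsLocalRing.closedPoint _) ?_)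
  change X.fromSpecStalk x _ ∈ Z
  rwa [Scheme.fromSpecStalk_closedPoint]

/-- The stalk at `y` of the inverse image ideal of a closed subset. -/
def pulledIdeal {Y X : Scheme.{u}} (f : Y ⟶ X) (Z : Set X) (y : Y) :
    Ideal (Y.presheaf.stalk y) :=
  (stalkIdeal Z (f y)).map (f.stalkMap y).hom

lemma pulledIdeal_comp {W Y X : Scheme.{u}} (f : W ⟶ Y) (g : Y ⟶ X) (Z : Set X) (w : W) :
    pulledIdeal (f ≫ g) Z w = (pulledIdeal g Z (f w)).map (f.stalkMap w).hom := by
  rw [pulledIdeal, pulledIdeal, Scheme.Hom.stalkMap_comp, Ideal.map_map]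
  rfl

lemma map_equiv_vanishingIdeal {R S : Type*} [CommRing R] [CommRing S] (E : R ≃+* S)
    (Z : Set (PrimeSpectrum R)) :
    (PrimeSpectrum.vanishingIdeal Z).map (E : R →+* S) =
      PrimeSpectrum.vanishingIdeal (PrimeSpectrum.comap (E : R →+* S) ⁻¹' Z) := by
  rw [Ideal.map_comap_of_equiv]
  ext a
  simp only [Ideal.mem_comap, PrimeSpectrum.mem_vanishingIdeal]
  refine ⟨fun h q hq => ?_, fun h q hq => ?_⟩
  · have := h _ hq
    rwa [PrimeSpectrum.comap_asIdeal, Ideal.mem_comap, RingEquiv.coe_toRingHom,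
      RingEquiv.apply_symm_apply] at this
  · refine h (PrimeSpectrum.comap (E.symm : S →+* R) q) ?_
    rwa [Set.mem_preimage, ← PrimeSpectrum.comap_comp_apply, RingEquiv.symm_comp,
      PrimeSpectrum.comap_id]

lemma pulledIdeal_of_isOpenImmersion {Y X : Scheme.{u}} (f : Y ⟶ X) [IsOpenImmersion f]
    (Z : Set X) (y : Y) : pulledIdeal f Z y = stalkIdeal (f ⁻¹' Z) y := by
  let E : X.presheaf.stalk (f y) ≃+* Y.presheaf.stalk y :=
    (asIso (f.stalkMap y)).commRingCatIsoToRingEquiv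
  refine (map_equiv_vanishingIdeal E _).trans (congrArg PrimeSpectrum.vanishingIdeal ?_)
  ext q
  exact Eq.to_iff (congrArg (fun g : Spec (Y.presheaf.stalk y) ⟶ X => g q ∈ Z)
    (Scheme.SpecMap_stalkMap_fromSpecStalk f (x := y)))

/-- The radical ideal of a closed subset of an affine scheme. -/
def idealOn {R : Type u} [CommRing R] (Z : Set (Spec (.of R))) : Ideal R :=
  PrimeSpectrum.vanishingIdeal (R := R) Z

lemma mem_iff_idealOn_le {R : Type u} [CommRing R] {Z : Set (Spec (.of R))} (hZ : IsClosed Z)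
    (p : PrimeSpectrum R) : p ∈ Z ↔ idealOn Z ≤ p.asIdeal := by
  conv_lhs => rw [← hZ.closure_eq]
  exact Set.ext_iff.1 (PrimeSpectrum.zeroLocus_vanishingIdeal_eq_closure (R := R) Z).symm p

lemma vanishingIdeal_comap_preimage {R S : Type*} [CommRing R] [CommRing S] [Algebra R S]
    (M : Submonoid R) [IsLocalization M S] {Z : Set (PrimeSpectrum R)} (hZ : IsClosed Z) :
    PrimeSpectrum.vanishingIdeal (PrimeSpectrum.comap (algebraMap R S) ⁻¹' Z) =
      (PrimeSpectrum.vanishingIdeal Z).map (algebraMap R S) := by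
  have hclosed : PrimeSpectrum.zeroLocus (PrimeSpectrum.vanishingIdeal Z : Set R) = Z := by
    rw [PrimeSpectrum.zeroLocus_vanishingIdeal_eq_closure, hZ.closure_eq]
  have hradical : (PrimeSpectrum.vanishingIdeal Z).radical = PrimeSpectrum.vanishingIdeal Z := by
    rw [← PrimeSpectrum.vanishingIdeal_zeroLocus_eq_radical, hclosed]
  calc PrimeSpectrum.vanishingIdeal (PrimeSpectrum.comap (algebraMap R S) ⁻¹' Z)
      = PrimeSpectrum.vanishingIdeal (PrimeSpectrum.zeroLocus
          ((PrimeSpectrum.vanishingIdeal Z).map (algebraMap R S) : Set S)) := by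
        rw [Ideal.map, PrimeSpectrum.zeroLocus_span, ← PrimeSpectrum.preimage_comap_zeroLocus,
          hclosed]
    _ = (PrimeSpectrum.vanishingIdeal Z).map (algebraMap R S) := by
        rw [PrimeSpectrum.vanishingIdeal_zeroLocus_eq_radical, ← IsLocalization.map_radical M,
          hradical]

lemma stalkIdeal_spec {R : Type u} [CommRing R] {Z : Set (Spec (.of R))} (hZ : IsClosed Z)
    (x : Spec (.of R)) :
    stalkIdeal Z x = (idealOn Z).map (specToStalk R x) := by
  let _ := (specToStalk R x).toAlgebra
  let x' : PrimeSpectrum R := x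
  have : IsLocalization x'.asIdeal.primeCompl ((Spec (.of R)).presheaf.stalk x) :=
    isLocalization_specToStalk R x'
  have h : (Spec (.of R)).fromSpecStalk x ⁻¹' Z = PrimeSpectrum.comap (specToStalk R x) ⁻¹' Z := by
    rw [fromSpecStalk_eq_specMap_specToStalk]
    rfl
  exact (congrArg PrimeSpectrum.vanishingIdeal h).trans
    (vanishingIdeal_comap_preimage (R := R) x'.asIdeal.primeCompl hZ)

lemma pulledIdeal_SpecMap_comp {R A : Type u} [CommRing R] [CommRing A] {X : Scheme.{u}}
    (g : Spec (.of A) ⟶ X) [IsOpenImmersion g] {Z : Set X} (hZ : IsClosed Z) (θ : A →+* R)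
    (w : Spec (.of R)) :
    pulledIdeal (Spec.map (CommRingCat.ofHom θ) ≫ g) Z w =
      ((idealOn (g ⁻¹' Z)).map θ).map (specToStalk R w) := by
  rw [pulledIdeal_comp, pulledIdeal_of_isOpenImmersion,
    stalkIdeal_spec (hZ.preimage g.continuous), Ideal.map_map, stalkMap_comp_specToStalk,
    Ideal.map_map]

lemma exists_mem_forall_dvd_mul_of_map_eq_span {A B : Type*} [CommRing A] [CommRing B] [Algebra A B]
    (p : Ideal A) [hp : p.IsPrime] [IsLocalization.AtPrime B p] {I : Ideal A} {t : B}
    (h : I.map (algebraMap A B) = Ideal.span {t}) :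
    ∃ a ∈ I, ∀ x ∈ I, ∃ b ∉ p, a ∣ b * x := by
  have ht : t ∈ I.map (algebraMap A B) := h ▸ Ideal.mem_span_singleton_self t
  obtain ⟨⟨a, s⟩, hs⟩ := (IsLocalization.mem_map_algebraMap_iff p.primeCompl _).1 ht
  refine ⟨a.1, a.2, fun x hx => ?_⟩
  obtain ⟨r, hr⟩ := Ideal.mem_span_singleton.1 (h ▸ Ideal.mem_map_of_mem (algebraMap A B) hx)
  obtain ⟨⟨n, m⟩, hm⟩ := IsLocalization.surj p.primeCompl r
  dsimp only at hs hm
  have heq : algebraMap A B (s.1 * m.1 * x) = algebraMap A B (a.1 * n) := by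
    simp only [map_mul, ← hs, ← hm, hr]
    ring
  obtain ⟨c, hc⟩ := (IsLocalization.eq_iff_exists p.primeCompl B).1 heq
  exact ⟨c.1 * (s.1 * m.1), (c * (s * m)).2, c.1 * n, by linear_combination hc⟩

lemma isLocallyPrincipal_idealOn {A : Type u} [CommRing A] {X : Scheme.{u}}
    (g : Spec (.of A) ⟶ X) [IsOpenImmersion g] {Z : Set X} (hZ : IsClosed Z)
    (hprinc : ∀ x ∈ Z, ∃ t, stalkIdeal Z x = Ideal.span {t}) :
    IsLocallyPrincipal (idealOn (g ⁻¹' Z)) := by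
  intro p hp
  let x : Spec (.of A) := (⟨p, hp⟩ : PrimeSpectrum A)
  let _ := (specToStalk A x).toAlgebra
  have : IsLocalization.AtPrime ((Spec (.of A)).presheaf.stalk x) p :=
    isLocalization_specToStalk A ⟨p, hp⟩
  obtain ⟨t, ht⟩ : ∃ t, stalkIdeal Z (g x) = Ideal.span {t} := by
    by_cases h : g x ∈ Z
    · exact hprinc _ h
    · exact ⟨1, by rw [stalkIdeal_eq_top hZ h, Ideal.span_singleton_one]⟩
  refine exists_mem_forall_dvd_mul_of_map_eq_span (B := (Spec (.of A)).presheaf.stalk x) p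
    (t := (g.stalkMap x).hom t) ?_
  have hpull := pulledIdeal_of_isOpenImmersion g Z x
  rw [pulledIdeal, ht, Ideal.map_span, Set.image_singleton,
    stalkIdeal_spec (hZ.preimage g.continuous)] at hpull
  exact hpull.symm

/-! ## Contact orders of one-parameter subgroups -/

lemma isUnit_single {R A : Type*} [Semiring R] [AddGroup A] (m : A) :
    IsUnit (AddMonoidAlgebra.single m (1 : R)) :=
  (Group.isUnit (Multiplicative.ofAdd m)).map (AddMonoidAlgebra.of R A)

section

variable {d : ℕ} (k : Type u) [Field k] (σ : PointedCone ℝ (Fin d → ℝ)) (u : Fin d → ℤ)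

instance : IsDomain (AddMonoidAlgebra k (dualMonoid σ)) := by
  have : UniqueSums (dualMonoid σ) :=
    UniqueSums.of_injective_addHom (dualMonoid σ).subtype.toAddHom Subtype.val_injective
      inferInstance
  exact NoZeroDivisors.to_isDomain _

instance : IsDomain (AddMonoidAlgebra k (Fin d → ℤ)) := NoZeroDivisors.to_isDomain _

/-- For a lattice vector `u` nonnegative on `σ^∨ ∩ M`, the characters of
`T × 𝔸^1 → U_σ`, `(τ, s) ↦ τ s^u`. -/
def oneParamChar (hu : ∀ m ∈ dualMonoid σ, 0 ≤ m ⬝ᵥ u) :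
    Multiplicative (dualMonoid σ) →* Polynomial (AddMonoidAlgebra k (Fin d → ℤ)) where
  toFun m := Polynomial.X ^ (m.toAdd.1 ⬝ᵥ u).toNat *
    Polynomial.C (AddMonoidAlgebra.single m.toAdd.1 1)
  map_one' := by
    rw [toAdd_one, ZeroMemClass.coe_zero, zero_dotProduct, ← AddMonoidAlgebra.one_def, map_one,
      mul_one, Int.toNat_zero, pow_zero]
  map_mul' a b := by
    rw [toAdd_mul, AddSubmonoid.coe_add, add_dotProduct,
      Int.toNat_add (hu _ a.toAdd.2) (hu _ b.toAdd.2), pow_add, mul_mul_mul_comm,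
      ← Polynomial.C_mul, AddMonoidAlgebra.single_mul_single, one_mul]

/-- The comorphism of `T × 𝔸^1 → U_σ`, `(τ, s) ↦ τ s^u`. -/
def oneParam (hu : ∀ m ∈ dualMonoid σ, 0 ≤ m ⬝ᵥ u) :
    AddMonoidAlgebra k (dualMonoid σ) →ₐ[k] Polynomial (AddMonoidAlgebra k (Fin d → ℤ)) :=
  AddMonoidAlgebra.lift k _ _ (oneParamChar k σ u hu)

lemma oneParam_single (hu : ∀ m ∈ dualMonoid σ, 0 ≤ m ⬝ᵥ u) (m : dualMonoid σ) :
    oneParam k σ u hu (AddMonoidAlgebra.single m 1) =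
      Polynomial.X ^ (m.1 ⬝ᵥ u).toNat * Polynomial.C (AddMonoidAlgebra.single m.1 1) := by
  rw [oneParam, AddMonoidAlgebra.lift_single, one_smul]
  rfl

lemma emultiplicity_X_oneParam_single (hu : ∀ m ∈ dualMonoid σ, 0 ≤ m ⬝ᵥ u) (m : dualMonoid σ) :
    emultiplicity Polynomial.X (oneParam k σ u hu (AddMonoidAlgebra.single m 1)) =
      (m.1 ⬝ᵥ u).toNat := by
  have hX : Prime (Polynomial.X : Polynomial (AddMonoidAlgebra k (Fin d → ℤ))) :=
    Polynomial.prime_X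
  have hunit : IsUnit (Polynomial.C (AddMonoidAlgebra.single m.1 (1 : k))) :=
    (isUnit_single m.1).map Polynomial.C
  rw [oneParam_single, emultiplicity_mul hX, emultiplicity_pow_self_of_prime hX,
    emultiplicity_eq_zero.2 fun h => hX.not_isUnit (isUnit_of_dvd_unit h hunit), add_zero]

end

section ContactOrders

variable {d : ℕ} (F : Fan d) {k : Type u} [Field k] (O : Orbifold k)
  (e : O.X ≅ F.toricVariety k) (σ : F.cones)

/-- The ideal of the component `Δ_i` of the boundary in the chart `U_σ`. -/
def chartIdeal (i : O.ι) : Ideal (AddMonoidAlgebra k (dualMonoid σ.1)) :=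
  idealOn (chartTo F e σ ⁻¹' (O.Δ i : Set O.X))

variable {O}

lemma isLocallyPrincipal_chartIdeal (i : O.ι) : IsLocallyPrincipal (chartIdeal F O e σ i) :=
  isLocallyPrincipal_idealOn _ (O.Δ i).isClosed fun x hx => by
    obtain ⟨t, ht, -⟩ := O.snc.parameters x
    exact ⟨_, ht ⟨i, hx⟩⟩

lemma isPrime_chartIdeal {i : O.ι} (hi : chartIdeal F O e σ i ≠ ⊤) :
    (chartIdeal F O e σ i).IsPrime := by
  have hne : (chartTo F e σ ⁻¹' (O.Δ i : Set O.X)).Nonempty := by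
    by_contra! h
    exact hi ((congrArg idealOn h).trans PrimeSpectrum.vanishingIdeal_empty)
  exact PrimeSpectrum.isIrreducible_iff_vanishingIdeal_isPrime.1
    ⟨hne, (O.snc.irreducible i).2.preimage (chartTo F e σ).isOpenEmbedding⟩

lemma isNoetherianRing_chart (he : e.hom ≫ F.toricStr k = O.str) :
    IsNoetherianRing (AddMonoidAlgebra k (dualMonoid σ.1)) := by
  have := O.projective.isProper
  have hft : LocallyOfFiniteType (chartTo F e σ ≫ O.str) := inferInstance
  rw [chartTo_comp F e he σ, HasRingHomProperty.Spec_iff (P := @LocallyOfFiniteType)] at hft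
  have : Algebra.FiniteType k (AddMonoidAlgebra k (dualMonoid σ.1)) :=
    RingHom.finiteType_algebraMap.1 hft
  exact Algebra.FiniteType.isNoetherianRing k _

variable (hΔ : e.hom ⁻¹' F.toricBoundary k = O.boundary)
include hΔ

lemma single_mem_iff_exists_chartIdeal_le {σ : F.cones} {m : Fin d → ℤ} (hm : m ∈ dualMonoid σ.1)
    (hpos : ∀ v ∈ σ.1, pairing m v = 0 → v = 0)
    (p : PrimeSpectrum (AddMonoidAlgebra k (dualMonoid σ.1))) :
    AddMonoidAlgebra.single (⟨m, hm⟩ : dualMonoid σ.1) (1 : k) ∈ p.asIdeal ↔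
      ∃ i, chartIdeal F O e σ i ≤ p.asIdeal := by
  rw [← not_iff_not, ← chartTo_mem_torusIn_iff F e hm hpos p, torusIn_eq_compl F e hΔ,
    Set.mem_compl_iff, not_iff_not, Orbifold.boundary, Set.mem_iUnion]
  exact exists_congr fun i => mem_iff_idealOn_le ((O.Δ i).isClosed.preimage
    (chartTo F e σ).continuous) p

lemma chartIdeal_ne_bot (i : O.ι) : chartIdeal F O e σ i ≠ ⊥ := by
  intro hi
  obtain ⟨m, hm, hpos⟩ := exists_mem_dualMonoid_pairing_eq_zero_imp (F.rational _ σ.2)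
    (F.stronglyConvex _ σ.2)
  have hzero := (single_mem_iff_exists_chartIdeal_le F e hΔ hm hpos
    ⟨⊥, Ideal.isPrime_bot⟩).2 ⟨i, hi.le⟩
  exact one_ne_zero (AddMonoidAlgebra.single_eq_zero.1 (Ideal.mem_bot.1 hzero))

lemma exists_chartIdeal_le_of_single_mem {p : PrimeSpectrum (AddMonoidAlgebra k (dualMonoid σ.1))}
    {a : dualMonoid σ.1} (ha : AddMonoidAlgebra.single a (1 : k) ∈ p.asIdeal) :
    ∃ i, chartIdeal F O e σ i ≤ p.asIdeal := by
  obtain ⟨m, hm, hpos⟩ := exists_mem_dualMonoid_pairing_eq_zero_imp (F.rational _ σ.2)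
    (F.stronglyConvex _ σ.2)
  rw [← single_mem_iff_exists_chartIdeal_le F e hΔ hm hpos p]
  by_contra hmp
  refine single_notMem_of_faceCone_eq_bot (F.rational _ σ.2) hmp ?_ a ha
  exact (Submodule.eq_bot_iff _).2 fun v hv => hpos v (mem_faceCone.1 hv).1 (mem_faceCone.1 hv).2

variable (u : Fin d → ℤ) (hu : ∀ m ∈ dualMonoid σ.1, 0 ≤ m ⬝ᵥ u)

lemma X_mem_radical_map_chartIdeal (i : O.ι) :
    Polynomial.X ∈ ((chartIdeal F O e σ i).map (oneParam k σ.1 u hu).toRingHom).radical := by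
  obtain ⟨m, hm, hpos⟩ := exists_mem_dualMonoid_pairing_eq_zero_imp (F.rational _ σ.2)
    (F.stronglyConvex _ σ.2)
  rw [Ideal.radical_eq_sInf, Ideal.mem_sInf]
  rintro q ⟨hq, hqp⟩
  have hmem : oneParam k σ.1 u hu (AddMonoidAlgebra.single ⟨m, hm⟩ 1) ∈ q :=
    (single_mem_iff_exists_chartIdeal_le F e hΔ hm hpos
      ⟨q.comap (oneParam k σ.1 u hu).toRingHom, hqp.comap _⟩).2
      ⟨i, Ideal.map_le_iff_le_comap.1 hq⟩
  rw [oneParam_single, Ideal.mul_unit_mem_iff_mem _ ((isUnit_single m).map Polynomial.C)] at hmem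
  exact hqp.mem_of_pow_mem _ hmem

/-- If every component has contact order zero in `k` then so has every monomial `χ^m`, since its
divisor is supported on the boundary; hence `u` vanishes in `k`. -/
lemma dotProduct_cast_eq_zero (he : e.hom ≫ F.toricStr k = O.str) {c : O.ι → ℕ}
    (hc : ∀ i, (chartIdeal F O e σ i).map (oneParam k σ.1 u hu).toRingHom =
      Ideal.span {Polynomial.X ^ c i})
    (hck : ∀ i, (c i : k) = 0) (m : Fin d → ℤ) : ((m ⬝ᵥ u : ℤ) : k) = 0 := by
  have := isNoetherianRing_chart F e σ he
  have hdual (m : Fin d → ℤ) (hm : m ∈ dualMonoid σ.1) : ((m ⬝ᵥ u : ℤ) : k) = 0 := by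
    rw [← Int.toNat_of_nonneg (hu m hm), Int.cast_natCast]
    exact natCast_order_eq_zero _ Polynomial.prime_X (fun i => isPrime_chartIdeal F e σ)
      (chartIdeal_ne_bot F e σ hΔ) (isLocallyPrincipal_chartIdeal F e σ) hc hck
      (fun q hq _ hmq => exists_chartIdeal_le_of_single_mem F e σ hΔ (p := ⟨q, hq⟩) hmq)
      (emultiplicity_X_oneParam_single k σ.1 u hu ⟨m, hm⟩)
  obtain ⟨m₀, hm₀, hpos⟩ := exists_mem_dualMonoid_pairing_eq_zero_imp (F.rational _ σ.2)
    (F.stronglyConvex _ σ.2)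
  obtain ⟨n, hn⟩ := exists_add_nsmul_mem (τ := ⊥) (w := m) (F.rational _ σ.2) hm₀
    (fun v => ⟨by rintro rfl; exact ⟨zero_mem _, pairing_zero_right m₀⟩,
      fun hv => hpos v hv.1 hv.2⟩)
    (by rintro v (rfl : v = 0); rw [pairing_zero_right])
  have hsum := hdual _ hn
  rwa [add_dotProduct, smul_dotProduct, Int.cast_add, nsmul_eq_mul, Int.cast_mul, hdual m₀ hm₀,
    mul_zero, add_zero] at hsum

/-- Some cone `σ` of a complete fan contains `u`, so that `s^u` extends to `s = 0` over `U_σ`. -/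
lemma exists_contact_orders (he : e.hom ≫ F.toricStr k = O.str) :
    ∃ (σ : F.cones) (hu : ∀ m ∈ dualMonoid σ.1, 0 ≤ m ⬝ᵥ u) (c : O.ι → ℕ),
      (∀ i, (chartIdeal F O e σ i).map (oneParam k σ.1 u hu).toRingHom =
        Ideal.span {Polynomial.X ^ c i}) ∧
      ((∀ i, (c i : k) = 0) → ∀ m : Fin d → ℤ, ((m ⬝ᵥ u : ℤ) : k) = 0) := by
  have := O.projective.isProper
  obtain ⟨σ, hu⟩ := exists_cone_dotProduct_nonneg F e he u
  have hpow (i : O.ι) := ((isLocallyPrincipal_chartIdeal F e σ i).map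
    (oneParam k σ.1 u hu).toRingHom).exists_eq_span_pow Polynomial.prime_X
    (X_mem_radical_map_chartIdeal F e σ hΔ u hu i)
  choose c hc using hpow
  exact ⟨σ, hu, c, hc, dotProduct_cast_eq_zero F e σ hΔ u hu he hc⟩

end ContactOrders

/-! ## The projective line over a field -/

section

variable (k : Type u) [Field k]

/-- The grading of `k[X_0, X_1]` by degree; the index type `Fin (1 + 1)` is that of
`projectiveSpace 1`. -/
abbrev lineGrading : ℕ → Submodule k (MvPolynomial (Fin (1 + 1)) k) :=
  MvPolynomial.homogeneousSubmodule (Fin (1 + 1)) k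

lemma X_mem_lineGrading (i : Fin (1 + 1)) : MvPolynomial.X i ∈ lineGrading k 1 :=
  MvPolynomial.isHomogeneous_X k i

/-- The structure map of `k[X_0, X_1]_{(f)}` as a `k`-algebra. -/
def toAway (f : MvPolynomial (Fin (1 + 1)) k) :
    k →+* HomogeneousLocalization.Away (lineGrading k) f :=
  (HomogeneousLocalization.fromZeroRingHom (lineGrading k) _).comp
    (algebraMap k (lineGrading k 0))

lemma val_toAway (f : MvPolynomial (Fin (1 + 1)) k) (c : k) :
    (toAway k f c).val =
      algebraMap (MvPolynomial (Fin (1 + 1)) k) (Localization.Away f) (MvPolynomial.C c) := rfl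

/-- The coordinate `X_j / X_i`, `j ≠ i`, on `X_i ≠ 0`. -/
def lineCoord (i : Fin (1 + 1)) : HomogeneousLocalization.Away (lineGrading k) (MvPolynomial.X i) :=
  HomogeneousLocalization.Away.mk _ (X_mem_lineGrading k i) 1 (MvPolynomial.X i.rev)
    (by rw [one_smul]; exact X_mem_lineGrading k _)

/-- `k[X] → k[X_0, X_1]_{(X_i)}`, `X ↦ X_j / X_i`. -/
def lineChartHom (i : Fin (1 + 1)) :
    Polynomial k →+* HomogeneousLocalization.Away (lineGrading k) (MvPolynomial.X i) :=
  Polynomial.eval₂RingHom (toAway k _) (lineCoord k i)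

lemma lineChartHom_C (i : Fin (1 + 1)) (c : k) :
    lineChartHom k i (Polynomial.C c) = toAway k _ c := Polynomial.eval₂_C _ _

lemma lineChartHom_X (i : Fin (1 + 1)) :
    lineChartHom k i Polynomial.X = lineCoord k i := Polynomial.eval₂_X _ _

lemma adjoin_zero_range_X : Algebra.adjoin (lineGrading k 0)
    (Set.range (MvPolynomial.X : Fin (1 + 1) → MvPolynomial (Fin (1 + 1)) k)) = ⊤ := by
  rw [← top_le_iff]
  rintro p -
  have hp : p ∈ Algebra.adjoin k
      (Set.range (MvPolynomial.X : Fin (1 + 1) → MvPolynomial (Fin (1 + 1)) k)) :=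
    MvPolynomial.adjoin_range_X.ge trivial
  induction hp using Algebra.adjoin_induction with
  | mem x hx => exact Algebra.subset_adjoin hx
  | algebraMap r => exact Subalgebra.algebraMap_mem _ (algebraMap k (lineGrading k 0) r)
  | add x y _ _ hx hy => exact add_mem hx hy
  | mul x y _ _ hx hy => exact mul_mem hx hy

lemma mk_prod_X_pow_eq_lineCoord_pow (i : Fin (1 + 1)) {a : ℕ} (e : Fin (1 + 1) → ℕ)
    (he : ∏ j, (MvPolynomial.X j : MvPolynomial (Fin (1 + 1)) k) ^ e j ∈ lineGrading k (a • 1))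
    (hsum : ∑ j, e j = a) :
    HomogeneousLocalization.Away.mk _ (X_mem_lineGrading k i) a (∏ j, MvPolynomial.X j ^ e j) he =
      lineCoord k i ^ e i.rev := by
  refine HomogeneousLocalization.val_injective _ ?_
  rw [HomogeneousLocalization.val_pow, lineCoord, HomogeneousLocalization.Away.val_mk,
    HomogeneousLocalization.Away.val_mk, Localization.mk_pow, Localization.mk_eq_mk_iff,
    Localization.r_iff_exists]
  refine ⟨1, ?_⟩
  subst hsum
  fin_cases i <;> simp [Fin.rev, Fin.prod_univ_two] <;> ring

lemma lineChartHom_surjective (i : Fin (1 + 1)) : Function.Surjective (lineChartHom k i) := by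
  intro x
  have hx : x ∈ (⊤ : Submodule (lineGrading k 0) _) := trivial
  rw [← HomogeneousLocalization.Away.span_mk_prod_pow_eq_top (X_mem_lineGrading k i)
    MvPolynomial.X (adjoin_zero_range_X k) (fun _ => 1) (X_mem_lineGrading k)] at hx
  change x ∈ (lineChartHom k i).range
  induction hx using Submodule.span_induction with
  | mem x hx =>
    obtain ⟨a, e, he, rfl⟩ := hx
    refine ⟨Polynomial.X ^ e i.rev, ?_⟩
    rw [map_pow, lineChartHom_X]
    refine (mk_prod_X_pow_eq_lineCoord_pow k i e _ ?_).symm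
    simpa only [smul_eq_mul, mul_one] using he
  | zero => exact zero_mem _
  | add x y _ _ hx hy => exact add_mem hx hy
  | smul a x _ hx =>
    obtain ⟨a, ha⟩ := a
    rw [lineGrading, MvPolynomial.homogeneousSubmodule_zero, Submodule.mem_one] at ha
    obtain ⟨c, rfl⟩ := ha
    rw [Algebra.smul_def]
    exact mul_mem ⟨Polynomial.C c, lineChartHom_C k i c⟩ hx

variable {k}

/-- Evaluation `k[X_0, X_1]_{(f)} → R` at a point `v` of `R²` where `f` is invertible. -/
def awayEval {R : Type u} [CommRing R] [Algebra k R] (v : Fin (1 + 1) → R)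
    (f : MvPolynomial (Fin (1 + 1)) k) (hf : IsUnit (MvPolynomial.aeval v f)) :
    HomogeneousLocalization.Away (lineGrading k) f →+* R :=
  (Localization.awayLift (MvPolynomial.aeval (R := k) v).toRingHom f hf).comp
    (algebraMap _ (Localization.Away f))

lemma awayEval_toAway {R : Type u} [CommRing R] [Algebra k R] (v : Fin (1 + 1) → R)
    (f : MvPolynomial (Fin (1 + 1)) k) (hf : IsUnit (MvPolynomial.aeval v f)) (c : k) :
    awayEval v f hf (toAway k f c) = algebraMap k R c := by
  change Localization.awayLift _ f hf (toAway k f c).val = _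
  rw [val_toAway, Localization.awayLift, IsLocalization.Away.lift_eq]
  exact MvPolynomial.aeval_C _ _

lemma awayEval_mk_mul {R : Type u} [CommRing R] [Algebra k R] (v : Fin (1 + 1) → R)
    (f : MvPolynomial (Fin (1 + 1)) k) (hf : IsUnit (MvPolynomial.aeval v f)) {d : ℕ}
    (hfd : f ∈ lineGrading k d) (n : ℕ) (a : MvPolynomial (Fin (1 + 1)) k) (ha) :
    awayEval v f hf (HomogeneousLocalization.Away.mk _ hfd n a ha) * MvPolynomial.aeval v f ^ n =
      MvPolynomial.aeval v a := by
  have lift_eq (p : MvPolynomial (Fin (1 + 1)) k) : MvPolynomial.aeval v p =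
      Localization.awayLift (MvPolynomial.aeval v).toRingHom f hf (algebraMap _ _ p) :=
    (IsLocalization.Away.lift_eq _ _ _).symm
  change Localization.awayLift _ f hf (HomogeneousLocalization.Away.mk _ hfd n a ha).val * _ = _
  rw [HomogeneousLocalization.Away.val_mk, ← map_pow, lift_eq (f ^ n), lift_eq a, ← map_mul,
    Localization.mk_eq_mk', IsLocalization.mk'_spec]

variable (k)

lemma lineChartHom_injective (i : Fin (1 + 1)) : Function.Injective (lineChartHom k i) := by
  have hf : IsUnit (MvPolynomial.aeval (R := k)
      (fun j => if j = i then (1 : Polynomial k) else Polynomial.X)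
      (MvPolynomial.X i : MvPolynomial (Fin (1 + 1)) k)) := by
    rw [MvPolynomial.aeval_X, if_pos rfl]; exact isUnit_one
  have h : (awayEval _ _ hf).comp (lineChartHom k i) = RingHom.id _ := by
    refine Polynomial.ringHom_ext (fun c => ?_) ?_
    · rw [RingHom.comp_apply, lineChartHom_C, awayEval_toAway]; rfl
    · rw [RingHom.comp_apply, lineChartHom_X]
      have := awayEval_mk_mul _ _ hf (X_mem_lineGrading k i) 1 (MvPolynomial.X i.rev)
        (by rw [one_smul]; exact X_mem_lineGrading k _)
      rw [MvPolynomial.aeval_X, MvPolynomial.aeval_X, if_pos rfl, one_pow, mul_one, if_neg] at this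
      · exact this
      · clear this hf; revert i; decide
  exact Function.LeftInverse.injective (g := awayEval _ _ hf) fun x => congrArg (fun f => f x) h

/-- The isomorphism of `k[X]` with the ring of the chart `X_i ≠ 0`. -/
def lineChartEquiv (i : Fin (1 + 1)) :
    Polynomial k ≃+* HomogeneousLocalization.Away (lineGrading k) (MvPolynomial.X i) :=
  RingEquiv.ofBijective (lineChartHom k i)
    ⟨lineChartHom_injective k i, lineChartHom_surjective k i⟩

/-- The open immersion of the affine line onto the locus `X_i ≠ 0` of `Proj k[X_0, X_1]`, with
coordinate `X_j / X_i`, `j ≠ i`. -/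
def projChart (i : Fin (1 + 1)) : Spec (.of (Polynomial k)) ⟶ Proj (lineGrading k) :=
  Spec.map (CommRingCat.ofHom (lineChartEquiv k i).symm.toRingHom) ≫
    Proj.awayι (lineGrading k) (MvPolynomial.X i) (X_mem_lineGrading k i) one_pos

lemma SpecMap_lineChartHom_projChart (i : Fin (1 + 1)) :
    Spec.map (CommRingCat.ofHom (lineChartHom k i)) ≫ projChart k i =
      Proj.awayι (lineGrading k) (MvPolynomial.X i) (X_mem_lineGrading k i) one_pos := by
  rw [projChart, ← Category.assoc, ← Spec.map_comp, ← CommRingCat.ofHom_comp]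
  have : (lineChartHom k i).comp (lineChartEquiv k i).symm.toRingHom = RingHom.id _ :=
    RingHom.ext fun x => (lineChartEquiv k i).apply_symm_apply x
  rw [this, CommRingCat.ofHom_id, Spec.map_id, Category.id_comp]

instance (i : Fin (1 + 1)) : IsOpenImmersion (projChart k i) := by
  have : IsIso (CommRingCat.ofHom (lineChartEquiv k i).symm.toRingHom) :=
    (ConcreteCategory.isIso_iff_bijective _).2 (lineChartEquiv k i).symm.bijective
  unfold projChart
  infer_instance

lemma projChart_toSpec (i : Fin (1 + 1)) :
    projChart k i ≫ Proj.toSpecZero (lineGrading k) ≫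
      Spec.map (CommRingCat.ofHom (algebraMap k (lineGrading k 0))) =
      Spec.map (CommRingCat.ofHom Polynomial.C) := by
  rw [projChart, Category.assoc, Proj.awayι_toSpecZero_assoc, ← Spec.map_comp,
    ← Spec.map_comp, ← CommRingCat.ofHom_comp, ← CommRingCat.ofHom_comp]
  congr 2
  refine RingHom.ext fun c => (lineChartEquiv k i).injective ?_
  rw [RingHom.comp_apply]
  refine ((lineChartEquiv k i).apply_symm_apply _).trans ?_
  exact (lineChartHom_C k i c).symm

lemma range_projChart (i : Fin (1 + 1)) : Set.range (projChart k i) =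
    (Proj.basicOpen (lineGrading k) (MvPolynomial.X i) : Set (Proj (lineGrading k))) := by
  rw [← Proj.opensRange_awayι (lineGrading k) _ (X_mem_lineGrading k i) one_pos]
  apply Set.Subset.antisymm
  · rintro _ ⟨x, rfl⟩
    exact ⟨_, rfl⟩
  · rintro _ ⟨x, rfl⟩
    rw [← SpecMap_lineChartHom_projChart]
    exact ⟨_, rfl⟩

lemma range_projChart_union : Set.range (projChart k 0) ∪ Set.range (projChart k 1) =
    Set.univ := by
  rw [Set.eq_univ_iff_forall]
  intro x
  have hx : x ∈ ⨆ i : Fin (1 + 1), Proj.basicOpen (lineGrading k) (MvPolynomial.X i) := by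
    rw [Proj.iSup_basicOpen_eq_top' (𝒜 := lineGrading k) MvPolynomial.X
      (fun i => ⟨1, X_mem_lineGrading k i⟩) (adjoin_zero_range_X k)]
    trivial
  obtain ⟨i, hi⟩ := TopologicalSpace.Opens.mem_iSup.1 hx
  rw [range_projChart, range_projChart]
  fin_cases i
  · exact Or.inl hi
  · exact Or.inr hi

variable {k} in
lemma awayEval_awayMap_lineChartHom {R : Type u} [CommRing R] [Algebra k R] (v : Fin (1 + 1) → R)
    {x : MvPolynomial (Fin (1 + 1)) k} (hf : IsUnit (MvPolynomial.aeval v x)) (i : Fin (1 + 1))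
    (hx : x = MvPolynomial.X i * MvPolynomial.X i.rev) {r : R} (hr : r * v i = v i.rev) :
    (awayEval v x hf).comp ((HomogeneousLocalization.awayMap (lineGrading k)
        (X_mem_lineGrading k i.rev) hx).comp (lineChartHom k i)) =
      (Polynomial.aeval (R := k) r).toRingHom := by
  refine Polynomial.ringHom_ext (fun c => ?_) ?_
  · have hc : HomogeneousLocalization.awayMap (lineGrading k) (X_mem_lineGrading k i.rev) hx
        (toAway k _ c) = toAway k x c :=
      HomogeneousLocalization.awayMap_fromZeroRingHom _ _ _ _
    rw [RingHom.comp_apply, RingHom.comp_apply, lineChartHom_C, hc, awayEval_toAway]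
    exact (Polynomial.aeval_C _ _).symm
  · have hmul := awayEval_mk_mul v x hf
      (hx ▸ SetLike.mul_mem_graded (X_mem_lineGrading k i) (X_mem_lineGrading k i.rev)) 1
      (MvPolynomial.X i.rev * MvPolynomial.X i.rev ^ 1) (by
        rw [one_smul, pow_one]
        exact SetLike.mul_mem_graded (X_mem_lineGrading k _) (X_mem_lineGrading k _))
    rw [RingHom.comp_apply, RingHom.comp_apply, lineChartHom_X, lineCoord,
      HomogeneousLocalization.awayMap_mk]
    refine (hf.pow 1).mul_right_cancel (hmul.trans ?_)
    change _ = Polynomial.aeval (R := k) r Polynomial.X * _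
    simp only [hx, Polynomial.aeval_X, map_mul, MvPolynomial.aeval_X, pow_one, ← hr]
    ring

variable {k} in
lemma SpecMap_aeval_projChart_eq_awayEval {R : Type u} [CommRing R] [Algebra k R]
    (v : Fin (1 + 1) → R) {x : MvPolynomial (Fin (1 + 1)) k}
    (hf : IsUnit (MvPolynomial.aeval v x)) (i : Fin (1 + 1))
    (hx : x = MvPolynomial.X i * MvPolynomial.X i.rev) {r : R} (hr : r * v i = v i.rev) :
    Spec.map (CommRingCat.ofHom (Polynomial.aeval (R := k) r).toRingHom) ≫ projChart k i =
      Spec.map (CommRingCat.ofHom (awayEval v x hf)) ≫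
        Proj.awayι (lineGrading k) x (m := 2)
          (hx ▸ SetLike.mul_mem_graded (X_mem_lineGrading k i) (X_mem_lineGrading k i.rev))
          two_pos := by
  rw [← Proj.SpecMap_awayMap_awayι (lineGrading k) (X_mem_lineGrading k i) one_pos
    (X_mem_lineGrading k i.rev) hx, ← SpecMap_lineChartHom_projChart,
    ← awayEval_awayMap_lineChartHom v hf i hx hr]
  simp only [CommRingCat.ofHom_comp, Spec.map_comp, Category.assoc]

lemma SpecMap_aeval_projChart {R : Type u} [CommRing R] [Algebra k R] {t s : R} (h : t * s = 1) :
    Spec.map (CommRingCat.ofHom (Polynomial.aeval (R := k) t).toRingHom) ≫ projChart k 0 =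
      Spec.map (CommRingCat.ofHom (Polynomial.aeval (R := k) s).toRingHom) ≫ projChart k 1 := by
  have hf : IsUnit (MvPolynomial.aeval (R := k) ![1, t]
      (MvPolynomial.X 0 * MvPolynomial.X 1 : MvPolynomial (Fin (1 + 1)) k)) := by
    simpa using IsUnit.of_mul_eq_one s h
  rw [SpecMap_aeval_projChart_eq_awayEval _ hf 0 rfl (mul_one t),
    SpecMap_aeval_projChart_eq_awayEval _ hf 1 (mul_comm _ _) ((mul_comm s t).trans h)]

lemma projChart_one_mem_range_zero (p : PrimeSpectrum (Polynomial k)) :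
    projChart k 1 p ∈ Set.range (projChart k 0) ↔ Polynomial.X ∉ p.asIdeal := by
  have hX : HomogeneousLocalization.Away.isLocalizationElem (X_mem_lineGrading k 1)
      (X_mem_lineGrading k 0) = lineChartEquiv k 1 Polynomial.X := by
    refine HomogeneousLocalization.val_injective _ ?_
    change _ = (lineChartHom k 1 Polynomial.X).val
    rw [lineChartHom_X]
    simp [lineCoord, HomogeneousLocalization.Away.val_mk, Fin.rev]
  rw [range_projChart]
  change Spec.map (CommRingCat.ofHom (lineChartEquiv k 1).symm.toRingHom) p ∈
    Proj.awayι (lineGrading k) (MvPolynomial.X 1) (X_mem_lineGrading k 1) one_pos ⁻¹ᵁ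
      Proj.basicOpen (lineGrading k) (MvPolynomial.X 0) ↔ _
  rw [Proj.awayι_preimage_basicOpen (lineGrading k) (X_mem_lineGrading k 1) one_pos
    (X_mem_lineGrading k 0) one_pos, hX]
  change (lineChartEquiv k 1).symm (lineChartEquiv k 1 Polynomial.X) ∉ p.asIdeal ↔ _
  rw [RingEquiv.symm_apply_apply]

/-- The chart `projChart k i` of `Proj k[X_0, X_1]`, seen as a chart of `projectiveSpace 1 k`. -/
def lineChart (i : Fin (1 + 1)) : Spec (.of (Polynomial k)) ⟶ projectiveSpace 1 k :=
  projChart k i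

instance (i : Fin (1 + 1)) : IsOpenImmersion (lineChart k i) :=
  inferInstanceAs (IsOpenImmersion (projChart k i))

lemma lineChart_projectiveStr (i : Fin (1 + 1)) :
    lineChart k i ≫ projectiveStr 1 k = Spec.map (CommRingCat.ofHom Polynomial.C) :=
  projChart_toSpec k i

lemma mem_range_lineChart (x : projectiveSpace 1 k) :
    x ∈ Set.range (lineChart k 0) ∨ x ∈ Set.range (lineChart k 1) :=
  (range_projChart_union k).ge (Set.mem_univ (show Proj (lineGrading k) from x))

lemma SpecMap_aeval_lineChart {R : Type u} [CommRing R] [Algebra k R] {t s : R} (h : t * s = 1) :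
    Spec.map (CommRingCat.ofHom (Polynomial.aeval (R := k) t).toRingHom) ≫ lineChart k 0 =
      Spec.map (CommRingCat.ofHom (Polynomial.aeval (R := k) s).toRingHom) ≫ lineChart k 1 :=
  SpecMap_aeval_projChart k h

lemma lineChart_one_mem_range_zero (p : PrimeSpectrum (Polynomial k)) :
    lineChart k 1 p ∈ Set.range (lineChart k 0) ↔ Polynomial.X ∉ p.asIdeal :=
  projChart_one_mem_range_zero k p

end

/-! ## Gluing along open covers by integral schemes -/

section

lemma isIrreducible_range {V U : Scheme.{u}} [IsIntegral V] (f : V ⟶ U) :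
    IsIrreducible (Set.range f) :=
  Set.image_univ ▸ (IrreducibleSpace.isIrreducible_univ V).image _ f.continuous.continuousOn

lemma isDominant_pullback_lift {T U V₁ V₂ : Scheme.{u}} {ι₁ : V₁ ⟶ U} {ι₂ : V₂ ⟶ U}
    [IsOpenImmersion ι₂] (η₁ : T ⟶ V₁) (η₂ : T ⟶ V₂) [IsDominant η₁] (h : η₁ ≫ ι₁ = η₂ ≫ ι₂) :
    IsDominant (pullback.lift η₁ η₂ h) := by
  have hfst : Topology.IsOpenEmbedding (pullback.fst ι₁ ι₂) :=
    (pullback.fst ι₁ ι₂).isOpenEmbedding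
  refine ⟨fun z => mem_closure_iff.2 fun o ho hz => ?_⟩
  obtain ⟨_, ⟨y, hy, hyt⟩, t, rfl⟩ :=
    η₁.denseRange.inter_open_nonempty _ (hfst.isOpenMap _ ho) ⟨_, z, hz, rfl⟩
  refine ⟨y, hy, t, hfst.injective ?_⟩
  rw [hyt, ← Scheme.Hom.comp_apply, pullback.lift_fst]

universe v

variable {U : Scheme.{u}} {J : Type v} {V : J → Scheme.{u}} (ι : ∀ j, V j ⟶ U)
  [∀ j, IsOpenImmersion (ι j)]

/-- The open cover given by a jointly surjective family of open immersions. -/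
def openCoverOf (hcov : ∀ x, ∃ j, x ∈ Set.range (ι j)) :
    Scheme.OpenCover.{v} U where
  I₀ := J
  X := V
  f := ι
  mem₀ := by
    rw [Scheme.presieve₀_mem_precoverage_iff]
    exact ⟨hcov, inferInstance⟩

lemma isPreirreducible_univ_of_cover [∀ j, IsIntegral (V j)]
    (hcov : ∀ x, ∃ j, x ∈ Set.range (ι j))
    (hne : ∀ i j, (Set.range (ι i) ∩ Set.range (ι j)).Nonempty) :
    IsPreirreducible (Set.univ : Set U) := by
  rintro A B hA hB ⟨a, -, ha⟩ ⟨b, -, hb⟩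
  obtain ⟨i, hi⟩ := hcov a
  obtain ⟨j, hj⟩ := hcov b
  obtain ⟨c, hci, hcj⟩ := hne i j
  obtain ⟨x, -, hxA, hxj⟩ := (isIrreducible_range (ι i)).2 A (Set.range (ι j)) hA
    (ι j).isOpenEmbedding.isOpen_range ⟨a, hi, ha⟩ ⟨c, hci, hcj⟩
  obtain ⟨y, -, hyA, hyB⟩ := (isIrreducible_range (ι j)).2 A B hA hB ⟨x, hxj, hxA⟩ ⟨b, hj, hb⟩
  exact ⟨y, trivial, hyA, hyB⟩

lemma isIntegral_of_cover [Nonempty J] [∀ j, IsIntegral (V j)]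
    (hcov : ∀ x, ∃ j, x ∈ Set.range (ι j))
    (hne : ∀ i j, (Set.range (ι i) ∩ Set.range (ι j)).Nonempty) : IsIntegral U := by
  have : ∀ j, AlgebraicGeometry.IsReduced ((openCoverOf ι hcov).X j) := fun j : J =>
    isReduced_of_isIntegral (V j)
  have : AlgebraicGeometry.IsReduced U :=
    AlgebraicGeometry.IsReduced.of_openCover U (openCoverOf ι hcov)
  have hnonempty : (Set.univ : Set U).Nonempty :=
    (isIrreducible_range (ι (Classical.arbitrary J))).1.mono (Set.subset_univ _)
  have : IrreducibleSpace U :=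
    (irreducibleSpace_def _).2 ⟨hnonempty, isPreirreducible_univ_of_cover ι hcov hne⟩
  exact isIntegral_of_irreducibleSpace_of_isReduced U

/- The generic agreement `hfη` suffices for gluing because the overlaps are reduced and `str` is
separated. -/
lemma exists_glue [∀ j, IsIntegral (V j)] (hcov : ∀ x, ∃ j, x ∈ Set.range (ι j))
    {T : Scheme.{u}} (η : ∀ j, T ⟶ V j) [∀ j, IsDominant (η j)]
    (hη : ∀ i j, η i ≫ ι i = η j ≫ ι j) {X S : Scheme.{u}} (str : X ⟶ S) [IsSeparated str]
    (g : U ⟶ S) (f : ∀ j, V j ⟶ X) (hf : ∀ j, f j ≫ str = ι j ≫ g)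
    (hfη : ∀ i j, η i ≫ f i = η j ≫ f j) :
    ∃ ev : U ⟶ X, (∀ j, ι j ≫ ev = f j) ∧ ev ≫ str = g := by
  have hagree : ∀ i j, pullback.fst (ι i) (ι j) ≫ f i = pullback.snd (ι i) (ι j) ≫ f j := by
    intro i j
    have : AlgebraicGeometry.IsReduced (pullback (ι i) (ι j)) :=
      isReduced_of_isOpenImmersion (pullback.fst (ι i) (ι j))
    have := isDominant_pullback_lift (η i) (η j) (hη i j)
    refine ext_of_isDominant_of_isSeparated str ?_ (pullback.lift (η i) (η j) (hη i j)) ?_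
    · rw [Category.assoc, Category.assoc, hf, hf, pullback.condition_assoc]
    · rw [pullback.lift_fst_assoc, pullback.lift_snd_assoc, hfη]
  let ev := Scheme.Cover.glueMorphisms (openCoverOf ι hcov) f hagree
  have hev : ∀ j, ι j ≫ ev = f j :=
    fun j => Scheme.Cover.ι_glueMorphisms (openCoverOf ι hcov) f hagree j
  refine ⟨ev, hev, Scheme.Cover.hom_ext (openCoverOf ι hcov) _ _ fun j => ?_⟩
  exact (Category.assoc _ _ _).symm.trans ((congrArg (· ≫ str) (hev j)).trans (hf j))

end

/-! ## The projective line over an affine base -/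

section

variable (k : Type u) [Field k] (B : Type u) [CommRing B] [Algebra k B]

/-- The structure morphism `Spec B → Spec k`. -/
abbrev baseStr : Spec (.of B) ⟶ Spec (.of k) := Spec.map (CommRingCat.ofHom (algebraMap k B))

/-- The projective line over `Spec B`. -/
abbrev relLine : Scheme.{u} := pullback (baseStr k B) (projectiveStr 1 k)

/-- The affine line over `B` as the chart of `relLine k B` lying over `lineChart k i`. -/
def relChart (i : Fin (1 + 1)) : Spec (.of (Polynomial B)) ⟶ relLine k B :=
  pullback.lift (Spec.map (CommRingCat.ofHom Polynomial.C))
    (Spec.map (CommRingCat.ofHom (Polynomial.mapRingHom (algebraMap k B))) ≫ lineChart k i) (by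
      rw [Category.assoc, lineChart_projectiveStr, ← Spec.map_comp, ← Spec.map_comp,
        ← CommRingCat.ofHom_comp, ← CommRingCat.ofHom_comp, Polynomial.mapRingHom_comp_C])

lemma relChart_fst (i : Fin (1 + 1)) :
    relChart k B i ≫ pullback.fst _ _ = Spec.map (CommRingCat.ofHom Polynomial.C) :=
  pullback.lift_fst _ _ _

lemma relChart_snd (i : Fin (1 + 1)) : relChart k B i ≫ pullback.snd _ _ =
    Spec.map (CommRingCat.ofHom (Polynomial.mapRingHom (algebraMap k B))) ≫ lineChart k i :=
  pullback.lift_snd _ _ _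

attribute [local instance] Polynomial.algebra in
lemma isPullback_relChart (i : Fin (1 + 1)) : IsPullback (relChart k B i)
    (Spec.map (CommRingCat.ofHom (Polynomial.mapRingHom (algebraMap k B))))
    (pullback.snd (baseStr k B) (projectiveStr 1 k)) (lineChart k i) := by
  have hpoly : IsPullback (Spec.map (CommRingCat.ofHom (Polynomial.C : B →+* _)))
      (Spec.map (CommRingCat.ofHom (Polynomial.mapRingHom (algebraMap k B))))
      (baseStr k B) (Spec.map (CommRingCat.ofHom Polynomial.C)) :=
    isPullback_SpecMap_of_isPushout _ _ _ _
      (CommRingCat.isPushout_of_isPushout k B (Polynomial k) (Polynomial B))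
  rw [← relChart_fst k B i, ← lineChart_projectiveStr k i] at hpoly
  exact IsPullback.of_right hpoly (relChart_snd k B i)
    (IsPullback.of_hasPullback (baseStr k B) (projectiveStr 1 k))

instance (i : Fin (1 + 1)) : IsOpenImmersion (relChart k B i) :=
  MorphismProperty.of_isPullback (isPullback_relChart k B i).flip inferInstance

lemma mem_range_relChart_iff (i : Fin (1 + 1)) (x : relLine k B) :
    x ∈ Set.range (relChart k B i) ↔
      pullback.snd (baseStr k B) (projectiveStr 1 k) x ∈ Set.range (lineChart k i) := by
  rw [← Set.mem_preimage, ← Scheme.Pullback.range_fst,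
    ← (isPullback_relChart k B i).isoPullback_hom_fst]
  constructor
  · rintro ⟨y, rfl⟩
    exact ⟨_, rfl⟩
  · rintro ⟨y, rfl⟩
    refine ⟨(isPullback_relChart k B i).isoPullback.inv y, ?_⟩
    rw [← Scheme.Hom.comp_apply, Iso.inv_hom_id_assoc]

lemma mem_range_relChart (x : relLine k B) :
    x ∈ Set.range (relChart k B 0) ∨ x ∈ Set.range (relChart k B 1) := by
  rw [mem_range_relChart_iff, mem_range_relChart_iff]
  exact mem_range_lineChart k _

lemma relChart_one_mem_range_zero (p : PrimeSpectrum (Polynomial B)) :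
    relChart k B 1 p ∈ Set.range (relChart k B 0) ↔ Polynomial.X ∉ p.asIdeal := by
  rw [mem_range_relChart_iff]
  have h : pullback.snd (baseStr k B) (projectiveStr 1 k) (relChart k B 1 p) =
      lineChart k 1 (PrimeSpectrum.comap (Polynomial.mapRingHom (algebraMap k B)) p) :=
    congrArg (fun f : Spec (.of (Polynomial B)) ⟶ projectiveSpace 1 k => f p) (relChart_snd k B 1)
  rw [h, lineChart_one_mem_range_zero]
  change Polynomial.mapRingHom (algebraMap k B) Polynomial.X ∉ p.asIdeal ↔ _
  rw [Polynomial.coe_mapRingHom, Polynomial.map_X]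

lemma SpecMap_eval₂_relChart {R : Type u} [CommRing R] (g : B →+* R) {t s : R} (h : t * s = 1) :
    Spec.map (CommRingCat.ofHom (Polynomial.eval₂RingHom g t)) ≫ relChart k B 0 =
      Spec.map (CommRingCat.ofHom (Polynomial.eval₂RingHom g s)) ≫ relChart k B 1 := by
  let _ := (g.comp (algebraMap k B)).toAlgebra
  have eval₂_comp_map : ∀ r : R, (Polynomial.eval₂RingHom g r).comp
      (Polynomial.mapRingHom (algebraMap k B)) = (Polynomial.aeval (R := k) r).toRingHom := by
    intro r
    refine Polynomial.ringHom_ext (fun c => ?_) ?_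
    · simp [RingHom.algebraMap_toAlgebra]
    · simp
  apply pullback.hom_ext
  · rw [Category.assoc, Category.assoc, relChart_fst, relChart_fst, ← Spec.map_comp,
      ← Spec.map_comp, ← CommRingCat.ofHom_comp, ← CommRingCat.ofHom_comp]
    congr 2
    ext; simp
  · rw [Category.assoc, Category.assoc, relChart_snd, relChart_snd, ← Category.assoc,
      ← Category.assoc, ← Spec.map_comp, ← Spec.map_comp, ← CommRingCat.ofHom_comp,
      ← CommRingCat.ofHom_comp, eval₂_comp_map, eval₂_comp_map]
    exact SpecMap_aeval_lineChart k h

end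

/-! ## Morphisms from one-parameter families of characters -/

section

variable {d : ℕ}

lemma prod_zpow_eq_zpow_sum {G ι : Type*} [CommGroup G] (a : G) (f : ι → ℤ) (s : Finset ι) :
    ∏ i ∈ s, a ^ f i = a ^ ∑ i ∈ s, f i := by
  induction s using Finset.cons_induction with
  | empty => simp
  | cons i s hi ih => rw [Finset.prod_cons, Finset.sum_cons, zpow_add, ih]

/-- The character `m ↦ ∏ v_i ^ m_i` of the lattice of monomials, i.e. the `R`-point of the torus
with coordinates `v_i`. -/
def unitChar {R : Type*} [CommRing R] (v : Fin d → Rˣ) : Multiplicative (Fin d → ℤ) →* R where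
  toFun m := ((∏ i, v i ^ m.toAdd i : Rˣ) : R)
  map_one' := by simp
  map_mul' a b := by
    rw [← Units.val_mul, ← Finset.prod_mul_distrib]
    simp [zpow_add]

lemma map_unitChar {R S : Type*} [CommRing R] [CommRing S] (f : R →+* S) (v : Fin d → Rˣ)
    (m : Multiplicative (Fin d → ℤ)) :
    f (unitChar v m) = unitChar (fun i => Units.map f (v i)) m := by
  have h : Units.map (f : R →* S) (∏ i, v i ^ m.toAdd i) =
      ∏ i, Units.map (f : R →* S) (v i) ^ m.toAdd i := by
    simp only [map_prod, map_zpow]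
  exact congrArg Units.val h

lemma unitChar_mul_zpow {R : Type*} [CommRing R] (v : Fin d → Rˣ) (z : Rˣ) (u : Fin d → ℤ)
    (m : Multiplicative (Fin d → ℤ)) :
    unitChar (fun i => v i * z ^ u i) m = (z ^ (m.toAdd ⬝ᵥ u) : Rˣ) * unitChar v m := by
  have h : ∏ i, (v i * z ^ u i) ^ m.toAdd i = z ^ (m.toAdd ⬝ᵥ u) * ∏ i, v i ^ m.toAdd i := by
    simp_rw [mul_zpow, Finset.prod_mul_distrib, ← zpow_mul, prod_zpow_eq_zpow_sum, dotProduct,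
      mul_comm (u _)]
    exact mul_comm _ _
  exact congrArg Units.val h

variable {k : Type u} [Field k] {R : Type u} [CommRing R] [Algebra k R]

/-- The comorphism of the morphism `Spec R → T × 𝔸^1` given by units `v_i` and a function `z`. -/
def paramHom (v : Fin d → Rˣ) (z : R) : Polynomial (AddMonoidAlgebra k (Fin d → ℤ)) →ₐ[k] R :=
  Polynomial.eval₂AlgHom (AddMonoidAlgebra.lift k R _ (unitChar v)) z fun _ => mul_comm _ _

lemma paramHom_X (v : Fin d → Rˣ) (z : R) : paramHom (k := k) v z Polynomial.X = z :=
  Polynomial.eval₂_X _ _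

lemma paramHom_C_single (v : Fin d → Rˣ) (z : R) (m : Fin d → ℤ) :
    paramHom (k := k) v z (Polynomial.C (AddMonoidAlgebra.single m 1)) =
      unitChar v (Multiplicative.ofAdd m) := by
  refine (Polynomial.eval₂_C _ _).trans ?_
  change AddMonoidAlgebra.lift k R _ (unitChar v) _ = _
  rw [AddMonoidAlgebra.lift_single, one_smul]

/-- The comorphism of the morphism `Spec R → U_σ` obtained by evaluating `(τ, s) ↦ τ s^u` at the
torus point `τ = v` and at `s = z`. -/
def familyHom (σ : PointedCone ℝ (Fin d → ℝ)) (u : Fin d → ℤ)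
    (hu : ∀ m ∈ dualMonoid σ, 0 ≤ m ⬝ᵥ u) (v : Fin d → Rˣ) (z : R) :
    AddMonoidAlgebra k (dualMonoid σ) →ₐ[k] R :=
  (paramHom v z).comp (oneParam k σ u hu)

lemma familyHom_single (σ : PointedCone ℝ (Fin d → ℝ)) (u : Fin d → ℤ)
    (hu : ∀ m ∈ dualMonoid σ, 0 ≤ m ⬝ᵥ u) (v : Fin d → Rˣ) (z : R) (m : dualMonoid σ) :
    familyHom (k := k) σ u hu v z (AddMonoidAlgebra.single m 1) =
      z ^ (m.1 ⬝ᵥ u).toNat * unitChar v (Multiplicative.ofAdd m.1) := by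
  rw [familyHom, AlgHom.comp_apply, oneParam_single, map_mul, map_pow, paramHom_X,
    paramHom_C_single]

lemma comp_familyHom_eq_charHom {L : Type u} [Field L] [Algebra k L] (g : R →ₐ[k] L)
    (σ : PointedCone ℝ (Fin d → ℝ)) (u : Fin d → ℤ) (hu : ∀ m ∈ dualMonoid σ, 0 ≤ m ⬝ᵥ u)
    (v : Fin d → Rˣ) (z : R) (V : Fin d → Lˣ) (hz : g z ≠ 0)
    (hV : ∀ i, (V i : L) = g (v i) * g z ^ u i) :
    g.comp (familyHom σ u hu v z) = charHom (k := k) σ (unitChar V) := by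
  have hV' : V = fun i => Units.map g.toRingHom (v i) * Units.mk0 _ hz ^ u i :=
    funext fun i => Units.ext (by simp [hV])
  refine algHom_ext_single fun m => ?_
  rw [AlgHom.comp_apply, familyHom_single, charHom_single, map_mul, map_pow, hV',
    unitChar_mul_zpow, ← map_unitChar, Units.val_zpow_eq_zpow_val, Units.val_mk0, toAdd_ofAdd,
    ← zpow_natCast, Int.toNat_of_nonneg (hu m.1 m.2)]
  rfl

variable (F : Fan d) {X : Scheme.{u}} (e : X ≅ F.toricVariety k)

/-- The morphism `Spec R → X` obtained by evaluating `(τ, s) ↦ τ s^u` in the chart of `σ` at the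
torus point `τ = v` and at `s = z`. -/
def familyMap (σ : F.cones) (u : Fin d → ℤ)
    (hu : ∀ m ∈ dualMonoid σ.1, 0 ≤ m ⬝ᵥ u) (v : Fin d → Rˣ) (z : R) :
    Spec (.of R) ⟶ X :=
  Spec.map (CommRingCat.ofHom (familyHom (k := k) σ.1 u hu v z).toRingHom) ≫ chartTo F e σ

lemma familyMap_str {str : X ⟶ Spec (.of k)} (he : e.hom ≫ F.toricStr k = str) (σ : F.cones)
    (u : Fin d → ℤ) (hu : ∀ m ∈ dualMonoid σ.1, 0 ≤ m ⬝ᵥ u) (v : Fin d → Rˣ) (z : R) :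
    familyMap F e σ u hu v z ≫ str = Spec.map (CommRingCat.ofHom (algebraMap k R)) := by
  rw [familyMap, Category.assoc, chartTo_comp F e he, ← Spec.map_comp, ← CommRingCat.ofHom_comp]
  congr 2
  exact (familyHom σ.1 u hu v z).comp_algebraMap

/-- The comorphism of the morphism `Spec R → T` to the torus with coordinates `v`. -/
def unitHom (v : Fin d → Rˣ) : AddMonoidAlgebra k (dualMonoid F.zeroCone.1) →ₐ[k] R :=
  charHom F.zeroCone.1 (unitChar v)

lemma comp_unitHom {S : Type u} [CommRing S] [Algebra k S] (g : R →ₐ[k] S) (v : Fin d → Rˣ) :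
    g.comp (unitHom F v) = unitHom F fun i => Units.map (g : R →* S) (v i) :=
  algHom_ext_single fun m => by
    rw [AlgHom.comp_apply, unitHom, unitHom, charHom_single, charHom_single]
    exact map_unitChar g.toRingHom v _

/-- The morphism `Spec R → X` to the torus with coordinates `v`. -/
def torusMap (v : Fin d → Rˣ) : Spec (.of R) ⟶ X :=
  Spec.map (CommRingCat.ofHom (unitHom (k := k) F v).toRingHom) ≫ chartTo F e F.zeroCone

lemma SpecMap_torusMap {S : Type u} [CommRing S] [Algebra k S] (g : R →ₐ[k] S) (v : Fin d → Rˣ) :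
    Spec.map (CommRingCat.ofHom g.toRingHom) ≫ torusMap (k := k) F e v =
      torusMap (k := k) F e fun i => Units.map (g : R →* S) (v i) := by
  rw [torusMap, torusMap, ← comp_unitHom, ← Category.assoc, ← Spec.map_comp,
    ← CommRingCat.ofHom_comp]
  rfl

lemma familyMap_eq_torusMap {L : Type u} [Field L] [Algebra k L] (g : R →ₐ[k] L) (σ : F.cones)
    (u : Fin d → ℤ) (hu : ∀ m ∈ dualMonoid σ.1, 0 ≤ m ⬝ᵥ u) (v : Fin d → Rˣ) (z : R)
    (V : Fin d → Lˣ) (hz : g z ≠ 0) (hV : ∀ i, (V i : L) = g (v i) * g z ^ u i) :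
    Spec.map (CommRingCat.ofHom g.toRingHom) ≫ familyMap F e σ u hu v z =
      torusMap (k := k) F e V := by
  rw [torusMap, unitHom, ← SpecMap_charHom_chartTo F e (unitChar V) σ, familyMap, ← Category.assoc,
    ← Spec.map_comp, ← CommRingCat.ofHom_comp]
  congr 3
  exact congrArg AlgHom.toRingHom (comp_familyHom_eq_charHom g σ.1 u hu v z V hz hV)

lemma pulledIdeal_familyMap (σ : F.cones) (u : Fin d → ℤ)
    (hu : ∀ m ∈ dualMonoid σ.1, 0 ≤ m ⬝ᵥ u) (v : Fin d → Rˣ) (z : R) {Z : Set X}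
    (hZ : IsClosed Z) {c : ℕ} (hc : (idealOn (chartTo F e σ ⁻¹' Z)).map
      (oneParam k σ.1 u hu).toRingHom = Ideal.span {Polynomial.X ^ c}) (w : Spec (.of R)) :
    pulledIdeal (familyMap F e σ u hu v z) Z w =
      (Ideal.span {z}).map (specToStalk R w) ^ c := by
  have hcomp : (familyHom (k := k) σ.1 u hu v z).toRingHom =
    (paramHom v z).toRingHom.comp (oneParam k σ.1 u hu).toRingHom := rfl
  have hX : (paramHom (k := k) v z).toRingHom Polynomial.X = z := paramHom_X v z
  rw [familyMap, pulledIdeal_SpecMap_comp _ hZ, hcomp, ← Ideal.map_map, hc, Ideal.map_span,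
    Set.image_singleton, map_pow, hX, ← Ideal.span_singleton_pow, Ideal.map_pow]

end

/-! ## Markings of the projective line and charts around them -/

lemma asIdeal_eq_ker_of_relChart_eq {k : Type u} [Field k] {B : Type u} [CommRing B]
    [Algebra k B] {p q : PrimeSpectrum (Polynomial B)} (h : relChart k B 1 p = relChart k B 0 q) :
    algebraMap (Polynomial B) p.asIdeal.ResidueField Polynomial.X ≠ 0 ∧
      q.asIdeal = RingHom.ker (Polynomial.eval₂RingHom
        ((algebraMap (Polynomial B) p.asIdeal.ResidueField).comp Polynomial.C)
        (algebraMap (Polynomial B) p.asIdeal.ResidueField Polynomial.X)⁻¹) := by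
  set g := algebraMap (Polynomial B) p.asIdeal.ResidueField
  have hX : g Polynomial.X ≠ 0 := by
    rw [Ne, Ideal.algebraMap_residueField_eq_zero, ← relChart_one_mem_range_zero k B p]
    exact ⟨q, h.symm⟩
  have hg : Polynomial.eval₂RingHom (g.comp Polynomial.C) (g Polynomial.X) = g :=
    Polynomial.ringHom_ext (fun c => Polynomial.eval₂_C _ _) (Polynomial.eval₂_X _ _)
  let o : PrimeSpectrum p.asIdeal.ResidueField := ⊥
  have ho : PrimeSpectrum.comap g o = p :=
    PrimeSpectrum.ext (Ideal.ext fun _ => Ideal.algebraMap_residueField_eq_zero)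
  have hchange := SpecMap_eval₂_relChart k B (g.comp Polynomial.C) (inv_mul_cancel₀ hX)
  rw [hg] at hchange
  have hq : relChart k B 0 (PrimeSpectrum.comap
      (Polynomial.eval₂RingHom (g.comp Polynomial.C) (g Polynomial.X)⁻¹) o) = relChart k B 0 q :=
    (congrArg (fun f : Spec (.of p.asIdeal.ResidueField) ⟶ relLine k B => f o) hchange).trans
      ((congrArg (relChart k B 1) ho).trans h)
  exact ⟨hX, congrArg PrimeSpectrum.asIdeal
    ((relChart k B 0).isOpenEmbedding.injective hq).symm⟩

lemma X_sub_C_mem_iff_of_relChart_eq {k : Type u} [Field k] {B : Type u} [CommRing B]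
    [Algebra k B] {p q : PrimeSpectrum (Polynomial B)} (h : relChart k B 1 p = relChart k B 0 q)
    (b : B) : Polynomial.X - Polynomial.C b ∈ q.asIdeal ↔
      1 - Polynomial.C b * Polynomial.X ∈ p.asIdeal := by
  obtain ⟨hX, hq⟩ := asIdeal_eq_ker_of_relChart_eq h
  rw [hq, RingHom.mem_ker, ← Ideal.algebraMap_residueField_eq_zero]
  simp only [Polynomial.coe_eval₂RingHom, Polynomial.eval₂_X, Polynomial.eval₂_C,
    map_sub, map_one, map_mul, RingHom.comp_apply]
  rw [sub_eq_zero, sub_eq_zero, eq_comm (a := (1 : p.asIdeal.ResidueField)),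
    mul_eq_one_iff_eq_inv₀ hX, eq_comm]

section

variable (k : Type u) {B : Type u} [Field k] [CommRing B] [Algebra k B] {d : ℕ} (p : Fin d → B)

/-- The chart containing a marking: the marking `0` is the point at infinity, the others lie in the
affine line. -/
def chartIndex {d : ℕ} : Fin (d + 1) → Fin (1 + 1) := Fin.cases 1 fun _ => 0

/-- The coordinate of a marking in its chart: `0` for the point at infinity, `p_i` for the marking
`i + 1`. -/
def center : Fin (d + 1) → B := Fin.cases 0 p

/-- The lattice vectors `-∑ e_i, e_1, …, e_d` attached to the markings: the orders of vanishing of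
the coordinates `t - p_1, …, t - p_d` at the markings. -/
def slope {d : ℕ} : Fin (d + 1) → Fin d → ℤ := Fin.cases (fun _ => -1) fun j => Pi.single j 1

open Polynomial in
/-- The equation, in the chart of the marking `j`, of the marking `i + 1` if this is not `j`, and
`1` otherwise. -/
def factor : Fin (d + 1) → Fin d → Polynomial B :=
  Fin.cases (fun i => 1 - C (p i) * X) fun j i => if i = j then 1 else X - C (p i)

/-- The equation, in the chart of the marking `j`, of the union of the other affine markings. -/
def denom (j : Fin (d + 1)) : Polynomial B := ∏ i, factor p j i

/-- The equation of a marking in its chart. -/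
def localParam (j : Fin (d + 1)) : Polynomial B := Polynomial.X - Polynomial.C (center p j)

/-- The coordinate ring of the complement of the other affine markings in the chart of a marking. -/
abbrev MarkRing (j : Fin (d + 1)) : Type u := Localization.Away (denom p j)

/-- The sections `p_j` of the projective line over `Spec B`. -/
def marking (j : Fin (d + 1)) : Spec (.of B) ⟶ relLine k B :=
  Spec.map (CommRingCat.ofHom (Polynomial.evalRingHom (center p j))) ≫
    relChart k B (chartIndex j)

/-- The neighbourhood of a marking with coordinate ring `MarkRing p j`. -/
def markChart (j : Fin (d + 1)) : Spec (.of (MarkRing p j)) ⟶ relLine k B :=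
  Spec.map (CommRingCat.ofHom (algebraMap (Polynomial B) (MarkRing p j))) ≫
    relChart k B (chartIndex j)

instance (j : Fin (d + 1)) : IsOpenImmersion (markChart k p j) := by
  have : IsOpenImmersion
      (Spec.map (CommRingCat.ofHom (algebraMap (Polynomial B) (MarkRing p j)))) :=
    IsOpenImmersion.of_isLocalization (denom p j)
  unfold markChart
  infer_instance

lemma marking_fst (j : Fin (d + 1)) : marking k p j ≫ pullback.fst _ _ = 𝟙 _ := by
  have hcomp : (Polynomial.evalRingHom (center p j)).comp Polynomial.C = RingHom.id B :=
    RingHom.ext fun b => Polynomial.eval_C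
  rw [marking, Category.assoc, relChart_fst, ← Spec.map_comp, ← CommRingCat.ofHom_comp, hcomp,
    CommRingCat.ofHom_id, Spec.map_id]

lemma mem_range_marking (j : Fin (d + 1)) (x : relLine k B) :
    x ∈ Set.range (marking k p j) ↔ ∃ q : PrimeSpectrum (Polynomial B),
      relChart k B (chartIndex j) q = x ∧ localParam p j ∈ q.asIdeal := by
  have h := range_comap_of_surjective _ (Polynomial.evalRingHom (center p j))
    (fun b => ⟨Polynomial.C b, Polynomial.eval_C⟩)
  rw [Polynomial.ker_evalRingHom, PrimeSpectrum.zeroLocus_span] at h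
  constructor
  · rintro ⟨y, rfl⟩
    exact ⟨PrimeSpectrum.comap (Polynomial.evalRingHom (center p j)) y, rfl,
      h.le ⟨y, rfl⟩ (Set.mem_singleton _)⟩
  · rintro ⟨q, rfl, hq⟩
    obtain ⟨y, rfl⟩ := h.ge (Set.singleton_subset_iff.2 hq)
    exact ⟨y, rfl⟩

lemma mem_range_markChart (j : Fin (d + 1)) (x : relLine k B) :
    x ∈ Set.range (markChart k p j) ↔ ∃ q : PrimeSpectrum (Polynomial B),
      relChart k B (chartIndex j) q = x ∧ denom p j ∉ q.asIdeal := by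
  have h := PrimeSpectrum.localization_away_comap_range (MarkRing p j) (denom p j)
  constructor
  · rintro ⟨y, rfl⟩
    exact ⟨PrimeSpectrum.comap (algebraMap (Polynomial B) (MarkRing p j)) y, rfl, h.le ⟨y, rfl⟩⟩
  · rintro ⟨q, rfl, hq⟩
    obtain ⟨y, rfl⟩ := h.ge hq
    exact ⟨y, rfl⟩

lemma denom_mem_of_factor_mem {j : Fin (d + 1)} {q : Ideal (Polynomial B)} (i : Fin d)
    (h : factor p j i ∈ q) : denom p j ∈ q :=
  Ideal.mem_of_dvd _ (Finset.dvd_prod_of_mem _ (Finset.mem_univ i)) h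

lemma relChart_mem_range_marking_iff (j : Fin (d + 1)) (q : PrimeSpectrum (Polynomial B)) :
    relChart k B (chartIndex j) q ∈ Set.range (marking k p j) ↔ localParam p j ∈ q.asIdeal := by
  rw [mem_range_marking]
  constructor
  · rintro ⟨q', h, hq'⟩
    obtain rfl := (relChart k B (chartIndex j)).isOpenEmbedding.injective h
    exact hq'
  · exact fun h => ⟨q, rfl, h⟩

lemma relChart_notMem_range_marking {l j : Fin (d + 1)} (hlj : l ≠ j)
    {q : PrimeSpectrum (Polynomial B)} (hq : denom p j ∉ q.asIdeal) :
    relChart k B (chartIndex j) q ∉ Set.range (marking k p l) := by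
  rw [mem_range_marking]
  rintro ⟨q', h, hq'⟩
  cases l using Fin.cases with
  | zero =>
    cases j using Fin.cases with
    | zero => exact hlj rfl
    | succ j =>
      have hX : Polynomial.X ∈ q'.asIdeal := by simpa [localParam, center] using hq'
      exact (relChart_one_mem_range_zero k B q').1 ⟨q, h.symm⟩ hX
  | succ l =>
    refine hq (denom_mem_of_factor_mem p l ?_)
    cases j using Fin.cases with
    | zero => exact (X_sub_C_mem_iff_of_relChart_eq h.symm (p l)).1 hq'
    | succ j =>
      obtain rfl := (relChart k B 0).isOpenEmbedding.injective h
      change (if l = j then (1 : Polynomial B) else _) ∈ _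
      rwa [if_neg fun h => hlj (congrArg _ h)]

variable (hp : ∀ i j, i ≠ j → IsUnit (p i - p j))

include hp in
lemma isUnit_eval_denom (j : Fin (d + 1)) : IsUnit ((denom p j).eval (center p j)) := by
  rw [denom, Polynomial.eval_prod]
  refine IsUnit.prod_univ_iff.2 fun i => ?_
  refine Fin.cases ?_ (fun j => ?_) j
  · simp [factor, center]
  · change IsUnit (Polynomial.eval (p j) (if i = j then 1 else Polynomial.X - Polynomial.C (p i)))
    split_ifs with h
    · simp
    · simpa using hp j i (Ne.symm h)

include hp in
lemma denom_notMem (j : Fin (d + 1)) {q : Ideal (Polynomial B)} (hq : q ≠ ⊤)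
    (h : localParam p j ∈ q) : denom p j ∉ q := by
  intro hd
  have hsub : denom p j - Polynomial.C ((denom p j).eval (center p j)) ∈ q :=
    Ideal.mem_of_dvd q Polynomial.X_sub_C_dvd_sub_C_eval h
  have heval : Polynomial.C ((denom p j).eval (center p j)) ∈ q := by
    simpa only [sub_sub_cancel] using q.sub_mem hd hsub
  exact hq (Ideal.eq_top_of_isUnit_mem _ heval ((isUnit_eval_denom p hp j).map Polynomial.C))

include hp in
lemma marking_disjoint (j l : Fin (d + 1)) (hjl : j ≠ l) :
    Disjoint (Set.range (marking k p j)) (Set.range (marking k p l)) := by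
  rw [Set.disjoint_left]
  intro x hx
  obtain ⟨q, rfl, hq⟩ := (mem_range_marking k p j x).1 hx
  exact relChart_notMem_range_marking k p hjl.symm (denom_notMem p hp j q.isPrime.ne_top hq)

include hp in
lemma exists_denom_succ_notMem (hd : 0 < d) (q : PrimeSpectrum (Polynomial B)) :
    ∃ l : Fin d, denom p l.succ ∉ q.asIdeal := by
  by_cases h : ∃ l : Fin d, localParam p l.succ ∈ q.asIdeal
  · obtain ⟨l, hl⟩ := h
    exact ⟨l, denom_notMem p hp l.succ q.isPrime.ne_top hl⟩
  · push Not at h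
    refine ⟨⟨0, hd⟩, fun hdenom => ?_⟩
    obtain ⟨i, -, hi⟩ := q.isPrime.prod_mem_iff.1 hdenom
    change (if i = _ then (1 : Polynomial B) else _) ∈ _ at hi
    split_ifs at hi with h0
    · exact (Ideal.ne_top_iff_one _).1 q.isPrime.ne_top hi
    · exact h i hi

include hp in
lemma exists_mem_range_markChart (hd : 0 < d) (x : relLine k B) :
    ∃ j, x ∈ Set.range (markChart k p j) := by
  simp_rw [mem_range_markChart]
  by_cases hx : x ∈ Set.range (relChart k B 0)
  · obtain ⟨q, rfl⟩ := hx
    obtain ⟨l, hl⟩ := exists_denom_succ_notMem p hp hd q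
    exact ⟨l.succ, q, rfl, hl⟩
  · obtain ⟨q, rfl⟩ := (mem_range_relChart k B x).resolve_left hx
    let q' : PrimeSpectrum (Polynomial B) := q
    have hX : Polynomial.X ∈ q'.asIdeal :=
      not_not.1 ((relChart_one_mem_range_zero k B q').not.1 hx)
    have hparam : localParam p 0 ∈ q'.asIdeal := by simpa [localParam, center] using hX
    exact ⟨0, q', rfl, denom_notMem p hp 0 q'.isPrime.ne_top hparam⟩

lemma preimage_range_marking_of_ne {l j : Fin (d + 1)} (h : l ≠ j) :
    markChart k p j ⁻¹' Set.range (marking k p l) = ∅ :=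
  Set.eq_empty_iff_forall_notMem.2 fun w => relChart_notMem_range_marking k p h
    ((PrimeSpectrum.localization_away_comap_range (MarkRing p j) (denom p j)).le ⟨w, rfl⟩)

lemma preimage_range_marking (j : Fin (d + 1)) :
    markChart k p j ⁻¹' Set.range (marking k p j) = (PrimeSpectrum.zeroLocus
      {algebraMap (Polynomial B) (MarkRing p j) (localParam p j)} :
        Set (PrimeSpectrum (MarkRing p j))) :=
  Set.ext fun w => (relChart_mem_range_marking_iff k p j
    (PrimeSpectrum.comap (algebraMap (Polynomial B) (MarkRing p j)) w)).trans
      ⟨fun h => Set.singleton_subset_iff.2 h, fun h => h rfl⟩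

variable [IsDomain B]

include hp in
lemma denom_ne_zero (j : Fin (d + 1)) : denom p j ≠ 0 := by
  intro h
  have := isUnit_eval_denom p hp j
  rw [h, Polynomial.eval_zero] at this
  exact not_isUnit_zero this

include hp in
lemma powers_denom_le_nonZeroDivisors (j : Fin (d + 1)) :
    Submonoid.powers (denom p j) ≤ nonZeroDivisors (Polynomial B) :=
  powers_le_nonZeroDivisors_of_noZeroDivisors (denom_ne_zero p hp j)

include hp in
lemma isDomain_markRing (j : Fin (d + 1)) : IsDomain (MarkRing p j) :=
  IsLocalization.isDomain_localization (powers_denom_le_nonZeroDivisors p hp j)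

include hp in
lemma prime_localParam (j : Fin (d + 1)) :
    Prime (algebraMap (Polynomial B) (MarkRing p j) (localParam p j)) := by
  have hprime : Prime (localParam p j) := Polynomial.prime_X_sub_C _
  have hspan : (Ideal.span {localParam p j}).IsPrime :=
    (Ideal.span_singleton_prime hprime.ne_zero).2 hprime
  have hdisj : Disjoint (Submonoid.powers (denom p j) : Set (Polynomial B))
      (Ideal.span {localParam p j}) := by
    rw [Set.disjoint_left]
    rintro _ ⟨n, rfl⟩ hn
    exact denom_notMem p hp j hspan.ne_top (Ideal.mem_span_singleton_self _)
      (hspan.mem_of_pow_mem n hn)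
  have hmap := IsLocalization.isPrime_of_isPrime_disjoint (Submonoid.powers (denom p j))
    (MarkRing p j) _ hspan hdisj
  rw [Ideal.map_span, Set.image_singleton] at hmap
  refine (Ideal.span_singleton_prime fun h0 => hprime.ne_zero ?_).1 hmap
  exact IsLocalization.injective (MarkRing p j) (powers_denom_le_nonZeroDivisors p hp j)
    (h0.trans (map_zero _).symm)

/-- The coordinate of the chart of a marking as a rational function on the affine line. -/
def genericCoord {d : ℕ} : Fin (d + 1) → FractionRing (Polynomial B) :=
  Fin.cases (algebraMap _ _ (Polynomial.X : Polynomial B))⁻¹ fun _ =>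
    algebraMap _ _ (Polynomial.X : Polynomial B)

/-- The comorphism of the inclusion of the generic point of the projective line into the chart of a
marking. -/
def genericHom (j : Fin (d + 1)) : Polynomial B →+* FractionRing (Polynomial B) :=
  Polynomial.eval₂RingHom (algebraMap B (FractionRing (Polynomial B))) (genericCoord j)

lemma algebraMap_X_ne_zero :
    algebraMap (Polynomial B) (FractionRing (Polynomial B)) Polynomial.X ≠ 0 :=
  (map_ne_zero_iff _ (IsFractionRing.injective _ _)).2 Polynomial.X_ne_zero

lemma genericHom_succ (j : Fin d) : genericHom (B := B) j.succ =
    algebraMap (Polynomial B) (FractionRing (Polynomial B)) := by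
  refine Polynomial.ringHom_ext (fun c => ?_) ?_
  · exact (Polynomial.eval₂_C _ _).trans (IsScalarTower.algebraMap_apply B (Polynomial B) _ c)
  · exact Polynomial.eval₂_X _ _

lemma genericHom_injective (j : Fin (d + 1)) : Function.Injective (genericHom (B := B) j) := by
  cases j using Fin.cases with
  | zero =>
    rw [injective_iff_map_eq_zero]
    intro f hf
    have hcoord : genericCoord (B := B) (0 : Fin (d + 1)) =
      (algebraMap (Polynomial B) (FractionRing (Polynomial B)) Polynomial.X)⁻¹ := rfl
    let _ : Invertible (genericCoord (B := B) (0 : Fin (d + 1))) :=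
      invertibleOfNonzero (inv_ne_zero (algebraMap_X_ne_zero (B := B)))
    have hreverse := (Polynomial.eval₂_reverse_eq_zero_iff
      (algebraMap B (FractionRing (Polynomial B))) _ f).2 hf
    rw [invOf_eq_inv, hcoord, inv_inv] at hreverse
    refine Polynomial.reverse_eq_zero.1
      ((map_eq_zero_iff _ (IsFractionRing.injective _ (FractionRing (Polynomial B)))).1 ?_)
    exact (DFunLike.congr_fun (genericHom_succ (d := 1) 0) _).symm.trans hreverse
  | succ j =>
    rw [genericHom_succ]
    exact IsFractionRing.injective _ _

/-- The comorphism of the inclusion of the generic point of the projective line into the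
neighbourhood of a marking. -/
def markGeneric (j : Fin (d + 1)) : MarkRing p j →+* FractionRing (Polynomial B) :=
  IsLocalization.Away.lift (denom p j) (g := genericHom j)
    (((map_ne_zero_iff _ (genericHom_injective j)).2 (denom_ne_zero p hp j)).isUnit)

lemma markGeneric_comp (j : Fin (d + 1)) :
    (markGeneric p hp j).comp (algebraMap (Polynomial B) (MarkRing p j)) = genericHom j :=
  IsLocalization.Away.lift_comp _ _

lemma markGeneric_algebraMap (j : Fin (d + 1)) (f : Polynomial B) :
    markGeneric p hp j (algebraMap (Polynomial B) (MarkRing p j) f) = genericHom j f :=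
  IsLocalization.Away.lift_eq _ _ _

lemma markGeneric_injective (j : Fin (d + 1)) : Function.Injective (markGeneric p hp j) :=
  (IsLocalization.lift_injective_iff _).2 fun x y => by
    rw [(genericHom_injective j).eq_iff, (IsLocalization.injective (MarkRing p j)
      (powers_denom_le_nonZeroDivisors p hp j)).eq_iff]

instance (j : Fin (d + 1)) :
    IsDominant (Spec.map (CommRingCat.ofHom (markGeneric p hp j))) := by
  refine ⟨(PrimeSpectrum.denseRange_comap_iff_ker_le_nilRadical _).2 ?_⟩
  exact ((RingHom.injective_iff_ker_eq_bot _).1 (markGeneric_injective p hp j)).le.trans bot_le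

lemma SpecMap_genericHom_relChart (j l : Fin (d + 1)) :
    Spec.map (CommRingCat.ofHom (genericHom (B := B) j)) ≫ relChart k B (chartIndex j) =
      Spec.map (CommRingCat.ofHom (genericHom (B := B) l)) ≫ relChart k B (chartIndex l) := by
  have h := SpecMap_eval₂_relChart k B (algebraMap B (FractionRing (Polynomial B)))
    (mul_inv_cancel₀ (algebraMap_X_ne_zero (B := B)))
  refine Fin.cases ?_ (fun _ => ?_) j <;> refine Fin.cases ?_ (fun _ => ?_) l
  · rfl
  · exact h.symm
  · exact h
  · rfl

lemma markGeneric_markChart (j l : Fin (d + 1)) :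
    Spec.map (CommRingCat.ofHom (markGeneric p hp j)) ≫ markChart k p j =
      Spec.map (CommRingCat.ofHom (markGeneric p hp l)) ≫ markChart k p l := by
  rw [markChart, markChart, ← Category.assoc, ← Category.assoc, ← Spec.map_comp, ← Spec.map_comp,
    ← CommRingCat.ofHom_comp, ← CommRingCat.ofHom_comp, markGeneric_comp, markGeneric_comp,
    SpecMap_genericHom_relChart k j l]

end

/-! ## The family of log maps -/

lemma stalkIdeal_zeroLocus_of_prime {R : Type u} [CommRing R] {q : R} (hq : Prime q)
    (w : Spec (.of R)) :
    stalkIdeal (X := Spec (.of R)) (PrimeSpectrum.zeroLocus {q} : Set (PrimeSpectrum R)) w =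
      (Ideal.span {q}).map (specToStalk R w) := by
  rw [stalkIdeal_spec (PrimeSpectrum.isClosed_zeroLocus (R := R) _)]
  congr 1
  change PrimeSpectrum.vanishingIdeal (PrimeSpectrum.zeroLocus {q}) = _
  rw [← PrimeSpectrum.zeroLocus_span, PrimeSpectrum.vanishingIdeal_zeroLocus_eq_radical]
  exact ((Ideal.span_singleton_prime hq.ne_zero).2 hq).isRadical.radical

lemma map_stalkMap_injective {Y X : Scheme.{u}} (f : Y ⟶ X) [IsOpenImmersion f] (y : Y) :
    Function.Injective (Ideal.map (f.stalkMap y).hom) := by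
  let E : X.presheaf.stalk (f y) ≃+* Y.presheaf.stalk y :=
    (asIso (f.stalkMap y)).commRingCatIsoToRingEquiv
  intro I J h
  change I.map (E : X.presheaf.stalk (f y) →+* Y.presheaf.stalk y) = J.map _ at h
  have hsymm := congrArg (Ideal.map (E.symm : Y.presheaf.stalk y →+* X.presheaf.stalk (f y))) h
  rw [Ideal.map_of_equiv] at hsymm
  exact hsymm.trans (Ideal.map_of_equiv E)

section

variable {k B : Type u} [Field k] [CommRing B] [Algebra k B] {d : ℕ} (p : Fin d → B)
  (τ : Fin d → Bˣ) (N : ℕ)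

lemma isUnit_factor (j : Fin (d + 1)) (i : Fin d) :
    IsUnit (algebraMap (Polynomial B) (MarkRing p j) (factor p j i)) :=
  isUnit_of_dvd_unit (map_dvd _ (Finset.dvd_prod_of_mem _ (Finset.mem_univ i)))
    (IsLocalization.Away.algebraMap_isUnit (denom p j))

/-- Near the marking `j`, the rational function `τ_i (t - p_i) ^ N` is the product of the unit
`markUnit p τ N j i` and of the power `slope j i` of `markParam p N j`. -/
def markUnit (j : Fin (d + 1)) (i : Fin d) : (MarkRing p j)ˣ :=
  Units.map (algebraMap B (MarkRing p j)) (τ i) * (isUnit_factor p j i).unit ^ N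

lemma val_markUnit (j : Fin (d + 1)) (i : Fin d) : (markUnit p τ N j i : MarkRing p j) =
    algebraMap B (MarkRing p j) (τ i) *
      algebraMap (Polynomial B) (MarkRing p j) (factor p j i) ^ N := by
  simp [markUnit]

/-- The element of order `N` at the marking `j` by which the family moves along the one-parameter
subgroup `slope j`. -/
def markParam (j : Fin (d + 1)) : MarkRing p j :=
  algebraMap (Polynomial B) (MarkRing p j) (localParam p j) ^ N

variable [IsDomain B] (hp : ∀ i j, i ≠ j → IsUnit (p i - p j))

lemma X_sub_C_ne_zero (i : Fin d) : algebraMap (Polynomial B) (FractionRing (Polynomial B))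
    (Polynomial.X - Polynomial.C (p i)) ≠ 0 :=
  (map_ne_zero_iff _ (IsFractionRing.injective _ _)).2 (Polynomial.X_sub_C_ne_zero _)

/-- The rational functions `τ_i (t - p_i) ^ N` on the affine line: the coordinates of the family in
the torus. -/
def genericUnit (i : Fin d) : (FractionRing (Polynomial B))ˣ :=
  Units.map (algebraMap B (FractionRing (Polynomial B))) (τ i) *
    (Units.mk0 _ (X_sub_C_ne_zero p i)) ^ N

lemma val_genericUnit (i : Fin d) : (genericUnit p τ N i : FractionRing (Polynomial B)) =
    algebraMap B _ (τ i) * algebraMap (Polynomial B) (FractionRing (Polynomial B))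
      (Polynomial.X - Polynomial.C (p i)) ^ N := by
  simp [genericUnit]

lemma genericHom_C {d : ℕ} (j : Fin (d + 1)) (b : B) : genericHom j (Polynomial.C b) =
    algebraMap B (FractionRing (Polynomial B)) b := Polynomial.eval₂_C _ _

lemma genericHom_X {d : ℕ} (j : Fin (d + 1)) :
    genericHom j (Polynomial.X : Polynomial B) = genericCoord j := Polynomial.eval₂_X _ _

lemma genericHom_localParam_ne_zero (j : Fin (d + 1)) : genericHom j (localParam p j) ≠ 0 :=
  (map_ne_zero_iff _ (genericHom_injective j)).2 (Polynomial.X_sub_C_ne_zero _)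

lemma genericHom_factor (j : Fin (d + 1)) (i : Fin d) :
    genericHom j (factor p j i) * genericHom j (localParam p j) ^ slope j i =
      algebraMap (Polynomial B) (FractionRing (Polynomial B))
        (Polynomial.X - Polynomial.C (p i)) := by
  cases j using Fin.cases with
  | zero =>
    have hX := algebraMap_X_ne_zero (B := B)
    have hC := (IsScalarTower.algebraMap_apply B (Polynomial B)
      (FractionRing (Polynomial B)) (p i)).symm
    rw [Polynomial.algebraMap_eq] at hC
    change genericHom 0 (1 - Polynomial.C (p i) * Polynomial.X) *
      genericHom 0 (Polynomial.X - Polynomial.C 0) ^ (-1 : ℤ) = _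
    rw [Polynomial.C_0, sub_zero, map_sub, map_one, map_mul, genericHom_C, genericHom_X, zpow_neg,
      zpow_one, map_sub, hC]
    change (1 - _ * (algebraMap (Polynomial B) (FractionRing (Polynomial B)) Polynomial.X)⁻¹) *
      (algebraMap (Polynomial B) (FractionRing (Polynomial B)) Polynomial.X)⁻¹⁻¹ = _
    rw [inv_inv, sub_mul, one_mul, mul_assoc, inv_mul_cancel₀ hX, mul_one]
  | succ j =>
    change genericHom j.succ (if i = j then 1 else Polynomial.X - Polynomial.C (p i)) *
      genericHom j.succ (Polynomial.X - Polynomial.C (p j)) ^ (Pi.single j 1 : Fin d → ℤ) i = _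
    rw [genericHom_succ]
    split_ifs with h
    · subst h
      rw [Pi.single_eq_same, zpow_one, map_one, one_mul]
    · rw [Pi.single_eq_of_ne h, zpow_zero, mul_one]

/-- `markGeneric` as a homomorphism of `k`-algebras. -/
def markGenericAlg (j : Fin (d + 1)) : MarkRing p j →ₐ[k] FractionRing (Polynomial B) :=
  { markGeneric p hp j with
    commutes' := fun c => by
      change markGeneric p hp j (algebraMap k (MarkRing p j) c) = _
      rw [IsScalarTower.algebraMap_apply k (Polynomial B) (MarkRing p j), markGeneric_algebraMap,
        IsScalarTower.algebraMap_apply k B (Polynomial B), Polynomial.algebraMap_eq, genericHom_C,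
        ← IsScalarTower.algebraMap_apply] }

lemma markGenericAlg_toRingHom (j : Fin (d + 1)) :
    (markGenericAlg (k := k) p hp j).toRingHom = markGeneric p hp j := rfl

variable (F : Fan d) {X : Scheme.{u}} (e : X ≅ F.toricVariety k)

lemma markGeneric_familyMap (σ : F.cones) (j : Fin (d + 1))
    (hu : ∀ m ∈ dualMonoid σ.1, 0 ≤ m ⬝ᵥ slope j) :
    Spec.map (CommRingCat.ofHom (markGeneric p hp j)) ≫
      familyMap F e σ (slope j) hu (markUnit p τ N j) (markParam p N j) =
      torusMap (k := k) F e (genericUnit p τ N) := by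
  rw [← markGenericAlg_toRingHom (k := k)]
  have hparam : markGenericAlg (k := k) p hp j (markParam p N j) =
      genericHom j (localParam p j) ^ N := by
    change markGeneric p hp j _ = _
    rw [markParam, map_pow, markGeneric_algebraMap]
  refine familyMap_eq_torusMap F e _ σ _ hu _ _ _ ?_ fun i => ?_
  · rw [hparam]
    exact pow_ne_zero _ (genericHom_localParam_ne_zero p j)
  · rw [hparam, val_genericUnit, ← genericHom_factor p j i, val_markUnit, map_mul, map_pow]
    change _ = markGeneric p hp j _ * markGeneric p hp j _ ^ N * _
    rw [markGeneric_algebraMap, IsScalarTower.algebraMap_apply B (Polynomial B) (MarkRing p j),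
      markGeneric_algebraMap, Polynomial.algebraMap_eq, genericHom_C, mul_pow, mul_assoc]
    congr 2
    rw [← zpow_natCast (genericHom j (localParam p j) ^ slope j i), ← zpow_mul,
      ← zpow_natCast (genericHom j (localParam p j)), ← zpow_mul, mul_comm]

include hp in
lemma exists_ev {str : X ⟶ Spec (.of k)} [IsSeparated str] (he : e.hom ≫ F.toricStr k = str)
    (hd : 0 < d) (σ : Fin (d + 1) → F.cones)
    (hu : ∀ j, ∀ m ∈ dualMonoid (σ j).1, 0 ≤ m ⬝ᵥ slope j) :
    ∃ ev : relLine k B ⟶ X,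
      (∀ j, markChart k p j ≫ ev =
        familyMap F e (σ j) (slope j) (hu j) (markUnit p τ N j) (markParam p N j)) ∧
      ev ≫ str = pullback.fst _ _ ≫ baseStr k B := by
  have := isDomain_markRing p hp
  refine exists_glue (markChart k p) (exists_mem_range_markChart k p hp hd)
    (fun j => Spec.map (CommRingCat.ofHom (markGeneric p hp j)))
    (fun i j => markGeneric_markChart k p hp i j) str (pullback.fst _ _ ≫ baseStr k B) _
    (fun j => ?_) fun i j => ?_
  · rw [familyMap_str F e he, markChart, Category.assoc, ← Category.assoc (relChart _ _ _),
      relChart_fst, ← Spec.map_comp, ← Spec.map_comp, ← CommRingCat.ofHom_comp,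
      ← CommRingCat.ofHom_comp]
  · rw [markGeneric_familyMap, markGeneric_familyMap]

include hp in
lemma contact_formula (σ : Fin (d + 1) → F.cones)
    (hu : ∀ j, ∀ m ∈ dualMonoid (σ j).1, 0 ≤ m ⬝ᵥ slope j) (hd : 0 < d)
    {ev : relLine k B ⟶ X} (hev : ∀ j, markChart k p j ≫ ev =
        familyMap F e (σ j) (slope j) (hu j) (markUnit p τ N j) (markParam p N j))
    {Z : Set X} (hZ : IsClosed Z) (c : Fin (d + 1) → ℕ)
    (hc : ∀ j, (idealOn (chartTo F e (σ j) ⁻¹' Z)).map (oneParam k (σ j).1 _ (hu j)).toRingHom =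
      Ideal.span {Polynomial.X ^ c j})
    (x : relLine k B) :
    (stalkIdeal Z (ev x)).map (ev.stalkMap x).hom =
      ∏ j, stalkIdeal (Set.range (marking k p j)) x ^ (N * c j) := by
  obtain ⟨j, w, rfl⟩ := exists_mem_range_markChart k p hp hd x
  apply map_stalkMap_injective (markChart k p j) w
  have hpull := pulledIdeal_familyMap F e (σ j) (slope j) (hu j) (markUnit p τ N j)
    (markParam p N j) hZ (hc j) w
  rw [← hev, pulledIdeal_comp] at hpull
  refine hpull.trans ?_
  have hmark : ∀ l, (stalkIdeal (Set.range (marking k p l)) (markChart k p j w)).map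
      ((markChart k p j).stalkMap w).hom =
      stalkIdeal (markChart k p j ⁻¹' Set.range (marking k p l)) w := fun l =>
    pulledIdeal_of_isOpenImmersion (markChart k p j) _ w
  refine Eq.trans ?_ (map_prod (Ideal.mapHom ((markChart k p j).stalkMap w).hom)
    (fun l => stalkIdeal (Set.range (marking k p l)) (markChart k p j w) ^ (N * c l))
    Finset.univ).symm
  simp_rw [map_pow, Ideal.mapHom_apply, hmark]
  rw [Finset.prod_eq_single j, preimage_range_marking,
    stalkIdeal_zeroLocus_of_prime (prime_localParam p hp j), markParam, ← Ideal.span_singleton_pow,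
    Ideal.map_pow, pow_mul]
  · intro l _ hl
    rw [preimage_range_marking_of_ne k p hl, stalkIdeal_eq_top isClosed_empty (Set.notMem_empty w),
      Ideal.top_pow, Ideal.one_eq_top]
  · exact fun h => absurd (Finset.mem_univ j) h

end

lemma exists_mem_of_contact {Y X : Scheme.{u}} {f : Y ⟶ X} {Z : Set X} {ι : Type*} [Fintype ι]
    {D : ι → Set Y} (hD : ∀ j, IsClosed (D j)) {c : ι → ℕ} {y : Y}
    (h : (stalkIdeal Z (f y)).map (f.stalkMap y).hom = ∏ j, stalkIdeal (D j) y ^ c j)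
    (hy : f y ∈ Z) : ∃ j, y ∈ D j := by
  by_contra! hno
  have htop : ∏ j, stalkIdeal (D j) y ^ c j = ⊤ :=
    (Finset.prod_eq_one fun j _ => by
      rw [stalkIdeal_eq_top (hD j) (hno j), Ideal.top_pow, Ideal.one_eq_top]).trans
        Ideal.one_eq_top
  have hlocal := ((IsLocalRing.local_hom_TFAE (f.stalkMap y).hom).out 0 2 rfl rfl).1 inferInstance
  have hle : (stalkIdeal Z (f y)).map (f.stalkMap y).hom ≤
      IsLocalRing.maximalIdeal (Y.presheaf.stalk y) :=
    (Ideal.map_mono (IsLocalRing.le_maximalIdeal (stalkIdeal_ne_top hy))).trans hlocal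
  rw [h, htop, top_le_iff] at hle
  exact (IsLocalRing.maximalIdeal.isMaximal _).ne_top hle

lemma mem_of_contact {Y X : Scheme.{u}} {f : Y ⟶ X} {Z : Set X} (hZ : IsClosed Z) {ι : Type*}
    [Fintype ι] {D : ι → Set Y} {c : ι → ℕ} {y : Y}
    (h : (stalkIdeal Z (f y)).map (f.stalkMap y).hom = ∏ j, stalkIdeal (D j) y ^ c j)
    {j : ι} (hj : y ∈ D j) (hcj : c j ≠ 0) : f y ∈ Z := by
  by_contra hy
  rw [stalkIdeal_eq_top hZ hy, Ideal.map_top] at h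
  have hle : ∏ j, stalkIdeal (D j) y ^ c j ≤ stalkIdeal (D j) y :=
    (Ideal.prod_le_inf.trans (Finset.inf_le (Finset.mem_univ j))).trans (Ideal.pow_le_self hcj)
  rw [← h, top_le_iff] at hle
  exact stalkIdeal_ne_top hj hle

lemma isLogMorphism_of_preimage_subset {Y X : Scheme.{u}} {f : Y ⟶ X} {E : Set Y} {D : Set X}
    (h : f ⁻¹' D ⊆ E) : IsLogMorphism f E D := by
  intro U s hs x hxU hxE
  have hunit : x ∈ f ⁻¹ᵁ X.basicOpen s := hs (f x) hxU fun hx => hxE (h hx)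
  rwa [Scheme.preimage_basicOpen] at hunit

section

variable {k B : Type u} [Field k] [CommRing B] [Algebra k B] {d : ℕ} (p : Fin d → B)

lemma isClosed_range_marking (j : Fin (d + 1)) : IsClosed (Set.range (marking k p j)) := by
  have h : IsClosedImmersion (marking k p j ≫ pullback.fst (baseStr k B) (projectiveStr 1 k)) := by
    rw [marking_fst]; infer_instance
  have : IsClosedImmersion (marking k p j) := IsClosedImmersion.of_comp _ (pullback.fst _ _)
  exact (marking k p j).isClosedEmbedding.isClosed_range

/-- The section `t = b` of the projective line. -/
def affineSection (k : Type u) [Field k] [Algebra k B] (b : B) : Spec (.of B) ⟶ relLine k B :=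
  Spec.map (CommRingCat.ofHom (Polynomial.evalRingHom b)) ≫ relChart k B 0

lemma affineSection_fst (b : B) : affineSection k b ≫ pullback.fst _ _ = 𝟙 _ := by
  rw [affineSection, Category.assoc, relChart_fst, ← Spec.map_comp, ← CommRingCat.ofHom_comp]
  have hcomp : (Polynomial.evalRingHom b).comp Polynomial.C = RingHom.id B :=
    RingHom.ext fun b => Polynomial.eval_C
  rw [hcomp, CommRingCat.ofHom_id, Spec.map_id]

lemma affineSection_mem_range_marking {b : B} {j : Fin (d + 1)} {w : Spec (.of B)}
    (h : affineSection k b w ∈ Set.range (marking k p j)) : j ≠ 0 ∧ ¬ IsUnit (b - center p j) := by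
  obtain ⟨q, hmem, hq⟩ := (mem_range_marking k p j _).1 h
  let w' : PrimeSpectrum B := w
  change relChart k B (chartIndex j) q = relChart k B 0 (PrimeSpectrum.comap
    (Polynomial.evalRingHom b) w') at hmem
  cases j using Fin.cases with
  | zero =>
    have hX : Polynomial.X ∈ q.asIdeal := by simpa [localParam, center] using hq
    exact absurd hX ((relChart_one_mem_range_zero k B q).1 ⟨_, hmem.symm⟩)
  | succ j =>
    refine ⟨Fin.succ_ne_zero j, fun hunit => ?_⟩
    obtain rfl := (relChart k B 0).isOpenEmbedding.injective hmem
    have heval : Polynomial.eval b (localParam p j.succ) ∈ w'.asIdeal := hq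
    rw [localParam, Polynomial.eval_sub, Polynomial.eval_X, Polynomial.eval_C] at heval
    exact w'.isPrime.ne_top (Ideal.eq_top_of_isUnit_mem _ heval hunit)

section

variable {O : Orbifold k} {ev : relLine k B ⟶ O.X} {c : Fin (d + 1) → O.ι → ℕ}
  (hcontact : ∀ i, ∀ x : relLine k B,
    (stalkIdeal (O.Δ i : Set O.X) (ev x)).map (ev.stalkMap x).hom =
      ∏ j, stalkIdeal (Set.range (marking k p j)) x ^ c j i)

include hcontact

lemma isLogMorphism_of_contact :
    IsLogMorphism ev (⋃ j, Set.range (marking k p j)) O.boundary := by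
  refine isLogMorphism_of_preimage_subset fun x hx => ?_
  obtain ⟨i, hi⟩ := Set.mem_iUnion.1 hx
  exact Set.mem_iUnion.2 (exists_mem_of_contact (isClosed_range_marking p) (hcontact i x) hi)

lemma three_le_or_not_subsingleton_image_fibre (hd : 0 < d) (hc : c 0 ≠ 0) (w : Spec (.of B)) :
    3 ≤ d + 1 ∨
      ¬ (ev '' (pullback.fst (baseStr k B) (projectiveStr 1 k) ⁻¹' {w})).Subsingleton := by
  -- For `d = 1` the marking at infinity is mapped into a component of the boundary, while the
  -- section `t = p_0 + 1` avoids all markings.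
  obtain h | rfl : 2 ≤ d ∨ d = 1 := by omega
  · exact Or.inl (by omega)
  refine Or.inr fun hsub => ?_
  have hfibre : ∀ s : Spec (.of B) ⟶ relLine k B, s ≫ pullback.fst _ _ = 𝟙 _ →
      ev (s w) ∈ ev '' (pullback.fst (baseStr k B) (projectiveStr 1 k) ⁻¹' {w}) := by
    intro s hs
    refine ⟨s w, ?_, rfl⟩
    rw [Set.mem_preimage, ← Scheme.Hom.comp_apply, hs]
    rfl
  have heq := hsub (hfibre _ (marking_fst k p 0)) (hfibre _ (affineSection_fst (p 0 + 1)))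
  obtain ⟨i, hi⟩ := Function.ne_iff.1 hc
  have hmem := mem_of_contact (O.Δ i).isClosed (hcontact i _) ⟨w, rfl⟩ hi
  rw [heq] at hmem
  obtain ⟨j, hj⟩ := exists_mem_of_contact (isClosed_range_marking p) (hcontact i _) hmem
  obtain ⟨hj0, hunit⟩ := affineSection_mem_range_marking p hj
  obtain rfl : j = Fin.succ 0 := (by decide : ∀ j : Fin 2, j ≠ 0 → j = Fin.succ 0) j hj0
  refine hunit ?_
  change IsUnit (p 0 + 1 - p 0)
  rw [add_sub_cancel_left]
  exact isUnit_one

end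

/-- The family of log maps on the projective line over `Spec B` given by an evaluation morphism
with prescribed contact orders. -/
def logFamily [IsDomain B] [Algebra.FiniteType k B]
    (hp : ∀ i j, i ≠ j → IsUnit (p i - p j)) (hd : 0 < d) {O : Orbifold k} (ev : relLine k B ⟶ O.X)
    (hev : ev ≫ O.str = pullback.fst _ _ ≫ baseStr k B) (c : Fin (d + 1) → O.ι → ℕ)
    (hcontact : ∀ i, ∀ x : relLine k B,
      (stalkIdeal (O.Δ i : Set O.X) (ev x)).map (ev.stalkMap x).hom =
        ∏ j, stalkIdeal (Set.range (marking k p j)) x ^ c j i)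
    (hc : c 0 ≠ 0) : O.LogFamily c where
  W := Spec (.of B)
  strW := baseStr k B
  isIntegral := inferInstance
  isSeparated := inferInstance
  locallyOfFiniteType := by
    rw [HasRingHomProperty.Spec_iff (P := @LocallyOfFiniteType)]
    exact RingHom.finiteType_algebraMap.2 inferInstance
  quasiCompact := inferInstance
  mark := marking k p
  mark_fst := marking_fst k p
  mark_disjoint := marking_disjoint k p hp
  ev := ev
  ev_str := hev
  isLogMorphism := isLogMorphism_of_contact p hcontact
  contact := hcontact
  stable := three_le_or_not_subsingleton_image_fibre p hcontact hd hc

end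

/-! ## Function fields and dominant morphisms -/

/-- Stated for a point `y` equal to the generic point, so that the stalk can be transported to the
function field. -/
lemma exists_isFractionRing_stalk {R : Type u} [CommRing R] [IsDomain R] {Y : Scheme.{u}}
    (j : Spec (.of R) ⟶ Y) [IsOpenImmersion j] {y : Y}
    (hy : j (genericPoint (Spec (.of R))) = y) :
    ∃ α : R →+* Y.presheaf.stalk y, (let _ := α.toAlgebra
      IsFractionRing R (Y.presheaf.stalk y)) ∧
      Spec.map (CommRingCat.ofHom α) ≫ j = Y.fromSpecStalk y := by
  subst hy
  set g := genericPoint (Spec (.of R))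
  let E : (Spec (.of R)).presheaf.stalk g ≃+* Y.presheaf.stalk (j g) :=
    (asIso (j.stalkMap g)).symm.commRingCatIsoToRingEquiv
  refine ⟨E.toRingHom.comp (specToStalk R g), ?_, ?_⟩
  · let _ := (specToStalk R g).toAlgebra
    let _ := (E.toRingHom.comp (specToStalk R g)).toAlgebra
    have : IsFractionRing R ((Spec (.of R)).presheaf.stalk g) :=
      functionField_isFractionRing_of_affine (.of R)
    exact IsLocalization.isLocalization_of_algEquiv (nonZeroDivisors R)
      (AlgEquiv.ofRingEquiv (f := E) fun _ => rfl)
  · have hcomp : CommRingCat.ofHom (E.toRingHom.comp (specToStalk R g)) =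
      CommRingCat.ofHom (specToStalk R g) ≫ inv (j.stalkMap g) := rfl
    rw [hcomp, Spec.map_comp, ← fromSpecStalk_eq_specMap_specToStalk, Category.assoc,
      ← Scheme.SpecMap_stalkMap_fromSpecStalk, ← Category.assoc, ← Spec.map_comp,
      IsIso.hom_inv_id, Spec.map_id]
    exact Category.id_comp _

lemma exists_isFractionRing_functionField {R : Type u} [CommRing R] [IsDomain R] {Y : Scheme.{u}}
    [IsIntegral Y] (j : Spec (.of R) ⟶ Y) [IsOpenImmersion j] :
    ∃ α : R →+* Y.functionField, (let _ := α.toAlgebra; IsFractionRing R Y.functionField) ∧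
      Spec.map (CommRingCat.ofHom α) ≫ j = Y.fromSpecStalk (genericPoint Y) :=
  exists_isFractionRing_stalk j (genericPoint_eq_of_isOpenImmersion j)

lemma isDominant_SpecMap_of_injective {R S : Type u} [CommRing R] [CommRing S] {f : R →+* S}
    (hf : Function.Injective f) : IsDominant (Spec.map (CommRingCat.ofHom f)) :=
  ⟨(PrimeSpectrum.denseRange_comap_iff_ker_le_nilRadical f).2
    ((RingHom.injective_iff_ker_eq_bot f).1 hf ▸ bot_le)⟩

lemma isDominant_of_isOpenImmersion {Y Z : Scheme.{u}} [Nonempty Y] [IrreducibleSpace Z]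
    (j : Y ⟶ Z) [IsOpenImmersion j] : IsDominant j :=
  ⟨(j.isOpenEmbedding.isOpen_range).dense (Set.range_nonempty j)⟩

lemma SpecMap_functionFieldMap {Y Z : Scheme.{u}} [IsIntegral Y] [IsIntegral Z] (f : Y ⟶ Z)
    [IsDominant f] : Spec.map (CommRingCat.ofHom (functionFieldMap f)) ≫
      Z.fromSpecStalk (genericPoint Z) = Y.fromSpecStalk (genericPoint Y) ≫ f := by
  have hmap : CommRingCat.ofHom (functionFieldMap f) =
    Z.presheaf.stalkSpecializes (genericPoint_specializes_genericPoint f) ≫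
    f.stalkMap (genericPoint Y) := rfl
  rw [hmap, Spec.map_comp, Category.assoc, Scheme.SpecMap_stalkSpecializes_fromSpecStalk,
    Scheme.SpecMap_stalkMap_fromSpecStalk]

lemma isDominantSeparable_of_chart {Y Z : Scheme.{u}} [IsIntegral Y] [IsIntegral Z] (f : Y ⟶ Z)
    {R T : Type u} [CommRing R] [IsDomain R] [CommRing T] [IsDomain T]
    (jY : Spec (.of R) ⟶ Y) [IsOpenImmersion jY] (jZ : Spec (.of T) ⟶ Z) [IsOpenImmersion jZ]
    (h : ∀ (L : Type u) [Field L] [Algebra R L] [IsFractionRing R L], ∃ ψ : T →+* L,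
      Function.Injective ψ ∧
      Spec.map (CommRingCat.ofHom (algebraMap R L)) ≫ jY ≫ f =
        Spec.map (CommRingCat.ofHom ψ) ≫ jZ ∧
      ∀ (K : Type u) [Field K] [Algebra T K] [IsFractionRing T K] (φ : K →+* L),
        φ.comp (algebraMap T K) = ψ → IsSeparablyGenerated K L φ) :
    IsDominantSeparable f := by
  obtain ⟨α, hα, hα'⟩ := exists_isFractionRing_functionField jY
  obtain ⟨β, hβ, hβ'⟩ := exists_isFractionRing_functionField jZ
  let _ := α.toAlgebra
  let _ := β.toAlgebra
  obtain ⟨ψ, hψ, hψ', hsep⟩ := h Y.functionField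
  have hfψ : Y.fromSpecStalk (genericPoint Y) ≫ f = Spec.map (CommRingCat.ofHom ψ) ≫ jZ := by
    rw [← hα', Category.assoc]; exact hψ'
  have hf : IsDominant f := by
    have := isDominant_SpecMap_of_injective hψ
    have := isDominant_of_isOpenImmersion jZ
    have : IsDominant (Y.fromSpecStalk (genericPoint Y) ≫ f) := by rw [hfψ]; infer_instance
    exact IsDominant.of_comp (Y.fromSpecStalk (genericPoint Y)) f
  refine ⟨inferInstance, inferInstance, hf, hsep _ _ ?_⟩
  have hgeneric := SpecMap_functionFieldMap f
  rw [hfψ, ← hβ', ← Category.assoc, ← Spec.map_comp, cancel_mono] at hgeneric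
  exact congrArg CommRingCat.Hom.hom (Spec.map_injective hgeneric)

/-! ## Self-products of integral schemes -/

section

variable {S : Type u} [CommRing S] {Y : Scheme.{u}} (f : Y ⟶ Spec (.of S))

/-- The affine chart of `Y ×_S Y` which is the product over `S` of two affine charts of `Y`. -/
def prodChart {A A' : Type u} [CommRing A] [CommRing A'] [Algebra S A] [Algebra S A']
    (j : Spec (.of A) ⟶ Y) (j' : Spec (.of A') ⟶ Y)
    (hj : j ≫ f = Spec.map (CommRingCat.ofHom (algebraMap S A)))
    (hj' : j' ≫ f = Spec.map (CommRingCat.ofHom (algebraMap S A'))) :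
    Spec (.of (A ⊗[S] A')) ⟶ pullback f f :=
  (pullbackSpecIso S A A').inv ≫ pullback.map _ _ f f j j' (𝟙 _)
    (by rw [Category.comp_id, hj]) (by rw [Category.comp_id, hj'])

variable {A A' : Type u} [CommRing A] [CommRing A'] [Algebra S A] [Algebra S A']
    {j : Spec (.of A) ⟶ Y} {j' : Spec (.of A') ⟶ Y}
    (hj : j ≫ f = Spec.map (CommRingCat.ofHom (algebraMap S A)))
    (hj' : j' ≫ f = Spec.map (CommRingCat.ofHom (algebraMap S A')))

instance [IsOpenImmersion j] [IsOpenImmersion j'] : IsOpenImmersion (prodChart f j j' hj hj') := by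
  unfold prodChart; infer_instance

lemma prodChart_fst : prodChart f j j' hj hj' ≫ pullback.fst f f =
    Spec.map (CommRingCat.ofHom Algebra.TensorProduct.includeLeftRingHom) ≫ j := by
  rw [prodChart, Category.assoc, pullback.map, pullback.lift_fst, ← Category.assoc,
    pullbackSpecIso_inv_fst]

lemma prodChart_snd : prodChart f j j' hj hj' ≫ pullback.snd f f =
    Spec.map (CommRingCat.ofHom
      (Algebra.TensorProduct.includeRight : A' →ₐ[S] A ⊗[S] A').toRingHom) ≫ j' := by
  rw [prodChart, Category.assoc, pullback.map, pullback.lift_snd, ← Category.assoc,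
    pullbackSpecIso_inv_snd]
  rfl

lemma range_prodChart : Set.range (prodChart f j j' hj hj') =
    pullback.fst f f ⁻¹' Set.range j ∩ pullback.snd f f ⁻¹' Set.range j' := by
  have hsurj : Function.Surjective (pullbackSpecIso S A A').inv :=
    (pullbackSpecIso S A A').inv.surjective
  have h : ⇑(prodChart f j j' hj hj') = pullback.map _ _ f f j j' (𝟙 _)
    (by rw [Category.comp_id, hj]) (by rw [Category.comp_id, hj']) ∘
      (pullbackSpecIso S A A').inv := by
    rw [prodChart]; exact funext fun x => Scheme.Hom.comp_apply _ _ _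
  rw [h, hsurj.range_comp]
  exact Scheme.Pullback.range_map _ _ _ _ _ _ _ _ _

lemma isIntegral_pullback_self [IsIntegral Y] {J : Type*} [Nonempty J] {A : J → Type u}
    [∀ i, CommRing (A i)] [∀ i, Algebra S (A i)] (j : ∀ i, Spec (.of (A i)) ⟶ Y)
    [∀ i, IsOpenImmersion (j i)] (hcov : ∀ y, ∃ i, y ∈ Set.range (j i)) [∀ i, Nontrivial (A i)]
    (hj : ∀ i, j i ≫ f = Spec.map (CommRingCat.ofHom (algebraMap S (A i))))
    (hdom : ∀ i i', IsDomain (A i ⊗[S] A i')) : IsIntegral (pullback f f) := by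
  have : ∀ q : J × J, IsIntegral (Spec (.of (A q.1 ⊗[S] A q.2))) := fun q => by
    have := hdom q.1 q.2
    infer_instance
  refine isIntegral_of_cover (fun q : J × J => prodChart f (j q.1) (j q.2) (hj q.1) (hj q.2))
    (fun y => ?_) fun q q' => ?_
  · obtain ⟨i, hi⟩ := hcov (pullback.fst f f y)
    obtain ⟨i', hi'⟩ := hcov (pullback.snd f f y)
    exact ⟨(i, i'), (range_prodChart f _ _).ge ⟨hi, hi'⟩⟩
  · have hgen : ∀ i, genericPoint Y ∈ Set.range (j i) := fun i =>
      ((genericPoint_spec Y).mem_open_set_iff (j i).isOpenEmbedding.isOpen_range).2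
        (by rw [Set.univ_inter]; exact Set.range_nonempty _)
    refine ⟨pullback.diagonal f (genericPoint Y), ?_⟩
    rw [range_prodChart, range_prodChart]
    have hfst : pullback.fst f f (pullback.diagonal f (genericPoint Y)) = genericPoint Y := by
      rw [← Scheme.Hom.comp_apply, pullback.diagonal_fst]; rfl
    have hsnd : pullback.snd f f (pullback.diagonal f (genericPoint Y)) = genericPoint Y := by
      rw [← Scheme.Hom.comp_apply, pullback.diagonal_snd]; rfl
    simp only [Set.mem_inter_iff, Set.mem_preimage, hfst, hsnd, hgen, and_self]

end

lemma isDomain_tensor_addMonoidAlgebra (k A : Type u) (M : Type*) [CommRing k]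
    [CommRing A] [IsDomain A] [Algebra k A] [AddCommMonoid M] [UniqueSums M] :
    IsDomain (A ⊗[k] AddMonoidAlgebra k M) :=
  (AddMonoidAlgebra.scalarTensorEquiv k A (M := M)).toMulEquiv.isDomain _

lemma isDomain_tensor_polynomial (S A : Type u) [CommRing S] [CommRing A] [IsDomain A]
    [Algebra S A] : IsDomain (A ⊗[S] Polynomial S) :=
  (polyEquivTensor S A).symm.toMulEquiv.isDomain _

/-! ## Field extensions generated by coordinates and roots -/

lemma linearIndependent_prod_pow {k L ι : Type*} [Field k] [Field L] [Algebra k L] [Fintype ι]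
    {v : ι → L} (hv : AlgebraicIndependent k v) :
    LinearIndependent k fun n : ι → ℕ => ∏ i, v i ^ n i := by
  have h := ((MvPolynomial.basisMonomials ι k).linearIndependent.map'
    (MvPolynomial.aeval v).toLinearMap (LinearMap.ker_eq_bot.2 hv)).comp
    _ Finsupp.equivFunOnFinite.symm.injective
  rwa [show _ ∘ _ = fun n : ι → ℕ => ∏ i, v i ^ n i from funext fun n => by
    simp [MvPolynomial.aeval_monomial, Finsupp.prod_fintype]] at h

lemma linearIndependent_prod_zpow {k L ι : Type*} [Field k] [Field L] [Algebra k L] [Fintype ι]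
    {v : ι → L} (hv : AlgebraicIndependent k v) :
    LinearIndependent k fun m : ι → ℤ => ∏ i, v i ^ m i := by
  refine linearIndependent_iff_finset_linearIndependent.2 fun s => ?_
  obtain ⟨n, hn⟩ := s.bddBelow
  have hinj : Function.Injective fun (m : s) i => (m.1 i - n i).toNat := fun m m' h =>
    Subtype.ext <| funext fun i => by
      have hi : (m.1 i - n i).toNat = (m'.1 i - n i).toNat := congrFun h i
      have hm : n i ≤ m.1 i := hn m.2 i
      have hm' : n i ≤ m'.1 i := hn m'.2 i
      omega
  refine .of_comp (LinearMap.mulLeft k (∏ i, v i ^ (-n i))) ?_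
  have hshift (m : s) : (∏ i, v i ^ (-n i)) * ∏ i, v i ^ m.1 i =
      ∏ i, v i ^ (m.1 i - n i).toNat := by
    rw [← Finset.prod_mul_distrib]
    refine Finset.prod_congr rfl fun i _ => ?_
    rw [← zpow_add₀ (hv.ne_zero i), ← zpow_natCast, Int.toNat_of_nonneg (sub_nonneg.2 (hn m.2 i)),
      neg_add_eq_sub]
  have h := (linearIndependent_prod_pow hv).comp _ hinj
  simp only [Function.comp_def, ← hshift] at h
  exact h

lemma mem_separableClosure_of_pow_mem {E L : Type*} [Field E] [Field L] [Algebra E L] {N : ℕ}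
    (hN : (N : L) ≠ 0) {x : L} (hx : x ≠ 0) (h : x ^ N ∈ (algebraMap E L).fieldRange) :
    x ∈ separableClosure E L := by
  obtain ⟨a, ha⟩ := h
  have hNE : (N : E) ≠ 0 := fun h => hN (by rw [← map_natCast (algebraMap E L), h, map_zero])
  have ha0 : a ≠ 0 := by
    rintro rfl
    exact pow_ne_zero N hx (by rw [← ha, map_zero])
  refine mem_separableClosure_iff.2
    ((Polynomial.separable_X_pow_sub_C a hNE ha0).of_dvd (minpoly.dvd E x ?_))
  simp [ha]

lemma adjoin_eq_top_of_fieldRange_le {k K L : Type*} [Field k] [Field K] [Field L] [Algebra k L]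
    [Algebra K L] (h : (algebraMap k L).fieldRange ≤ (algebraMap K L).fieldRange) {S : Set L}
    (hS : IntermediateField.adjoin k S = ⊤) : IntermediateField.adjoin K S = ⊤ := by
  rw [← IntermediateField.toSubfield_inj, IntermediateField.adjoin_toSubfield,
    IntermediateField.top_toSubfield] at hS ⊢
  exact top_le_iff.1 (hS.ge.trans (Subfield.closure_mono (Set.union_subset_union_left S h)))

section

variable {L : Type u} [Field L] {d : ℕ} (N : ℕ) (τ p : Fin d → L) (t : Fin 2 → L)

/-- The coordinates `τ_i (t_l - p_i) ^ N` of two points on a curve with parameters `τ` and `p`. -/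
def coord (l : Fin 2) (i : Fin d) : L := τ i * (t l - p i) ^ N

variable (hτ : ∀ i, τ i ≠ 0) (htp : ∀ l i, t l ≠ p i) (ht : t 0 ≠ t 1) (hN : (N : L) ≠ 0)

include hτ htp ht hN

section

variable {E : Type u} [Field E] [Algebra E L] (htE : ∀ l, t l ∈ (algebraMap E L).fieldRange)
  (hcE : ∀ l i, coord N τ p t l i ∈ (algebraMap E L).fieldRange)

include htE hcE

/-- The quotient `x = (t_1 - p_i) / (t_0 - p_i)` is an `N`-th root of a quotient of coordinates, and
`p_i` is a Möbius transform of `x` over the field generated by `t_0` and `t_1`. -/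
lemma center_mem_separableClosure (i : Fin d) : p i ∈ separableClosure E L := by
  have htp' (l) : t l - p i ≠ 0 := sub_ne_zero.2 (htp l i)
  have hmem {y : L} (hy : y ∈ (algebraMap E L).fieldRange) : y ∈ separableClosure E L := by
    obtain ⟨y, rfl⟩ := hy
    exact (separableClosure E L).algebraMap_mem y
  set x := (t 1 - p i) / (t 0 - p i) with hx
  have hxN : x ^ N = coord N τ p t 1 i / coord N τ p t 0 i := by
    rw [coord, coord, mul_div_mul_left _ _ (hτ i), ← div_pow]
  have hxmem : x ∈ separableClosure E L := by
    refine mem_separableClosure_of_pow_mem hN (div_ne_zero (htp' 1) (htp' 0)) ?_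
    rw [hxN]
    exact div_mem (hcE 1 i) (hcE 0 i)
  have hx1 : x - 1 ≠ 0 := by
    rw [sub_ne_zero, hx, Ne, div_eq_one_iff_eq (htp' 0)]
    exact fun h => ht (sub_left_injective h).symm
  have hp : p i = (x * t 0 - t 1) / (x - 1) := by
    rw [eq_div_iff hx1]
    linear_combination -div_mul_cancel₀ (t 1 - p i) (htp' 0)
  rw [hp]
  exact div_mem (sub_mem (mul_mem hxmem (hmem (htE 0))) (hmem (htE 1)))
    (sub_mem hxmem (one_mem _))

lemma multiplier_mem_separableClosure (i : Fin d) : τ i ∈ separableClosure E L := by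
  have hmem {y : L} (hy : y ∈ (algebraMap E L).fieldRange) : y ∈ separableClosure E L := by
    obtain ⟨y, rfl⟩ := hy
    exact (separableClosure E L).algebraMap_mem y
  have hpi := center_mem_separableClosure N τ p t hτ htp ht hN htE hcE i
  have hτi : τ i = coord N τ p t 0 i / (t 0 - p i) ^ N := by
    rw [coord, mul_div_cancel_right₀ _ (pow_ne_zero _ (sub_ne_zero.2 (htp 0 i)))]
  rw [hτi]
  exact div_mem (hmem (hcE 0 i)) (pow_mem (sub_mem (hmem (htE 0)) hpi) N)

end

lemma isSeparable_of_coord_mem {K : Type u} [Field K] [Algebra K L] (E : IntermediateField K L)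
    (htE : ∀ l, t l ∈ E) (hcE : ∀ l i, coord N τ p t l i ∈ E)
    (hgen : IntermediateField.adjoin K (Set.range (Sum.elim t (Sum.elim τ p))) = ⊤) :
    Algebra.IsSeparable E L := by
  have htE' (l) : t l ∈ (algebraMap E L).fieldRange := ⟨⟨_, htE l⟩, rfl⟩
  have hcE' (l i) : coord N τ p t l i ∈ (algebraMap E L).fieldRange := ⟨⟨_, hcE l i⟩, rfl⟩
  have htop : ⊤ ≤ (separableClosure E L).restrictScalars K := by
    rw [← hgen, IntermediateField.adjoin_le_iff]
    rintro _ ⟨l | i | i, rfl⟩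
    · exact (separableClosure E L).algebraMap_mem ⟨t l, htE l⟩
    · exact multiplier_mem_separableClosure N τ p t hτ htp ht hN htE' hcE' i
    · exact center_mem_separableClosure N τ p t hτ htp ht hN htE' hcE' i
  exact ⟨fun y => mem_separableClosure_iff.1 (htop (IntermediateField.mem_top (x := y)))⟩

variable {k : Type u} [Field k] [Algebra k L]
  (hgen : IntermediateField.adjoin k (Set.range (Sum.elim t (Sum.elim τ p))) = ⊤)
  (htrdeg : Algebra.trdeg k L = (2 + (d + d) : ℕ))

include hgen htrdeg

open scoped IntermediateField.algebraAdjoinAdjoin in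
/-- `L` is algebraic over the field generated by the `2 + 2 d` listed elements, so these are
independent as soon as they are as many as the transcendence degree. -/
lemma algebraicIndependent_coord :
    AlgebraicIndependent k (Sum.elim t (Sum.elim (coord N τ p t 0) (coord N τ p t 1))) := by
  set v := Sum.elim t (Sum.elim (coord N τ p t 0) (coord N τ p t 1))
  have hv (a) : v a ∈ IntermediateField.adjoin k (Set.range v) :=
    IntermediateField.subset_adjoin _ _ ⟨a, rfl⟩
  have hsep : Algebra.IsSeparable (IntermediateField.adjoin k (Set.range v)) L :=
    isSeparable_of_coord_mem N τ p t hτ htp ht hN _ (fun l => hv (.inl l))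
      (Fin.forall_fin_two.2 ⟨fun i => hv (.inr (.inl i)), fun i => hv (.inr (.inr i))⟩) hgen
  have halg : Algebra.IsAlgebraic (Algebra.adjoin k (Set.range v)) L :=
    IntermediateField.isAlgebraic_adjoin_iff_top.1 inferInstance
  refine (Algebra.IsAlgebraic.isTranscendenceBasis_of_lift_le_trdeg_of_finite k v ?_).1
  rw [htrdeg]
  simp

open scoped IntermediateField.algebraAdjoinAdjoin in
lemma isSeparablyGenerated_coord {K : Type u} [Field K] (φ : K →+* L)
    (hφ : φ.fieldRange = (IntermediateField.adjoin k
      (Set.range (Sum.elim (coord N τ p t 0) (coord N τ p t 1)))).toSubfield) :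
    IsSeparablyGenerated K L φ := by
  set v := Sum.elim (coord N τ p t 0) (coord N τ p t 1)
  set F := IntermediateField.adjoin k (Set.range v)
  have hmem (x : K) : φ x ∈ F := hφ.le ⟨x, rfl⟩
  let φ' : K →+* F := φ.codRestrict _ hmem
  let _ := φ.toAlgebra
  let _ := φ'.toAlgebra
  have : IsScalarTower K F L := IsScalarTower.of_algebraMap_eq fun x => rfl
  have hind : AlgebraicIndependent K t :=
    ((AlgebraicIndependent.sumElim_iff.1
      (algebraicIndependent_coord N τ p t hτ htp ht hN hgen htrdeg)).2.extendScalars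
        _).restrictScalars φ'.injective
  set E := IntermediateField.adjoin K (Set.range t)
  have hFE {x : L} (hx : x ∈ F) : x ∈ E := by
    obtain ⟨y, rfl⟩ := hφ.ge hx
    exact E.algebraMap_mem y
  have hvF (a) : v a ∈ F := IntermediateField.subset_adjoin _ _ ⟨a, rfl⟩
  have hgenK : IntermediateField.adjoin K (Set.range (Sum.elim t (Sum.elim τ p))) = ⊤ :=
    adjoin_eq_top_of_fieldRange_le (by
      rintro _ ⟨c, rfl⟩
      exact hφ.ge (F.algebraMap_mem c)) hgen
  have hsep : Algebra.IsSeparable E L := isSeparable_of_coord_mem N τ p t hτ htp ht hN E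
    (fun l => IntermediateField.subset_adjoin _ _ ⟨l, rfl⟩)
    (Fin.forall_fin_two.2 ⟨fun i => hFE (hvF (.inl i)), fun i => hFE (hvF (.inr i))⟩) hgenK
  have halg : Algebra.IsAlgebraic (Algebra.adjoin K (Set.range t)) L :=
    IntermediateField.isAlgebraic_adjoin_iff_top.1 inferInstance
  refine ⟨Set.range t, ?_, hsep⟩
  rwa [hind.to_subtype_range.isTranscendenceBasis_iff_isAlgebraic, Subtype.range_val]

end

/-! ## Pairs of points of the torus -/

section

variable {k : Type u} [Field k] {d : ℕ} {L : Type u} [Field L] [Algebra k L]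

lemma fieldRange_eq_adjoin {T K : Type u} [CommRing T] [Algebra k T] [Field K] [Algebra T K]
    [IsFractionRing T K] (f : T →ₐ[k] L) {S : Set L} (hS : S ⊆ f.range)
    (hf : f.range ≤ (IntermediateField.adjoin k S).toSubalgebra) {φ : K →+* L}
    (hφ : φ.comp (algebraMap T K) = f.toRingHom) :
    φ.fieldRange = (IntermediateField.adjoin k S).toSubfield := by
  rw [IsFractionRing.ringHom_fieldRange_eq_of_comp_eq hφ]
  refine le_antisymm (Subfield.closure_le.2 hf) ?_
  rw [IntermediateField.adjoin_toSubfield, Subfield.closure_le]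
  exact Set.union_subset
    (Set.range_subset_iff.2 fun c => Subfield.subset_closure ⟨algebraMap k T c, f.commutes c⟩)
    (Set.Subset.trans hS Subfield.subset_closure)

lemma val_unitChar (v : Fin d → Lˣ) (m : Fin d → ℤ) :
    unitChar v (Multiplicative.ofAdd m) = ∏ i, (v i : L) ^ m i := by
  change ((∏ i, v i ^ m i : Lˣ) : L) = _
  simp only [Units.coe_prod, Units.val_zpow_eq_zpow_val]

variable (F : Fan d)

lemma unitHom_single (v : Fin d → Lˣ) (m : dualMonoid F.zeroCone.1) :
    unitHom (k := k) F v (AddMonoidAlgebra.single m 1) = ∏ i, (v i : L) ^ m.1 i :=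
  (charHom_single _ _ _).trans (val_unitChar v m.1)

lemma mem_dualMonoid_zeroCone (m : Fin d → ℤ) : m ∈ dualMonoid F.zeroCone.1 := by
  intro v hv
  obtain rfl : v = 0 := hv
  rw [pairing_zero_right]

lemma mem_range_unitHom (v : Fin d → Lˣ) (i : Fin d) :
    (v i : L) ∈ (unitHom (k := k) F v).range := by
  refine ⟨AddMonoidAlgebra.single ⟨Pi.single i 1, mem_dualMonoid_zeroCone F _⟩ 1, ?_⟩
  refine (unitHom_single F v _).trans ((Fintype.prod_eq_single i fun j hj => ?_).trans ?_)
  · exact (congrArg _ (Pi.single_eq_of_ne hj 1)).trans (zpow_zero _)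
  · exact (congrArg _ (Pi.single_eq_same i 1)).trans (zpow_one _)

lemma range_unitHom_le (v : Fin d → Lˣ) {E : IntermediateField k L} (hv : ∀ i, (v i : L) ∈ E) :
    (unitHom (k := k) F v).range ≤ E.toSubalgebra := by
  rintro _ ⟨x, rfl⟩
  change unitHom F v x ∈ E
  induction x using AddMonoidAlgebra.induction_on with
  | of m => exact unitHom_single (k := k) F v m ▸ prod_mem fun i _ => zpow_mem (hv i) _
  | add x y hx hy => exact map_add (unitHom F v) x y ▸ add_mem hx hy
  | smul r x hx => exact map_smul (unitHom F v) r x ▸ E.smul_mem hx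

/-- The comorphism of the morphism `Spec L → T × T` to the square of the torus with coordinates `v`
and `w`. -/
def unitHom₂ (v w : Fin d → Lˣ) : AddMonoidAlgebra k (dualMonoid F.zeroCone.1) ⊗[k]
    AddMonoidAlgebra k (dualMonoid F.zeroCone.1) →ₐ[k] L :=
  Algebra.TensorProduct.productMap (unitHom F v) (unitHom F w)

/-- The monomials form a basis of the functions on the square of the torus, which `unitHom₂` maps to
Laurent monomials in the coordinates. -/
lemma unitHom₂_injective {v w : Fin d → Lˣ}
    (h : AlgebraicIndependent k (Sum.elim (fun i => (v i : L)) fun i => (w i : L))) :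
    Function.Injective (unitHom₂ (k := k) F v w) := by
  let b := AddMonoidAlgebra.basis (dualMonoid F.zeroCone.1) k
  let expo (m : dualMonoid F.zeroCone.1 × dualMonoid F.zeroCone.1) : Fin d ⊕ Fin d → ℤ :=
    Sum.elim m.1.1 m.2.1
  have hexpo : Function.Injective expo := fun m n hmn =>
    Prod.ext (Subtype.ext (funext fun i => congrFun hmn (Sum.inl i)))
      (Subtype.ext (funext fun i => congrFun hmn (Sum.inr i)))
  have hmonomial (m) : (unitHom₂ (k := k) F v w).toLinearMap (b.tensorProduct b m) =
      ∏ i, Sum.elim (fun i => (v i : L)) (fun i => (w i : L)) i ^ expo m i := by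
    have hb : b.tensorProduct b m =
        AddMonoidAlgebra.single m.1 1 ⊗ₜ AddMonoidAlgebra.single m.2 1 := by
      rw [Module.Basis.tensorProduct_apply]
      simp [b]
    rw [hb, AlgHom.toLinearMap_apply, unitHom₂, Algebra.TensorProduct.productMap_apply_tmul,
      unitHom_single, unitHom_single]
    simp [expo]
  have hli := (linearIndependent_prod_zpow h).comp expo hexpo
  simp only [Function.comp_def, ← hmonomial] at hli
  exact LinearMap.injective_of_linearIndependent (b.tensorProduct b).span_eq hli

lemma fieldRange_eq_adjoin_of_comp_eq_unitHom₂ {K : Type u} [Field K]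
    [Algebra (AddMonoidAlgebra k (dualMonoid F.zeroCone.1) ⊗[k]
      AddMonoidAlgebra k (dualMonoid F.zeroCone.1)) K]
    [IsFractionRing (AddMonoidAlgebra k (dualMonoid F.zeroCone.1) ⊗[k]
      AddMonoidAlgebra k (dualMonoid F.zeroCone.1)) K] {φ : K →+* L} {v w : Fin d → Lˣ}
    (hφ : φ.comp (algebraMap _ K) = (unitHom₂ (k := k) F v w).toRingHom) :
    φ.fieldRange = (IntermediateField.adjoin k
      (Set.range (Sum.elim (fun i => (v i : L)) fun i => (w i : L)))).toSubfield := by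
  have hrange := Algebra.TensorProduct.productMap_range (unitHom (k := k) F v) (unitHom F w)
  refine fieldRange_eq_adjoin (unitHom₂ F v w) ?_ ?_ hφ
  · rintro _ ⟨i | i, rfl⟩
    · exact hrange.ge (le_sup_left (α := Subalgebra k L) (mem_range_unitHom F v i))
    · exact hrange.ge (le_sup_right (α := Subalgebra k L) (mem_range_unitHom F w i))
  · exact hrange.le.trans (sup_le
      (range_unitHom_le F v fun i => IntermediateField.subset_adjoin _ _ ⟨.inl i, rfl⟩)
      (range_unitHom_le F w fun i => IntermediateField.subset_adjoin _ _ ⟨.inr i, rfl⟩))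

end

/-! ## The square of the affine line -/

lemma algebraMap_mem_adjoin {k B L : Type*} [Field k] [CommRing B] [IsDomain B] [Field L]
    [Algebra k B] [Algebra B L] [Algebra k L] [IsScalarTower k B L]
    (hinj : Function.Injective (algebraMap B L)) {S : Set B}
    (hS : IntermediateField.adjoin k (algebraMap B (FractionRing B) '' S) = ⊤) (b : B) :
    algebraMap B L b ∈ IntermediateField.adjoin k (algebraMap B L '' S) := by
  let f : FractionRing B →ₐ[k] L :=
    IsFractionRing.liftAlgHom (g := IsScalarTower.toAlgHom k B L) hinj
  have hf (b : B) : f (algebraMap B _ b) = algebraMap B L b := IsFractionRing.lift_algebraMap hinj b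
  have himage : f '' (algebraMap B (FractionRing B) '' S) = algebraMap B L '' S := by
    simp only [Set.image_image, hf]
  rw [← himage, ← IntermediateField.adjoin_map, hS, ← hf]
  exact ⟨_, IntermediateField.mem_top, rfl⟩

lemma trdeg_pair (k B L : Type u) [Field k] [CommRing B] [IsDomain B] [Field L] [Algebra k B]
    [Algebra k L] [Algebra (Polynomial B ⊗[B] Polynomial B) L]
    [IsFractionRing (Polynomial B ⊗[B] Polynomial B) L]
    [IsScalarTower k (Polynomial B ⊗[B] Polynomial B) L] {n : ℕ}
    (h : Algebra.trdeg k B = n) : Algebra.trdeg k L = (2 + n : ℕ) := by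
  have hdom : IsDomain (Polynomial B ⊗[B] Polynomial B) := isDomain_tensor_polynomial B _
  have hfaithful : FaithfulSMul (Polynomial B) (Polynomial B ⊗[B] Polynomial B) :=
    (faithfulSMul_iff_algebraMap_injective (Polynomial B) (Polynomial B ⊗[B] Polynomial B)).2
      (Algebra.TensorProduct.includeLeft_injective (S := B) Polynomial.C_injective)
  have halg : Algebra.IsAlgebraic (Polynomial B ⊗[B] Polynomial B) L :=
    IsLocalization.isAlgebraic L (nonZeroDivisors _)
  calc Algebra.trdeg k L = Algebra.trdeg k (Polynomial B ⊗[B] Polynomial B) := by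
        rw [← trdeg_add_eq k (Polynomial B ⊗[B] Polynomial B),
          trdeg_eq_zero (R := Polynomial B ⊗[B] Polynomial B), add_zero]
    _ = Algebra.trdeg k (Polynomial B) + 1 := by
        rw [← trdeg_add_eq k (Polynomial B), ← (polyEquivTensor' B (Polynomial B)).trdeg_eq,
          Polynomial.trdeg_of_isDomain]
    _ = Algebra.trdeg k B + 1 + 1 := by rw [← trdeg_add_eq k B, Polynomial.trdeg_of_isDomain]
    _ = (2 + n : ℕ) := by
        rw [h]
        norm_cast
        omega

section

variable (B L : Type u) [CommRing B] [Field L] [Algebra B L]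
  [Algebra (Polynomial B ⊗[B] Polynomial B) L] [IsScalarTower B (Polynomial B ⊗[B] Polynomial B) L]

/-- The pullback of functions along the `l`-th projection of the square of the affine line. -/
def pairEval (l : Fin 2) : Polynomial B →ₐ[B] L :=
  (IsScalarTower.toAlgHom B (Polynomial B ⊗[B] Polynomial B) L).comp
    (![Algebra.TensorProduct.includeLeft, Algebra.TensorProduct.includeRight] l)

/-- The `l`-th coordinate on the square of the affine line. -/
def pairCoord (l : Fin 2) : L := pairEval B L l Polynomial.X

lemma algebraMap_tensor_mem (S : Subring L) (hB : ∀ b, algebraMap B L b ∈ S)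
    (hS : ∀ l, pairCoord B L l ∈ S) (z : Polynomial B ⊗[B] Polynomial B) :
    algebraMap _ L z ∈ S := by
  have heval (l) (q : Polynomial B) : pairEval B L l q ∈ S := by
    induction q using Polynomial.induction_on with
    | C b => exact (AlgHom.commutes (pairEval B L l) b).symm ▸ hB b
    | add q r hq hr => exact map_add (pairEval B L l) q r ▸ add_mem hq hr
    | monomial n b h =>
      rw [pow_succ, ← mul_assoc, map_mul]
      exact mul_mem h (hS l)
  induction z using TensorProduct.induction_on with
  | zero => simp only [map_zero, zero_mem]
  | add x y hx hy => simp only [map_add, add_mem hx hy]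
  | tmul x y =>
    rw [← one_mul y, ← mul_one x, ← Algebra.TensorProduct.tmul_mul_tmul, map_mul]
    exact mul_mem (heval 0 x) (heval 1 y)

variable [IsFractionRing (Polynomial B ⊗[B] Polynomial B) L]

lemma pairEval_injective (l : Fin 2) : Function.Injective (pairEval B L l) := by
  refine (IsFractionRing.injective (Polynomial B ⊗[B] Polynomial B) L).comp ?_
  revert l
  refine Fin.forall_fin_two.2 ⟨?_, ?_⟩
  · exact Algebra.TensorProduct.includeLeft_injective (S := B) Polynomial.C_injective
  · exact Algebra.TensorProduct.includeRight_injective Polynomial.C_injective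

lemma algebraMap_injective_of_pair : Function.Injective (algebraMap B L) := by
  rw [← (pairEval B L 0).comp_algebraMap]
  exact (pairEval_injective B L 0).comp Polynomial.C_injective

lemma pairCoord_ne_algebraMap [Nontrivial B] (l : Fin 2) (b : B) :
    pairCoord B L l ≠ algebraMap B L b := fun h =>
  Polynomial.X_sub_C_ne_zero b <| sub_eq_zero.2 <| pairEval_injective B L l <|
    h.trans ((pairEval B L l).commutes b).symm

/-- The first coordinate restricts to a non-constant function on `t_1 = 0`. -/
lemma pairCoord_zero_ne_one [Nontrivial B] : pairCoord B L 0 ≠ pairCoord B L 1 := by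
  intro h
  have hX := congrArg (Algebra.TensorProduct.productMap (AlgHom.id B (Polynomial B))
    ((Algebra.ofId B _).comp (Polynomial.aeval 0)))
    (IsFractionRing.injective (Polynomial B ⊗[B] Polynomial B) L h)
  simp [Polynomial.X_ne_zero] at hX

lemma adjoin_pairCoord_eq_top (k : Type u) [Field k] [Algebra k B] [Algebra k L] [IsDomain B]
    [IsScalarTower k B L] {ι : Type*} {g : ι → B}
    (hg : IntermediateField.adjoin k (Set.range (algebraMap B (FractionRing B) ∘ g)) = ⊤) :
    IntermediateField.adjoin k
      (Set.range (Sum.elim (pairCoord B L) (algebraMap B L ∘ g))) = ⊤ := by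
  set E := IntermediateField.adjoin k (Set.range (Sum.elim (pairCoord B L) (algebraMap B L ∘ g)))
  have hB (b : B) : algebraMap B L b ∈ E := by
    rw [Set.range_comp] at hg
    refine IntermediateField.adjoin.mono k _ _ ?_
      (algebraMap_mem_adjoin (algebraMap_injective_of_pair B L) hg b)
    rintro _ ⟨_, ⟨i, rfl⟩, rfl⟩
    exact ⟨.inr i, rfl⟩
  have hE (z : Polynomial B ⊗[B] Polynomial B) : algebraMap _ L z ∈ E :=
    algebraMap_tensor_mem B L E.toSubring hB
      (fun l => IntermediateField.subset_adjoin _ _ ⟨.inl l, rfl⟩) z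
  refine top_le_iff.1 fun y _ => ?_
  obtain ⟨a, b, -, rfl⟩ := IsFractionRing.div_surjective (A := Polynomial B ⊗[B] Polynomial B) y
  exact div_mem (hE a) (hE b)

end

/-! ## Separability of the two-point evaluation morphism -/

section

variable {k : Type u} [Field k] {d : ℕ} (F : Fan d) {X : Scheme.{u}} (e : X ≅ F.toricVariety k)
  {str : X ⟶ Spec (.of k)} (he : e.hom ≫ F.toricStr k = str)

lemma isDomain_tensor_dualMonoid (σ σ' : F.cones) :
    IsDomain (AddMonoidAlgebra k (dualMonoid σ.1) ⊗[k] AddMonoidAlgebra k (dualMonoid σ'.1)) := by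
  have : UniqueSums (dualMonoid σ'.1) := .of_injective_addHom
    (dualMonoid σ'.1).subtype.toAddHom Subtype.val_injective inferInstance
  exact isDomain_tensor_addMonoidAlgebra k _ _

include he in
lemma isIntegral_pullback_toric [IsIntegral X] : IsIntegral (pullback str str) :=
  have : Nonempty F.cones := ⟨F.zeroCone⟩
  isIntegral_pullback_self str (chartTo F e) (exists_chartTo_eq F e) (chartTo_comp F e he)
    (isDomain_tensor_dualMonoid F)

variable {L : Type u} [Field L] [Algebra k L] (v w : Fin d → Lˣ)

/-- The affine chart of `X × X` which is the square of the torus. -/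
def torusSquare : Spec (.of (AddMonoidAlgebra k (dualMonoid F.zeroCone.1) ⊗[k]
    AddMonoidAlgebra k (dualMonoid F.zeroCone.1))) ⟶ pullback str str :=
  prodChart str (chartTo F e F.zeroCone) (chartTo F e F.zeroCone) (chartTo_comp F e he _)
    (chartTo_comp F e he _)

instance : IsOpenImmersion (torusSquare F e he) := by
  unfold torusSquare
  infer_instance

lemma SpecMap_unitHom₂_fst : Spec.map (CommRingCat.ofHom (unitHom₂ (k := k) F v w).toRingHom) ≫
    torusSquare F e he ≫ pullback.fst str str = torusMap F e v := by
  rw [torusSquare, prodChart_fst, ← Category.assoc, ← Spec.map_comp, ← CommRingCat.ofHom_comp,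
    torusMap]
  congr 3
  exact congrArg AlgHom.toRingHom
    (Algebra.TensorProduct.productMap_left (unitHom (k := k) F v) (unitHom F w))

lemma SpecMap_unitHom₂_snd : Spec.map (CommRingCat.ofHom (unitHom₂ (k := k) F v w).toRingHom) ≫
    torusSquare F e he ≫ pullback.snd str str = torusMap F e w := by
  rw [torusSquare, prodChart_snd, ← Category.assoc, ← Spec.map_comp, ← CommRingCat.ofHom_comp,
    torusMap]
  congr 3
  exact congrArg AlgHom.toRingHom
    (Algebra.TensorProduct.productMap_right (unitHom (k := k) F v) (unitHom F w))

end

section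

variable (k B : Type u) [Field k] [CommRing B] [Algebra k B]

lemma exists_mem_range_relChart (x : relLine k B) : ∃ i, x ∈ Set.range (relChart k B i) := by
  rcases mem_range_relChart k B x with h | h
  exacts [⟨0, h⟩, ⟨1, h⟩]

variable [IsDomain B]

instance : IsIntegral (relLine k B) := by
  refine isIntegral_of_cover (relChart k B) (exists_mem_range_relChart k B) ?_
  have hgen : ∀ i, relChart k B 1 (⊥ : PrimeSpectrum (Polynomial B)) ∈ Set.range (relChart k B i) :=
    Fin.forall_fin_two.2 ⟨(relChart_one_mem_range_zero k B ⊥).2 fun h => Polynomial.X_ne_zero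
      ((Submodule.mem_bot _).1 h), ⟨_, rfl⟩⟩
  exact fun i j => ⟨_, hgen i, hgen j⟩

lemma isIntegral_relLine_square :
    IsIntegral (pullback (pullback.fst (baseStr k B) (projectiveStr 1 k))
      (pullback.fst (baseStr k B) (projectiveStr 1 k))) :=
  isIntegral_pullback_self _ (relChart k B) (exists_mem_range_relChart k B) (relChart_fst k B)
    fun _ _ => isDomain_tensor_polynomial B _

/-- The affine chart of the square of the relative projective line which is the square of the affine
line. -/
def lineSquare : Spec (.of (Polynomial B ⊗[B] Polynomial B)) ⟶
    pullback (pullback.fst (baseStr k B) (projectiveStr 1 k))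
      (pullback.fst (baseStr k B) (projectiveStr 1 k)) :=
  prodChart _ (relChart k B 0) (relChart k B 0) (relChart_fst k B 0) (relChart_fst k B 0)

instance : IsOpenImmersion (lineSquare k B) := by
  unfold lineSquare
  infer_instance

end

section

variable {k B : Type u} [Field k] [CommRing B] [Algebra k B] [IsDomain B] {d : ℕ} (p : Fin d → B)
  (τ : Fin d → Bˣ) (N : ℕ) {L : Type u} [Field L] [Algebra k L] [Algebra B L]
  [Algebra (Polynomial B ⊗[B] Polynomial B) L] [IsScalarTower B (Polynomial B ⊗[B] Polynomial B) L]
  [IsFractionRing (Polynomial B ⊗[B] Polynomial B) L]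

variable (B L) in
/-- The extension of `pairEval` to rational functions. -/
def pairGeneric (l : Fin 2) : FractionRing (Polynomial B) →ₐ[B] L :=
  IsFractionRing.liftAlgHom (pairEval_injective B L l)

lemma pairGeneric_algebraMap (l : Fin 2) (q : Polynomial B) :
    pairGeneric B L l (algebraMap (Polynomial B) _ q) = pairEval B L l q :=
  IsFractionRing.lift_algebraMap (pairEval_injective B L l) q

/-- The torus coordinates of the image under the family of the `l`-th generic point. -/
def pairUnit (l : Fin 2) (i : Fin d) : Lˣ :=
  Units.map (pairGeneric B L l : FractionRing (Polynomial B) →* L) (genericUnit p τ N i)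

lemma val_pairUnit (l : Fin 2) : (fun i => (pairUnit (L := L) p τ N l i : L)) =
    coord N (fun i => algebraMap B L (τ i)) (algebraMap B L ∘ p) (pairCoord B L) l := by
  funext i
  change pairGeneric B L l (genericUnit p τ N i) = _
  rw [val_genericUnit, map_mul, map_pow, AlgHom.commutes, pairGeneric_algebraMap, map_sub]
  exact congrArg (fun c => _ * (_ - c) ^ N) ((pairEval B L l).commutes (p i))

section

variable [IsScalarTower k B L] [IsScalarTower k (Polynomial B ⊗[B] Polynomial B) L]
  (hN : (N : k) ≠ 0) (htrdeg : Algebra.trdeg k B = (d + d : ℕ))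
  (hgen : IntermediateField.adjoin k (Set.range
    (algebraMap B (FractionRing B) ∘ Sum.elim (fun i => (τ i : B)) p)) = ⊤)

include hN htrdeg hgen

lemma pairUnit_algebraicIndependent_and_isSeparablyGenerated :
    AlgebraicIndependent k (Sum.elim (fun i => (pairUnit (L := L) p τ N 0 i : L))
      fun i => (pairUnit (L := L) p τ N 1 i : L)) ∧
    ∀ {K : Type u} [Field K] (φ : K →+* L), φ.fieldRange = (IntermediateField.adjoin k
      (Set.range (Sum.elim (fun i => (pairUnit (L := L) p τ N 0 i : L))
        fun i => (pairUnit (L := L) p τ N 1 i : L)))).toSubfield → IsSeparablyGenerated K L φ := by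
  have hinj := algebraMap_injective_of_pair B L
  have hτ (i) : algebraMap B L (τ i) ≠ 0 := (map_ne_zero_iff _ hinj).2 (τ i).ne_zero
  have htp (l i) : pairCoord B L l ≠ algebraMap B L (p i) := pairCoord_ne_algebraMap B L l (p i)
  have ht := pairCoord_zero_ne_one B L
  have hNL : (N : L) ≠ 0 := by
    rw [← map_natCast (algebraMap k L)]
    exact (map_ne_zero _).2 hN
  have hgenL := adjoin_pairCoord_eq_top B L k hgen
  rw [Sum.comp_elim] at hgenL
  have htrdegL := trdeg_pair k B L htrdeg
  simp only [val_pairUnit]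
  exact ⟨(AlgebraicIndependent.sumElim_iff.1
    (algebraicIndependent_coord N _ _ _ hτ htp ht hNL hgenL htrdegL)).1,
    fun φ => isSeparablyGenerated_coord N _ _ _ hτ htp ht hNL hgenL htrdegL φ⟩

end

variable (hp : ∀ i j, i ≠ j → IsUnit (p i - p j)) (F : Fan d) {X : Scheme.{u}}
  (e : X ≅ F.toricVariety k) {σ : Fin (d + 1) → F.cones}
  {hu : ∀ j, ∀ m ∈ dualMonoid (σ j).1, 0 ≤ m ⬝ᵥ slope j} {ev : relLine k B ⟶ X} (hd : 0 < d)
  (hev : ∀ j, markChart k p j ≫ ev =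
    familyMap F e (σ j) (slope j) (hu j) (markUnit p τ N j) (markParam p N j))

include hp hd hev

lemma generic_relChart_ev :
    Spec.map (CommRingCat.ofHom (algebraMap (Polynomial B) (FractionRing (Polynomial B)))) ≫
      relChart k B 0 ≫ ev = torusMap (k := k) F e (genericUnit p τ N) := by
  let j : Fin d := ⟨0, hd⟩
  rw [← markGeneric_familyMap p τ N hp F e (σ j.succ) j.succ (hu j.succ), ← hev, markChart,
    Category.assoc, ← Category.assoc (Spec.map _) (Spec.map _), ← Spec.map_comp,
    ← CommRingCat.ofHom_comp, markGeneric_comp, genericHom_succ]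
  rfl

lemma SpecMap_pairEval_ev [IsScalarTower k B L] (l : Fin 2) :
    Spec.map (CommRingCat.ofHom (pairEval B L l).toRingHom) ≫ relChart k B 0 ≫ ev =
      torusMap (k := k) F e (pairUnit p τ N l) := by
  have hcomp : (pairEval B L l).toRingHom = (pairGeneric B L l).toRingHom.comp
      (algebraMap (Polynomial B) (FractionRing (Polynomial B))) :=
    RingHom.ext fun q => (pairGeneric_algebraMap l q).symm
  rw [hcomp, CommRingCat.ofHom_comp, Spec.map_comp, Category.assoc,
    generic_relChart_ev p τ N hp F e hd hev]
  exact SpecMap_torusMap F e ((pairGeneric B L l).restrictScalars k) (genericUnit p τ N)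

theorem isDominantSeparable_lift [IsIntegral X] {str : X ⟶ Spec (.of k)}
    (he : e.hom ≫ F.toricStr k = str) (hN : (N : k) ≠ 0)
    (htrdeg : Algebra.trdeg k B = (d + d : ℕ))
    (hgen : IntermediateField.adjoin k (Set.range
      (algebraMap B (FractionRing B) ∘ Sum.elim (fun i => (τ i : B)) p)) = ⊤)
    (h : (pullback.fst _ _ ≫ ev) ≫ str = (pullback.snd _ _ ≫ ev) ≫ str) :
    IsDominantSeparable (pullback.lift (f := str) (g := str)
      (pullback.fst (pullback.fst (baseStr k B) (projectiveStr 1 k))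
        (pullback.fst (baseStr k B) (projectiveStr 1 k)) ≫ ev) (pullback.snd _ _ ≫ ev) h) := by
  have := isDomain_tensor_polynomial B (Polynomial B)
  have := isIntegral_relLine_square k B
  have := isIntegral_pullback_toric F e he
  have := isDomain_tensor_dualMonoid (k := k) F F.zeroCone F.zeroCone
  refine isDominantSeparable_of_chart _ (lineSquare k B) (torusSquare F e he) fun L _ _ _ => ?_
  let _ : Algebra B L := Algebra.compHom L (algebraMap B (Polynomial B ⊗[B] Polynomial B))
  let _ : Algebra k L := Algebra.compHom L (algebraMap k (Polynomial B ⊗[B] Polynomial B))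
  have : IsScalarTower B (Polynomial B ⊗[B] Polynomial B) L :=
    @IsScalarTower.of_algebraMap_eq B (Polynomial B ⊗[B] Polynomial B) L _ _ _ _ _ _ fun _ => rfl
  have : IsScalarTower k (Polynomial B ⊗[B] Polynomial B) L :=
    @IsScalarTower.of_algebraMap_eq k (Polynomial B ⊗[B] Polynomial B) L _ _ _ _ _ _ fun _ => rfl
  have : IsScalarTower k B L := .of_algebraMap_eq fun _ => rfl
  obtain ⟨hind, hsep⟩ := pairUnit_algebraicIndependent_and_isSeparablyGenerated p τ N (L := L) hN
    htrdeg hgen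
  have hev' := SpecMap_pairEval_ev p τ N hp F e hd hev (L := L)
  refine ⟨(unitHom₂ F (pairUnit p τ N 0) (pairUnit p τ N 1)).toRingHom, unitHom₂_injective F hind,
    pullback.hom_ext ?_ ?_, fun K _ _ _ φ hφ =>
      hsep φ (fieldRange_eq_adjoin_of_comp_eq_unitHom₂ F hφ)⟩
  · simp only [Category.assoc, pullback.lift_fst]
    rw [SpecMap_unitHom₂_fst, ← hev', lineSquare, ← Category.assoc (prodChart _ _ _ _ _),
      prodChart_fst, Category.assoc, ← Category.assoc (Spec.map _), ← Spec.map_comp]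
    rfl
  · simp only [Category.assoc, pullback.lift_snd]
    rw [SpecMap_unitHom₂_snd, ← hev', lineSquare, ← Category.assoc (prodChart _ _ _ _ _),
      prodChart_snd, Category.assoc, ← Category.assoc (Spec.map _), ← Spec.map_comp]
    rfl

end

/-! ## The parameter space of the family -/

lemma adjoin_range_algebraMap_X_eq_top {k ι B K : Type*} [Field k] [CommRing B] [Field K]
    [Algebra k B] [Algebra (MvPolynomial ι k) B] [IsScalarTower k (MvPolynomial ι k) B]
    [Algebra k K] [Algebra B K] [IsScalarTower k B K] [IsFractionRing B K]
    (M : Submonoid (MvPolynomial ι k)) [IsLocalization M B] :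
    IntermediateField.adjoin k (Set.range fun i : ι =>
      algebraMap B K (algebraMap (MvPolynomial ι k) B (MvPolynomial.X i))) = ⊤ := by
  let E := IntermediateField.adjoin k
    (Set.range fun i => algebraMap B K (algebraMap (MvPolynomial ι k) B (MvPolynomial.X i)))
  let φ : MvPolynomial ι k →ₐ[k] K :=
    (IsScalarTower.toAlgHom k B K).comp (IsScalarTower.toAlgHom k (MvPolynomial ι k) B)
  have hpoly : ∀ q, φ q ∈ E := fun q => by
    have hle : Algebra.adjoin k (Set.range (MvPolynomial.X (R := k) (σ := ι))) ≤
        E.toSubalgebra.comap φ :=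
      Algebra.adjoin_le (Set.range_subset_iff.2 fun i =>
        IntermediateField.subset_adjoin _ _ ⟨i, rfl⟩)
    rw [MvPolynomial.adjoin_range_X] at hle
    exact hle Algebra.mem_top
  have hB : ∀ b : B, algebraMap B K b ∈ E := fun b => by
    obtain ⟨q, s, rfl⟩ := IsLocalization.exists_mk'_eq M b
    have hs : IsUnit (φ s) := (IsLocalization.map_units B s).map (algebraMap B K)
    have hmul : algebraMap B K (IsLocalization.mk' B q s) * φ s = φ q :=
      (map_mul _ _ _).symm.trans (congrArg _ (IsLocalization.mk'_spec B q s))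
    rw [eq_div_of_mul_eq hs.ne_zero hmul]
    exact div_mem (hpoly q) (hpoly s)
  refine eq_top_iff.2 fun x _ => ?_
  obtain ⟨a, b, -, rfl⟩ := IsFractionRing.div_surjective (A := B) x
  exact div_mem (hB a) (hB b)

section

variable (k : Type u) [Field k] (d : ℕ)

/-- The equation of the complement in affine `2d`-space of the parameter space of the family: there
the scaling factors `τ_i` are nonzero and the points `p_i` are distinct. -/
def paramDenom : MvPolynomial (Fin d ⊕ Fin d) k :=
  (∏ i, MvPolynomial.X (Sum.inl i)) * ∏ q ∈ Finset.univ.offDiag,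
    (MvPolynomial.X (Sum.inr q.1) - MvPolynomial.X (Sum.inr q.2))

lemma powers_paramDenom_le_nonZeroDivisors :
    Submonoid.powers (paramDenom k d) ≤ nonZeroDivisors (MvPolynomial (Fin d ⊕ Fin d) k) := by
  refine powers_le_nonZeroDivisors_of_noZeroDivisors <|
    mul_ne_zero (Finset.prod_ne_zero_iff.2 fun i _ => MvPolynomial.X_ne_zero _)
      (Finset.prod_ne_zero_iff.2 fun q hq h => (Finset.mem_offDiag.1 hq).2.2 ?_)
  exact Sum.inr_injective (MvPolynomial.X_injective (sub_eq_zero.1 h))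

/-- The coordinate ring of the parameter space, over which the `τ_i` are units and the differences
of the `p_i` are invertible. -/
abbrev ParamRing : Type u := Localization.Away (paramDenom k d)

instance : IsDomain (ParamRing k d) :=
  IsLocalization.isDomain_localization (powers_paramDenom_le_nonZeroDivisors k d)

instance : Algebra.FiniteType k (ParamRing k d) :=
  have := IsLocalization.Away.finitePresentation (S := ParamRing k d) (paramDenom k d)
  .trans (S := MvPolynomial (Fin d ⊕ Fin d) k) inferInstance inferInstance

lemma isUnit_of_dvd_paramDenom {a : MvPolynomial (Fin d ⊕ Fin d) k} (h : a ∣ paramDenom k d) :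
    IsUnit (algebraMap _ (ParamRing k d) a) :=
  isUnit_of_dvd_unit (map_dvd _ h) (IsLocalization.Away.algebraMap_isUnit (paramDenom k d))

/-- The universal scaling factors `τ_i`. -/
def paramUnit (i : Fin d) : (ParamRing k d)ˣ :=
  (isUnit_of_dvd_paramDenom k d (a := MvPolynomial.X (Sum.inl i))
    (Dvd.dvd.mul_right (Finset.dvd_prod_of_mem _ (Finset.mem_univ i)) _)).unit

/-- The universal points `p_i` of the affine line. -/
def paramPoint (i : Fin d) : ParamRing k d :=
  algebraMap _ _ (MvPolynomial.X (Sum.inr i) : MvPolynomial (Fin d ⊕ Fin d) k)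

lemma isUnit_paramPoint_sub (i j : Fin d) (h : i ≠ j) :
    IsUnit (paramPoint k d i - paramPoint k d j) := by
  rw [paramPoint, paramPoint, ← map_sub]
  exact isUnit_of_dvd_paramDenom k d (Dvd.dvd.mul_left
    (Finset.dvd_prod_of_mem (fun q : Fin d × Fin d => MvPolynomial.X (Sum.inr q.1) -
      MvPolynomial.X (Sum.inr q.2)) (Finset.mem_offDiag.2
      ⟨Finset.mem_univ i, Finset.mem_univ j, h⟩ : (i, j) ∈ _)) _)

lemma trdeg_paramRing : Algebra.trdeg k (ParamRing k d) = (d + d : ℕ) := by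
  have := (faithfulSMul_iff_algebraMap_injective _ _).2
    (IsLocalization.injective (ParamRing k d) (powers_paramDenom_le_nonZeroDivisors k d))
  have : Algebra.IsAlgebraic (MvPolynomial (Fin d ⊕ Fin d) k) (ParamRing k d) :=
    IsLocalization.isAlgebraic _ (Submonoid.powers (paramDenom k d))
  have hadd := trdeg_add_eq k (MvPolynomial (Fin d ⊕ Fin d) k) (A := ParamRing k d)
  rw [MvPolynomial.trdeg_of_isDomain, trdeg_eq_zero, add_zero] at hadd
  rw [← hadd]
  simp

lemma adjoin_paramUnit_paramPoint :
    IntermediateField.adjoin k (Set.range (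
      algebraMap (ParamRing k d) (FractionRing (ParamRing k d)) ∘
        Sum.elim (fun i => (paramUnit k d i : ParamRing k d)) (paramPoint k d))) = ⊤ := by
  rw [← adjoin_range_algebraMap_X_eq_top (B := ParamRing k d) (Submonoid.powers (paramDenom k d))]
  congr! 2
  funext i
  cases i <;> rfl

end

/-! ## Contact orders of Campana type -/

lemma exists_dotProduct_slope_eq_one {d : ℕ} (hd : 0 < d) (j : Fin (d + 1)) :
    ∃ m, m ⬝ᵥ slope j = 1 := by
  refine Fin.cases ⟨Pi.single ⟨0, hd⟩ (-1), ?_⟩ (fun j => ⟨Pi.single j 1, ?_⟩) j <;>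
    simp [slope]

lemma not_forall_ringChar_dvd_mul {k ι κ : Type*} [Ring k] [IsDomain k] [Fintype κ] {N : ℕ}
    (hN : (N : k) ≠ 0) {c : ι → ℕ} {u : κ → ℤ} (hu : ∃ m, m ⬝ᵥ u = 1)
    (hc : (∀ i, (c i : k) = 0) → ∀ m, ((m ⬝ᵥ u : ℤ) : k) = 0) :
    ¬ ∀ i, ringChar k ∣ N * c i := by
  intro hdvd
  obtain ⟨m, hm⟩ := hu
  have hzero := hc (fun i => ?_) m
  · rw [hm, Int.cast_one] at hzero
    exact one_ne_zero hzero
  · have hmul := (ringChar.spec k _).2 (hdvd i)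
    rw [Nat.cast_mul] at hmul
    exact (mul_eq_zero.1 hmul).resolve_left hN

lemma ne_zero_of_not_forall_dvd {ι : Type*} {q : ℕ} {c : ι → ℕ} (h : ¬ ∀ i, q ∣ c i) : c ≠ 0 := by
  rintro rfl
  exact h fun _ => dvd_zero q

lemma exists_le_natCast_ne_zero (R : Type*) [AddMonoidWithOne R] [NeZero (1 : R)] (M : ℕ) :
    ∃ N, M ≤ N ∧ (N : R) ≠ 0 := by
  by_cases h : (M : R) = 0
  · exact ⟨M + 1, M.le_succ, by rw [Nat.cast_succ, h, zero_add]; exact one_ne_zero⟩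
  · exact ⟨M, le_rfl, h⟩

section

variable {k : Type u} [Field k] {O : Orbifold k} (hklt : O.IsKlt)

include hklt

lemma exists_forall_mult_le : ∃ M : ℕ, ∀ i, O.mult i ≤ M := by
  have := O.finite
  obtain ⟨M, hM⟩ := (Set.finite_range fun i => (O.mult i).toNat).bddAbove
  refine ⟨M, fun i => ?_⟩
  rw [← ENat.natCast_toNat (hklt i)]
  exact_mod_cast hM ⟨i, rfl⟩

lemma isCampanaType_mul {N : ℕ} (hN : ∀ i, O.mult i ≤ N) {n : ℕ} (c : Fin n → O.ι → ℕ) :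
    O.IsCampanaType fun j i => N * c j i := by
  refine fun i => ⟨fun _ j => ?_, fun h => absurd h (hklt i)⟩
  obtain h | h := Nat.eq_zero_or_pos (c j i)
  · exact .inl (mul_eq_zero_of_right N h)
  · exact .inr ((hN i).trans (by exact_mod_cast Nat.le_mul_of_pos_right N h))

end

theorem exists_isSeparablyRationallyConnected {k : Type u} [Field k] {d : ℕ} (hd : 0 < d)
    (F : Fan d) (O : Orbifold k) (e : O.X ≅ F.toricVariety k)
    (he : e.hom ≫ F.toricStr k = O.str) (hΔ : e.hom ⁻¹' F.toricBoundary k = O.boundary) {N : ℕ}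
    (hN : (N : k) ≠ 0) :
    ∃ c : Fin (d + 1) → O.ι → ℕ, (∀ j, ¬ ∀ i, ringChar k ∣ N * c j i) ∧
      O.IsSeparablyRationallyConnected fun j i => N * c j i := by
  have := O.isIntegral
  have := O.projective.isProper
  have : IsSeparated O.str := inferInstance
  choose σ hu c hc hchar using fun j => exists_contact_orders F e hΔ (slope j) he
  have hgood : ∀ j, ¬ ∀ i, ringChar k ∣ N * c j i := fun j =>
    not_forall_ringChar_dvd_mul hN (exists_dotProduct_slope_eq_one hd j) (hchar j)
  let p := paramPoint k d
  let τ := paramUnit k d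
  have hp := isUnit_paramPoint_sub k d
  obtain ⟨ev, hev, hstr⟩ := exists_ev p τ N hp F e he hd σ hu
  refine ⟨c, hgood, logFamily p hp hd ev hstr _ (fun i => ?_)
    (ne_zero_of_not_forall_dvd (hgood 0)), ?_⟩
  · exact contact_formula p τ N hp F e σ hu hd hev (O.Δ i).isClosed (fun j => c j i)
      fun j => hc j i
  · exact isDominantSeparable_lift p τ N hp F e hd hev he hN (trdeg_paramRing k d)
      (adjoin_paramUnit_paramPoint k d) _

end

end Campana

theorem corollary7p3_general {k : Type*} [Field k] {d : ℕ} (hd : 0 < d)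
    (F : Campana.Fan d) (O : Campana.Orbifold k) (hklt : O.IsKlt)
    (e : O.X ≅ F.toricVariety k) (he : e.hom ≫ F.toricStr k = O.str)
    (hΔ : e.hom ⁻¹' F.toricBoundary k = O.boundary) :
    O.IsSeparablyCampanaRationallyConnectedByGoodContactOrders := by
  obtain ⟨M, hM⟩ := Campana.exists_forall_mult_le hklt
  obtain ⟨N, hMN, hN⟩ := Campana.exists_le_natCast_ne_zero k M
  obtain ⟨c, hgood, hconn⟩ :=
    Campana.exists_isSeparablyRationallyConnected hd F O e he hΔ hN
  refine ⟨d + 1, fun j i => N * c j i,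
    fun j => Campana.ne_zero_of_not_forall_dvd (hgood j), ?_, hgood, hconn⟩
  exact Campana.isCampanaType_mul hklt (fun i => (hM i).trans (by exact_mod_cast hMN)) c

theorem corollary7p3 {k : Type*} [Field k] [IsAlgClosed k] {d : ℕ} (hd : 0 < d)
    (F : Campana.Fan d) (O : Campana.Orbifold k) (hklt : O.IsKlt)
    (e : O.X ≅ F.toricVariety k) (he : e.hom ≫ F.toricStr k = O.str)
    (hΔ : e.hom ⁻¹' F.toricBoundary k = O.boundary) :
    O.IsSeparablyCampanaRationallyConnectedByGoodContactOrders :=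
  corollary7p3_general hd F O hklt e he hΔ
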